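/- Let $\mathbb T=\mathbb R/\mathbb Z$. For $f\in L^1(\mathbb T)$ put $\hat f(k)=\int_{\mathbb T}e^{-2i\pi kx}f(x)\,dx$ and $P_0f=\hat f(0)=\int_{\mathbb T}f\,dx$, let $\langle x\rangle=(1+|x|^2)^{1/2}$, and for $s\ge 0$ let $\|f\|_{H^s}=\big(\sum_{k\in\mathbb Z}\langle k\rangle^{2s}|\hat f(k)|^2\big)^{1/2}$ be the norm of $H^s(\mathbb T)$. For functions on $\mathbb R\times\mathbb T$ and $s\in\mathbb R$, $b\ge0$, let $$\|u\|_{X^{s,b}}=\Big(\sum_{k\in\mathbb Z}\int_{\mathbb R}\langle 2\pi\tau-(2\pi k)^3\rangle^{2b}\langle k\rangle^{2s}|\mathcal F u(\tau,k)|^2\,d\tau\Big)^{1/2}$$ be the Bourgain norm associated with the linear group $e^{-t\partial_x^3}$, where $\mathcal Fu(\tau,k)$ is the Fourier transform in $(t,x)$ with kernel $e^{-2i\pi(\tau t+kx)}$. For $s\ge0$ let $Z^s=X^{s-\frac{11}{10},1}\cap L^\infty_tH^s_x$ with norm $\|u\|_{Z^s}=\|u\|_{X^{s-\frac{11}{10},1}}+\|u\|_{L^\infty(\mathbb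 R;H^s)}$. For $T>0$, $Z^s_T$ is the space of functions $u$ on $]0,T[\times\mathbb T$ for which $$\|u\|_{Z^s_T}=\inf\{\|\tilde u\|_{Z^s}:\ \tilde u:\mathbb R\times\mathbb T\to\mathbb C,\ \tilde u|_{]0,T[\times\mathbb T}=u\}<\infty .$$ For $s\ge \frac16$ and $u_0\in H^s(\mathbb T)$ real-valued, a real-valued function $u\in L^\infty(0,T;H^s(\mathbb T))$ is a solution on $]0,T[$, with initial datum $u_0$, of the renormalized mKdV equation $$u_t+\partial_x^3u+\partial_x\big(u^3-3P_0(u^2)u\big)=0$$ if for every $\phi\in C_c^\infty(]-T,T[\times\mathbb T)$ $$\int_0^T\!\!\int_{\mathbb T}\Big[(\phi_t+\partial_x^3\phi)\,u+\phi_x\big(u^3-3P_0(u^2)u\big)\Big]dx\,dt+\int_{\mathbb T}\phi(0,x)u_0(x)\,dx=0 .$$ **Proposition (energy estimate).** Let $s>\frac29$. There is a constant $C$, depending only on $s$, such that for every $0<T\le1$, every real-valued $u_0\in H^s(\mathbb T)$ and every solution $u\in Z^s_T$ of the renormalized mKdV equation on $]0,T[$ with initial datum $u_0$, $$\|u\|_{L^\infty(0,T;H^s)}^2\le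 C\Big(\|u_0\|_{H^s}^2+T^{1/8}\|u\|_{Z^s_T}^4\Big).$$ -/

import Mathlib

open MeasureTheory Set
open scoped ENNReal NNReal ContDiff FourierTransform

noncomputable section

namespace MKdV

/-- The torus `𝕋 = ℝ / ℤ`, with its Lebesgue (probability) measure `volume`. -/
abbrev Torus : Type := UnitAddCircle

/-- The squared Japanese bracket `⟨x⟩² = 1 + |x|²`. -/
def bracketSq (x : ℝ) : ℝ := 1 + x ^ 2

/-! ### Sobolev norm on the torus -/

open Classical in
/-- The `H^s(𝕋)` norm `(∑ₖ ⟨k⟩^{2s} |f̂(k)|²)^{1/2}` of a function `f`, where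
`f̂(k) = ∫_𝕋 e^{-2iπkx} f(x) dx`; it is `∞` if `f` is not integrable (so that for `s ≥ 0` it is
finite exactly for the functions that belong to `H^s(𝕋) ⊆ L²(𝕋)`). -/
def sobolevNorm (s : ℝ) (f : Torus → ℂ) : ℝ≥0∞ :=
  if Integrable f then
    (∑' k : ℤ, ENNReal.ofReal (bracketSq k ^ s) * ‖fourierCoeff f k‖ₑ ^ 2) ^ (1 / 2 : ℝ)
  else ⊤

/-- The norm of `L^∞(I; H^s(𝕋))` for a set of times `I` (essential supremum over `t ∈ I`). -/
def linftySobolevNorm (I : Set ℝ) (s : ℝ) (u : ℝ → Torus → ℂ) : ℝ≥0∞ :=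
  essSup (fun t => sobolevNorm s (u t)) (volume.restrict I)

/-! ### Bourgain spaces, and the space `Z^s` -/

open Classical in
/-- The norm of the Bourgain space `X^{s,b}`, `b ≥ 0`, associated with the group
`U(t) = e^{-t ∂ₓ³}` on `𝕋 = ℝ / ℤ`.  For `b ≥ 0`, an element of `X^{s,b}` has each spatial
Fourier coefficient `t ↦ û(t, k)` in `L²(ℝ)`, so that its time Fourier transform is that of
`L²(ℝ)`, here in the normalization `∫ e^{-2iπτt} f(t) dt`.  In this normalization the space-time
Fourier transform of a free solution `U(t) u₀` is carried by the curve `2πτ = (2πk)³`. -/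
def bourgainNorm (s b : ℝ) (u : ℝ → Torus → ℂ) : ℝ≥0∞ :=
  if h : ∀ k : ℤ, MemLp (fun t : ℝ => fourierCoeff (u t) k) 2 volume then
    (∑' k : ℤ, ∫⁻ τ : ℝ,
      ENNReal.ofReal
          (bracketSq (2 * Real.pi * τ - (2 * Real.pi * k) ^ 3) ^ b * bracketSq k ^ s) *
        ‖(𝓕 (h k).toLp : Lp ℂ 2 (volume : Measure ℝ)) τ‖ₑ ^ 2) ^ (1 / 2 : ℝ)
  else ⊤

/-- The norm of `Z^s = X^{s - 11/10, 1} ∩ L^∞_t H^s_x` (`s ≥ 0`). -/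
def zNorm (s : ℝ) (u : ℝ → Torus → ℂ) : ℝ≥0∞ :=
  bourgainNorm (s - 11 / 10) 1 u + linftySobolevNorm univ s u

/-- Regard a real-valued function of space and time as a complex-valued one. -/
def toComplex (u : ℝ → Torus → ℝ) : ℝ → Torus → ℂ := fun t x => (u t x : ℂ)

/-- `v : ℝ × 𝕋 → ℂ` is a (measurable) extension of the restriction of `u` to `]0,T[ × 𝕋`. -/
structure IsExtension (T : ℝ) (u v : ℝ → Torus → ℂ) : Prop where
  aestronglyMeasurable :
    AEStronglyMeasurable (fun p : ℝ × Torus => v p.1 p.2) (volume.prod volume)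
  ae_eq : ∀ᵐ p : ℝ × Torus ∂((volume.restrict (Ioo 0 T)).prod volume), v p.1 p.2 = u p.1 p.2

/-- The norm of the restriction space `Z^s_T`: the infimum of `‖v‖_{Z^s}` over all extensions `v`
of `u` from `]0,T[` to `ℝ`. Only the values of `u` at times in `]0,T[` matter, and
`u ∈ Z^s_T` means that this norm is finite. -/
def zNormT (T s : ℝ) (u : ℝ → Torus → ℂ) : ℝ≥0∞ :=
  ⨅ (v : ℝ → Torus → ℂ) (_ : IsExtension T u v), zNorm s v

/-! ### The renormalized mKdV equation -/

/-- Time derivative of a function on `ℝ × 𝕋`. -/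
def dt (φ : ℝ → Torus → ℝ) (t : ℝ) (x : Torus) : ℝ := deriv (fun r : ℝ => φ r x) t

/-- Spatial derivative of order `n` of a function on `ℝ × 𝕋`. -/
def dx (n : ℕ) (φ : ℝ → Torus → ℝ) (t : ℝ) (x : Torus) : ℝ :=
  iteratedDeriv n (fun h : ℝ => φ t (x + (h : Torus))) 0

/-- `φ ∈ C_c^∞(]-T,T[ × 𝕋)`. -/
structure IsTestFunction (T : ℝ) (φ : ℝ → Torus → ℝ) : Prop where
  contDiff : ContDiff ℝ ∞ (fun p : ℝ × ℝ => φ p.1 (p.2 : Torus))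
  support : ∃ a < T, ∀ t x, a ≤ |t| → φ t x = 0

/-- The renormalized nonlinearity `F(f) = f³ - 3 P₀(f²) f`, with `P₀` the mean value over `𝕋`. -/
def nonlinearity (f : Torus → ℝ) (x : Torus) : ℝ := f x ^ 3 - 3 * (∫ y, f y ^ 2) * f x

/-- `u ∈ L^∞(0,T; H^s(𝕋))` is a real-valued solution, in the sense of distributions, of the
renormalized mKdV equation `u_t + ∂ₓ³ u + ∂ₓ(u³ - 3 P₀(u²) u) = 0` with initial datum
`u₀ ∈ H^s(𝕋)` (meaningful for `s ≥ 1/6`, for which `u³ ∈ L^∞(0,T; L¹(𝕋))`). The values of `u` at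
times outside `]0,T[` are irrelevant. -/
structure IsSolution (T s : ℝ) (u₀ : Torus → ℝ) (u : ℝ → Torus → ℝ) : Prop where
  datum : sobolevNorm s (fun x => (u₀ x : ℂ)) < ⊤
  aestronglyMeasurable : AEStronglyMeasurable (fun p : ℝ × Torus => u p.1 p.2)
    ((volume.restrict (Ioo 0 T)).prod volume)
  bounded : linftySobolevNorm (Ioo 0 T) s (toComplex u) < ⊤
  weak : ∀ φ : ℝ → Torus → ℝ, IsTestFunction T φ →
    (∫ t in Ioo 0 T, ∫ x : Torus,
        ((dt φ t x + dx 3 φ t x) * u t x + dx 1 φ t x * nonlinearity (u t) x)) +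
      ∫ x : Torus, φ 0 x * u₀ x = 0

end MKdV

end

/-!
The estimate rests on one mechanism: after the resonant interactions have been removed, time
oscillations compensate for the derivative in the nonlinearity.

Write `v_k(t) = e^{-i(2πk)³t} û(t, k)` (`modCoeff`; its continuous representative is `profile`).
For `s > 1/6` a function of `H^s` is the `L³` limit of its dyadic partial Fourier sums
(`memLp_three_and_tendsto`), so that the Fourier coefficients of the cubic nonlinearity are
absolutely convergent sums. In these sums the resonant frequencies form three lines. The
renormalization cancels their contribution up to the intersections of the lines, and there remains
`-3 |û(k)|² û(k)` (`fourierCoeff_nonlinearity`), which only rotates the phase of `v_k`.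
Testing the equation with plane waves turns it into absolutely continuous evolution equations for
the `v_k` (`weak_modCoeff`, `ae_eq_integral_of_weak`, `IsSolution.isProfile`), in which the
nonresonant interactions carry the phase `e^{iΩt}`, `Ω` being a constant times
`(k₁ + k₂)(k₁ + k₃)(k₂ + k₃)`.

The energy `∑ w(k) |v_k|²`, for a smooth truncation `w` of `⟨k⟩^{2s}`, therefore varies by a sum
over four frequencies with zero sum (`energy_identity`). Symmetrizing over the four frequencies
replaces the multiplier by `∑ⱼ kⱼ w(kⱼ)`, which vanishes with `Ω`: it is bounded by `|Ω| B^{s-1}`,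
where `B` is the largest squared bracket, uniformly in the truncation (`IsSymbol.abs_sum_le`). An
integration by parts in time gains `|Ω|⁻¹`. Interpolating its boundary terms with the trivial bound
costs `|Ω|^{1/8}` and gains `T^{1/8}`, and the resulting sums close by the Cauchy–Schwarz inequality
(`tsum_maxBr_mul_le`). In the remaining term one profile is replaced by its time derivative, which
is only controlled in a weighted `ℓ²L²_t` space of order `s - 11/10`; Cauchy–Schwarz in time gives
there a factor `T^{1/2}`. This yields `exists_profile_estimate`.

Finally, the time derivative of the profiles is read off the Bourgain norm of any extension of the
solution by Plancherel's theorem in time (`exists_weak_deriv`, `tsum_modForcing_le`), and the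
infimum over the extensions is taken.
-/

noncomputable section

namespace MKdV

/-! ### Symbols and the symmetrized multiplier -/

lemma one_le_bracketSq (x : ℝ) : 1 ≤ bracketSq x := by
  unfold bracketSq; nlinarith [sq_nonneg x]

lemma bracketSq_pos (x : ℝ) : 0 < bracketSq x := lt_of_lt_of_le one_pos (one_le_bracketSq x)

lemma bracketSq_neg (x : ℝ) : bracketSq (-x) = bracketSq x := by
  simp [bracketSq]

lemma abs_le_bracketSq_rpow (x : ℝ) : |x| ≤ bracketSq x ^ (1 / 2 : ℝ) := by
  rw [← Real.sqrt_eq_rpow]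
  exact Real.abs_le_sqrt (by unfold bracketSq; linarith)

/-- `f`, with first and second derivatives `f₁` and `f₂`, is a symbol of order `2 * m` up to two
derivatives, with constant `C`: differentiation gains a power of `⟨x⟩ = (bracketSq x) ^ (1 / 2)`. -/
structure IsSymbol (m C : ℝ) (f f₁ f₂ : ℝ → ℝ) : Prop where
  hasDerivAt : ∀ x, HasDerivAt f (f₁ x) x
  hasDerivAt' : ∀ x, HasDerivAt f₁ (f₂ x) x
  bound : ∀ x, |f x| ≤ C * bracketSq x ^ m
  bound₁ : ∀ x, |f₁ x| ≤ C * bracketSq x ^ (m - 1 / 2)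
  bound₂ : ∀ x, |f₂ x| ≤ C * bracketSq x ^ (m - 1)

lemma IsSymbol.nonneg {m C : ℝ} {f f₁ f₂ : ℝ → ℝ} (h : IsSymbol m C f f₁ f₂) : 0 ≤ C := by
  have := (abs_nonneg _).trans (h.bound 0)
  simpa [bracketSq] using this

lemma IsSymbol.mul {m m' C C' : ℝ} {f f₁ f₂ g g₁ g₂ : ℝ → ℝ} (hf : IsSymbol m C f f₁ f₂)
    (hg : IsSymbol m' C' g g₁ g₂) :
    IsSymbol (m + m') (4 * (C * C')) (fun x => f x * g x) (fun x => f₁ x * g x + f x * g₁ x)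
      (fun x => (f₂ x * g x + f₁ x * g₁ x) + (f₁ x * g₁ x + f x * g₂ x)) := by
  have key : ∀ (x p q r a b : ℝ), |a| ≤ C * bracketSq x ^ p → |b| ≤ C' * bracketSq x ^ q →
      p + q = r → |a * b| ≤ (C * C') * bracketSq x ^ r := by
    intro x p q r a b ha hb hr
    rw [abs_mul, ← hr, Real.rpow_add (bracketSq_pos x)]
    calc |a| * |b| ≤ (C * bracketSq x ^ p) * (C' * bracketSq x ^ q) :=
          mul_le_mul ha hb (abs_nonneg _) ((abs_nonneg _).trans ha)
      _ = _ := by ring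
  have pos : ∀ (x r : ℝ), 0 ≤ (C * C') * bracketSq x ^ r := fun x r =>
    mul_nonneg (mul_nonneg hf.nonneg hg.nonneg) (Real.rpow_nonneg (bracketSq_pos x).le _)
  refine ⟨fun x => (hf.hasDerivAt x).mul (hg.hasDerivAt x), fun x =>
    ((hf.hasDerivAt' x).mul (hg.hasDerivAt x)).add ((hf.hasDerivAt x).mul (hg.hasDerivAt' x)),
    fun x => ?_, fun x => ?_, fun x => ?_⟩
  · have h := key x _ _ (m + m') _ _ (hf.bound x) (hg.bound x) rfl
    linarith [pos x (m + m')]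
  · have h1 := key x _ _ (m + m' - 1 / 2) _ _ (hf.bound₁ x) (hg.bound x) (by ring)
    have h2 := key x _ _ (m + m' - 1 / 2) _ _ (hf.bound x) (hg.bound₁ x) (by ring)
    have := abs_add_le (f₁ x * g x) (f x * g₁ x)
    linarith [pos x (m + m' - 1 / 2)]
  · have h1 := key x _ _ (m + m' - 1) _ _ (hf.bound₂ x) (hg.bound x) (by ring)
    have h2 := key x _ _ (m + m' - 1) _ _ (hf.bound x) (hg.bound₂ x) (by ring)
    have h3 := key x _ _ (m + m' - 1) _ _ (hf.bound₁ x) (hg.bound₁ x) (by ring)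
    have e1 := abs_add_le (f₂ x * g x + f₁ x * g₁ x) (f₁ x * g₁ x + f x * g₂ x)
    have e2 := abs_add_le (f₂ x * g x) (f₁ x * g₁ x)
    have e3 := abs_add_le (f₁ x * g₁ x) (f x * g₂ x)
    linarith [pos x (m + m' - 1)]

lemma isSymbol_id : IsSymbol (1 / 2) 1 (fun x => x) (fun _ => 1) (fun _ => 0) := by
  refine ⟨fun x => hasDerivAt_id x, fun x => hasDerivAt_const x _, fun x => ?_, fun x => ?_,
    fun x => ?_⟩
  · simpa using abs_le_bracketSq_rpow x
  · simp
  · simpa using Real.rpow_nonneg (bracketSq_pos x).le _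

lemma hasDerivAt_bracketSq_rpow (s x : ℝ) :
    HasDerivAt (fun x => bracketSq x ^ s) (2 * s * x * bracketSq x ^ (s - 1)) x := by
  have h : HasDerivAt bracketSq (2 * x) x := by
    have := (hasDerivAt_pow 2 x).const_add 1
    convert! this using 1
    simp
  convert! h.rpow_const (p := s) (Or.inl (bracketSq_pos x).ne') using 1
  ring

lemma isSymbol_bracketSq_rpow (s : ℝ) :
    IsSymbol s (1 + 2 * |s| + 4 * |s| * |s - 1|) (fun x => bracketSq x ^ s)
      (fun x => 2 * s * x * bracketSq x ^ (s - 1))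
      (fun x => 2 * s * bracketSq x ^ (s - 1)
        + 2 * s * x * (2 * (s - 1) * x * bracketSq x ^ (s - 1 - 1))) := by
  have hx : ∀ x p : ℝ, |x * bracketSq x ^ (p - 1)| ≤ bracketSq x ^ (p - 1 / 2) := by
    intro x p
    rw [abs_mul, abs_of_pos (Real.rpow_pos_of_pos (bracketSq_pos x) (p - 1)),
      show p - 1 / 2 = 1 / 2 + (p - 1) by ring, Real.rpow_add (bracketSq_pos x)]
    exact mul_le_mul_of_nonneg_right (abs_le_bracketSq_rpow x)
      (Real.rpow_nonneg (bracketSq_pos x).le _)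
  have pos : ∀ x p : ℝ, 0 ≤ bracketSq x ^ p := fun x p => Real.rpow_nonneg (bracketSq_pos x).le _
  refine ⟨hasDerivAt_bracketSq_rpow s, fun x => ?_, fun x => ?_, fun x => ?_, fun x => ?_⟩
  · have h1 : HasDerivAt (fun x : ℝ => 2 * s * x) (2 * s) x := by
      simpa using (hasDerivAt_id x).const_mul (2 * s)
    exact h1.mul (hasDerivAt_bracketSq_rpow (s - 1) x)
  · rw [abs_of_nonneg (pos x s)]
    nlinarith [pos x s, mul_nonneg (abs_nonneg s) (pos x s),
      mul_nonneg (mul_nonneg (abs_nonneg s) (abs_nonneg (s - 1))) (pos x s)]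
  · rw [mul_assoc, abs_mul, abs_mul, abs_two]
    have := mul_le_mul_of_nonneg_left (hx x s) (abs_nonneg s)
    nlinarith [pos x (s - 1 / 2), mul_nonneg (mul_nonneg (abs_nonneg s) (abs_nonneg (s - 1)))
      (pos x (s - 1 / 2))]
  · have h1 : |2 * s * bracketSq x ^ (s - 1)| = 2 * |s| * bracketSq x ^ (s - 1) := by
      rw [abs_mul, abs_mul, abs_two, abs_of_nonneg (pos x (s - 1))]
    have h2 : |2 * s * x * (2 * (s - 1) * x * bracketSq x ^ (s - 1 - 1))|
        ≤ 4 * |s| * |s - 1| * bracketSq x ^ (s - 1) := by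
      have e : 2 * s * x * (2 * (s - 1) * x * bracketSq x ^ (s - 1 - 1))
          = 4 * (s * (s - 1) * (x * (x * bracketSq x ^ (s - 1 - 1)))) := by ring
      have h3 : |x * (x * bracketSq x ^ (s - 1 - 1))| ≤ bracketSq x ^ (s - 1) := by
        rw [abs_mul, show s - 1 = 1 / 2 + (s - 1 - 1 / 2) by ring, Real.rpow_add (bracketSq_pos x)]
        have := hx x (s - 1)
        rw [show 1 / 2 + (s - 1 - 1 / 2) - 1 = s - 1 - 1 by ring]
        exact mul_le_mul (abs_le_bracketSq_rpow x) this (abs_nonneg _) (pos _ _)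
      rw [e, abs_mul, abs_mul, abs_mul, abs_of_pos (by norm_num : (0 : ℝ) < 4)]
      have := mul_le_mul_of_nonneg_left h3 (mul_nonneg (abs_nonneg s) (abs_nonneg (s - 1)))
      nlinarith
    have := abs_add_le (2 * s * bracketSq x ^ (s - 1))
      (2 * s * x * (2 * (s - 1) * x * bracketSq x ^ (s - 1 - 1)))
    nlinarith [pos x (s - 1)]

/-- A smooth even cutoff function, equal to `1` on `[-1, 1]` and supported in `[-2, 2]`. -/
def cutoff : ContDiffBump (0 : ℝ) := ⟨1, 2, one_pos, one_lt_two⟩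

lemma exists_isSymbol_cutoff : ∃ C : ℝ, ∀ R : ℝ, 1 ≤ R → ∃ f₁ f₂ : ℝ → ℝ,
    IsSymbol 0 C (fun x => cutoff (x / R)) f₁ f₂ := by
  have hc : ContDiff ℝ ∞ (cutoff : ℝ → ℝ) := cutoff.contDiff
  have hc1 : ContDiff ℝ ∞ (deriv cutoff) := hc.deriv' 
  have hc2 : ContDiff ℝ ∞ (deriv (deriv cutoff)) := hc1.deriv'
  have hs1 : HasCompactSupport (deriv cutoff) := cutoff.hasCompactSupport.deriv
  have hs2 : HasCompactSupport (deriv (deriv cutoff)) := hs1.deriv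
  obtain ⟨D₁, hD₁⟩ := hs1.exists_bound_of_continuous hc1.continuous
  obtain ⟨D₂, hD₂⟩ := hs2.exists_bound_of_continuous hc2.continuous
  have hz1 : ∀ y, 2 < |y| → deriv cutoff y = 0 := by
    intro y hy
    apply image_eq_zero_of_notMem_tsupport
    intro h
    have := tsupport_deriv_subset h
    rw [cutoff.tsupport_eq] at this
    simp [cutoff] at this
    linarith
  have hz2 : ∀ y, 2 < |y| → deriv (deriv cutoff) y = 0 := by
    intro y hy
    apply image_eq_zero_of_notMem_tsupport
    intro h
    have := tsupport_deriv_subset (tsupport_deriv_subset h)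
    rw [cutoff.tsupport_eq] at this
    simp [cutoff] at this
    linarith
  have hD₁0 : 0 ≤ D₁ := (norm_nonneg _).trans (hD₁ 0)
  have hD₂0 : 0 ≤ D₂ := (norm_nonneg _).trans (hD₂ 0)
  refine ⟨1 + 3 * D₁ + 5 * D₂, fun R hR => ⟨fun x => deriv cutoff (x / R) * (1 / R),
    fun x => deriv (deriv cutoff) (x / R) * (1 / R) * (1 / R), ?_⟩⟩
  have hR0 : 0 < R := by linarith
  have hdiv : ∀ x : ℝ, HasDerivAt (fun x => x / R) (1 / R) x := fun x =>
    (hasDerivAt_id x).div_const R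
  -- on the support of the derivatives of the dilated cutoff, `R⁻²` is at most `5 ⟨x⟩⁻²`
  have hsq : ∀ x : ℝ, |x / R| ≤ 2 → bracketSq x ≤ 5 * R ^ 2 := by
    intro x hx
    rw [abs_div, abs_of_pos hR0, div_le_iff₀ hR0] at hx
    have : x ^ 2 ≤ (2 * R) ^ 2 := by rw [← sq_abs]; gcongr
    unfold bracketSq; nlinarith
  refine ⟨fun x => ?_, fun x => ?_, fun x => ?_, fun x => ?_, fun x => ?_⟩
  · exact HasDerivAt.comp (h₂ := cutoff) (h := fun x => x / R) x
      ((hc.differentiable (by simp)) (x / R)).hasDerivAt (hdiv x)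
  · exact (HasDerivAt.comp (h₂ := deriv cutoff) (h := fun x => x / R) x
      ((hc1.differentiable (by simp)) (x / R)).hasDerivAt (hdiv x)).mul_const _
  · rw [abs_of_nonneg cutoff.nonneg]
    have := cutoff.le_one (x := x / R)
    simp; linarith
  · have pos : 0 ≤ bracketSq x ^ (0 - 1 / 2 : ℝ) := Real.rpow_nonneg (bracketSq_pos x).le _
    rcases lt_or_ge 2 |x / R| with h | h
    · rw [hz1 _ h, zero_mul, abs_zero]; exact mul_nonneg (by positivity) pos
    · have h1 : 1 / R ≤ 3 * bracketSq x ^ (0 - 1 / 2 : ℝ) := by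
        rw [zero_sub, Real.rpow_neg (bracketSq_pos x).le, ← Real.sqrt_eq_rpow, ← div_eq_mul_inv,
          div_le_div_iff₀ hR0 (Real.sqrt_pos.2 (bracketSq_pos x)), one_mul]
        apply Real.sqrt_le_iff.2 ⟨by positivity, ?_⟩
        nlinarith [hsq x h]
      rw [abs_mul, abs_of_pos (by positivity : 0 < 1 / R)]
      calc |deriv cutoff (x / R)| * (1 / R) ≤ D₁ * (3 * bracketSq x ^ (0 - 1 / 2 : ℝ)) :=
            mul_le_mul (hD₁ _) h1 (by positivity) hD₁0
        _ ≤ _ := by nlinarith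
  · have pos : 0 ≤ bracketSq x ^ (0 - 1 : ℝ) := Real.rpow_nonneg (bracketSq_pos x).le _
    rcases lt_or_ge 2 |x / R| with h | h
    · rw [hz2 _ h, zero_mul, zero_mul, abs_zero]; exact mul_nonneg (by positivity) pos
    · have h1 : 1 / R * (1 / R) ≤ 5 * bracketSq x ^ (0 - 1 : ℝ) := by
        rw [zero_sub, Real.rpow_neg_one, ← div_eq_mul_inv, div_mul_div_comm,
          div_le_div_iff₀ (by positivity) (bracketSq_pos x)]
        nlinarith [hsq x h]
      rw [mul_assoc, abs_mul, abs_of_pos (by positivity : 0 < 1 / R * (1 / R))]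
      calc |deriv (deriv cutoff) (x / R)| * (1 / R * (1 / R))
            ≤ D₂ * (5 * bracketSq x ^ (0 - 1 : ℝ)) :=
            mul_le_mul (hD₂ _) h1 (by positivity) hD₂0
        _ ≤ _ := by nlinarith

/-- The energy weight `⟨x⟩^{2s}`, cut off smoothly at frequency `R`. -/
def weight (s R x : ℝ) : ℝ := bracketSq x ^ s * cutoff (x / R)

lemma weight_neg (s R x : ℝ) : weight s R (-x) = weight s R x := by
  rw [weight, weight, bracketSq_neg, neg_div, cutoff.neg]

lemma weight_nonneg (s R x : ℝ) : 0 ≤ weight s R x :=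
  mul_nonneg (Real.rpow_nonneg (bracketSq_pos x).le _) cutoff.nonneg

lemma weight_le (s R x : ℝ) : weight s R x ≤ bracketSq x ^ s :=
  mul_le_of_le_one_right (Real.rpow_nonneg (bracketSq_pos x).le _) cutoff.le_one

lemma weight_eq {s R x : ℝ} (hR : 0 < R) (hx : |x| ≤ R) : weight s R x = bracketSq x ^ s := by
  rw [weight, cutoff.one_of_mem_closedBall, mul_one]
  simpa [cutoff, abs_div, abs_of_pos hR] using (div_le_one hR).2 hx

lemma weight_eq_zero {s R x : ℝ} (hR : 0 < R) (hx : 2 * R ≤ |x|) : weight s R x = 0 := by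
  rw [weight, cutoff.zero_of_le_dist, mul_zero]
  simpa [cutoff, abs_div, abs_of_pos hR] using (le_div_iff₀ hR).2 hx

lemma exists_isSymbol_weight (s : ℝ) : ∃ C : ℝ, ∀ R : ℝ, 1 ≤ R → ∃ f₁ f₂ : ℝ → ℝ,
    IsSymbol (s + 1 / 2) C (fun x => x * weight s R x) f₁ f₂ := by
  obtain ⟨C, hC⟩ := exists_isSymbol_cutoff
  refine ⟨4 * (1 * (4 * ((1 + 2 * |s| + 4 * |s| * |s - 1|) * C))), fun R hR => ?_⟩
  obtain ⟨f₁, f₂, h⟩ := hC R hR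
  have := isSymbol_id.mul ((isSymbol_bracketSq_rpow s).mul h)
  rw [show 1 / 2 + (s + 0) = s + 1 / 2 by ring] at this
  exact ⟨_, _, this⟩

lemma abs_sub_le_of_hasDerivAt {f f' : ℝ → ℝ} {C x y : ℝ} (hf : ∀ z, HasDerivAt f (f' z) z)
    (hC : ∀ z ∈ uIcc x y, |f' z| ≤ C) : |f y - f x| ≤ C * |y - x| :=
  Convex.norm_image_sub_le_of_norm_hasDerivWithin_le (fun z _ => (hf z).hasDerivWithinAt)
    hC (convex_uIcc x y) left_mem_uIcc right_mem_uIcc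

/-- The symmetrized multiplier when `|x + y| ≤ |x + z| ≤ |y + z|`. If `|x + z|` is comparable with
the largest frequency, a single mean value estimate suffices; otherwise all four frequencies are
comparable and the sum is a second difference. -/
lemma IsSymbol.abs_sum_le_of_le {s C : ℝ} {φ φ₁ φ₂ : ℝ → ℝ} (hs : 0 ≤ s)
    (h : IsSymbol (s + 1 / 2) C φ φ₁ φ₂) (odd : ∀ x, φ (-x) = -φ x) {x y z w B : ℝ}
    (hsum : x + y + z + w = 0) (hx : bracketSq x ≤ B) (hy : bracketSq y ≤ B)
    (hz : bracketSq z ≤ B) (hw : bracketSq w ≤ B)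
    (hB : B = bracketSq x ∨ B = bracketSq y ∨ B = bracketSq z ∨ B = bracketSq w)
    (h1 : 1 ≤ |y + z|) (hab : |x + y| ≤ |x + z|) (hbc : |x + z| ≤ |y + z|) :
    |φ x + φ y + φ z + φ w|
      ≤ (32 + 2 * 4 ^ |s - 1 / 2|) * C * (|x + y| * |x + z| * |y + z|) * B ^ (s - 1) := by
  have hC := h.nonneg
  have hB1 : 1 ≤ B := (one_le_bracketSq x).trans hx
  have hB0 : 0 < B := by linarith
  set a := x + y with ha
  set b := x + z with hb
  set c := y + z with hc
  have hBc : B ≤ (2 * |c|) ^ 2 := by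
    have e : ∀ u : ℝ, 2 * |u| ≤ 3 * |c| → bracketSq u ≤ (2 * |c|) ^ 2 := by
      intro u hu
      have : (2 * |u|) ^ 2 ≤ (3 * |c|) ^ 2 := by gcongr
      unfold bracketSq
      rw [mul_pow, sq_abs] at this
      nlinarith [abs_nonneg c]
    have tri : ∀ p q r : ℝ, |p + q + r| ≤ |p| + |q| + |r| := fun p q r => abs_add_three p q r
    rcases hB with e1 | e1 | e1 | e1 <;> rw [e1] <;> apply e
    · have : (2 : ℝ) * |x| = |a + b + (-c)| := by
        rw [← abs_two, ← abs_mul]; congr 1; rw [ha, hb, hc]; ring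
      have := tri a b (-c); rw [abs_neg] at this; linarith
    · have : (2 : ℝ) * |y| = |a + (-b) + c| := by
        rw [← abs_two, ← abs_mul]; congr 1; rw [ha, hb, hc]; ring
      have := tri a (-b) c; rw [abs_neg] at this; linarith
    · have : (2 : ℝ) * |z| = |(-a) + b + c| := by
        rw [← abs_two, ← abs_mul]; congr 1; rw [ha, hb, hc]; ring
      have := tri (-a) b c; rw [abs_neg] at this; linarith
    · have : (2 : ℝ) * |w| = |a + b + c| := by
        rw [show w = -(x + y + z) by linarith, abs_neg, ← abs_two, ← abs_mul]
        congr 1; rw [ha, hb, hc]; ring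
      have := tri a b c; linarith
  have hsB : √B ≤ 2 * |c| := Real.sqrt_le_iff.2 ⟨by positivity, hBc⟩
  have hpow : B ^ s = B ^ (s - 1) * B := by
    rw [← Real.rpow_add_one hB0.ne']; ring_nf
  have hpos : 0 ≤ B ^ (s - 1) := Real.rpow_nonneg hB0.le _
  have hsqB : √B * √B = B := Real.mul_self_sqrt hB0.le
  have hK : 0 ≤ (4 : ℝ) ^ |s - 1 / 2| := by positivity
  rcases le_or_gt (√B) (8 * |b|) with hcase | hcase
  · have hφ : ∀ u v : ℝ, bracketSq u ≤ B → bracketSq v ≤ B →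
        |φ u + φ v| ≤ C * B ^ s * |u + v| := by
      intro u v hu hv
      have := abs_sub_le_of_hasDerivAt (C := C * B ^ s) (x := -v) (y := u) h.hasDerivAt (by
        intro t ht
        refine (h.bound₁ t).trans (mul_le_mul_of_nonneg_left ?_ hC)
        rw [show s + 1 / 2 - 1 / 2 = s by ring]
        refine Real.rpow_le_rpow (bracketSq_pos t).le ?_ hs
        have htt : |t| ≤ max |u| |v| := by
          rcases mem_uIcc.1 ht with ⟨p, q⟩ | ⟨p, q⟩
          · rcases abs_cases t with ⟨e, _⟩ | ⟨e, _⟩ <;> rw [e]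
            · exact (q.trans (le_abs_self u)).trans (le_max_left _ _)
            · exact le_trans (by linarith [le_abs_self v]) (le_max_right _ _)
          · rcases abs_cases t with ⟨e, _⟩ | ⟨e, _⟩ <;> rw [e]
            · exact le_trans (by linarith [neg_le_abs v]) (le_max_right _ _)
            · exact le_trans (by linarith [neg_le_abs u]) (le_max_left _ _)
        unfold bracketSq at *
        rcases le_max_iff.1 htt with q | q
        · have := sq_le_sq.2 q; linarith
        · have := sq_le_sq.2 q; linarith)
      rw [odd, sub_neg_eq_add, sub_neg_eq_add] at this
      exact this
    have e1 := hφ x y hx hy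
    have e2 := hφ z w hz hw
    have e3 : |z + w| = |a| := by rw [show z + w = -a by rw [ha]; linarith, abs_neg]
    rw [e3] at e2
    have e4 : |φ x + φ y + φ z + φ w| ≤ |φ x + φ y| + |φ z + φ w| := by
      rw [add_assoc]; exact abs_add_le _ _
    have e5 : B ≤ 16 * (|b| * |c|) := by
      rw [← hsqB]
      have := mul_le_mul hcase hsB (Real.sqrt_nonneg B) (by positivity)
      linarith
    calc |φ x + φ y + φ z + φ w| ≤ 2 * (C * |a|) * B ^ (s - 1) * B := by
          rw [hpow] at e1 e2; linarith
      _ ≤ 2 * (C * |a|) * B ^ (s - 1) * (16 * (|b| * |c|)) := by gcongr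
      _ = 32 * C * (|a| * |b| * |c|) * B ^ (s - 1) := by ring
      _ ≤ _ := by
        have : 0 ≤ C * (|a| * |b| * |c|) * B ^ (s - 1) := by positivity
        nlinarith
  · have hζ : ∀ t : ℝ, |t - x| ≤ √B / 4 →
        |φ₂ t| ≤ C * (4 ^ |s - 1 / 2| * (B ^ (s - 1) * (2 * |c|))) := by
      intro t ht
      refine (h.bound₂ t).trans (mul_le_mul_of_nonneg_left ?_ hC)
      rw [show s + 1 / 2 - 1 = s - 1 / 2 by ring]
      have sq4 : ∀ r : ℝ, |r| ≤ √B / 2 → r ^ 2 ≤ B / 4 := by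
        intro r hr
        have : |r| ^ 2 ≤ (√B / 2) ^ 2 := by gcongr
        rw [sq_abs] at this; nlinarith
      have up : bracketSq t ≤ 4 * B := by
        have := sq4 (t - x) (by linarith [Real.sqrt_nonneg B])
        unfold bracketSq at *; nlinarith [sq_nonneg (t - 2 * x)]
      have low : B / 4 ≤ bracketSq t := by
        have e : ∀ u r : ℝ, |r| ≤ √B / 2 → (u = t + r ∨ u = -(t + r)) → B = bracketSq u →
            B / 4 ≤ bracketSq t := by
          intro u r hr hu hBu
          have := sq4 r hr
          have hu2 : u ^ 2 = (t + r) ^ 2 := by rcases hu with e | e <;> rw [e]; ring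
          unfold bracketSq at *; rw [hu2] at hBu; nlinarith [sq_nonneg (t - r)]
        have tx : |x - t| ≤ √B / 4 := by rwa [abs_sub_comm]
        rcases hB with e1 | e1 | e1 | e1
        · exact e x (x - t) (by linarith [Real.sqrt_nonneg B]) (Or.inl (by ring)) e1
        · refine e y (x - t - a) ?_ (Or.inr (by rw [ha]; ring)) e1
          have := abs_sub (x - t) a; linarith [Real.sqrt_nonneg B]
        · refine e z (x - t - b) ?_ (Or.inr (by rw [hb]; ring)) e1
          have := abs_sub (x - t) b; linarith [Real.sqrt_nonneg B]
        · refine e w (x - t - a - b) ?_ (Or.inl (by rw [ha, hb]; linarith)) e1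
          have h1 := abs_sub (x - t - a) b
          have h2 := abs_sub (x - t) a; linarith
      have hB12 : B ^ (s - 1 / 2) ≤ B ^ (s - 1) * (2 * |c|) := by
        rw [show s - 1 / 2 = (s - 1) + 1 / 2 by ring, Real.rpow_add hB0, ← Real.sqrt_eq_rpow]
        gcongr
      refine le_trans ?_ (mul_le_mul_of_nonneg_left hB12 hK)
      rcases le_total 0 (s - 1 / 2) with hs2 | hs2
      · rw [abs_of_nonneg hs2, ← Real.mul_rpow (by norm_num) hB0.le]
        exact Real.rpow_le_rpow (bracketSq_pos t).le up hs2
      · rw [abs_of_nonpos hs2, Real.rpow_neg (by norm_num), ← Real.inv_rpow (by norm_num),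
          ← Real.mul_rpow (by norm_num) hB0.le]
        exact Real.rpow_le_rpow_of_nonpos (by positivity) (by linarith) hs2
    set K := C * (4 ^ |s - 1 / 2| * (B ^ (s - 1) * (2 * |c|))) with hKdef
    have hfirst : ∀ t : ℝ, t ∈ uIcc (x - b) x → |φ₁ t - φ₁ (t - a)| ≤ K * |a| := by
      intro t ht
      have htx : |t - x| ≤ |b| := by
        have := abs_sub_right_of_mem_uIcc ht
        rw [abs_sub_comm]
        refine this.trans_eq ?_
        congr 1; ring
      have := abs_sub_le_of_hasDerivAt (C := K) (x := t - a) (y := t) h.hasDerivAt' (by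
        intro r hr
        apply hζ
        have hrt : |t - r| ≤ |a| := by
          refine (abs_sub_right_of_mem_uIcc hr).trans_eq ?_
          congr 1; ring
        have := abs_sub_le r t x
        rw [abs_sub_comm r t] at this
        linarith)
      simpa using this
    have hsecond := abs_sub_le_of_hasDerivAt (f := fun t => φ t - φ (t - a))
      (f' := fun t => φ₁ t - φ₁ (t - a)) (C := K * |a|) (x := x - b) (y := x)
      (fun t => (h.hasDerivAt t).sub ((h.hasDerivAt (t - a)).comp_sub_const t a)) hfirst
    have e1 : φ (x - a) = -φ y := by rw [← odd]; congr 1; rw [ha]; ring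
    have e2 : φ (x - b) = -φ z := by rw [← odd]; congr 1; rw [hb]; ring
    have e3 : φ (x - b - a) = φ w := by congr 1; rw [ha, hb]; linarith
    simp only [e1, e2, e3] at hsecond
    calc |φ x + φ y + φ z + φ w| = |φ x - -φ y - (-φ z - φ w)| := by congr 1; ring
      _ ≤ K * |a| * |x - (x - b)| := hsecond
      _ = 2 * 4 ^ |s - 1 / 2| * C * (|a| * |b| * |c|) * B ^ (s - 1) := by
        rw [sub_sub_cancel, hKdef]; ring
      _ ≤ _ := by
        have : 0 ≤ C * (|a| * |b| * |c|) * B ^ (s - 1) := by positivity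
        nlinarith

/-- The symmetrized multiplier of an odd symbol `φ` of order `2s + 1` on the hyperplane
`x + y + z + w = 0` is bounded by the resonance function times `B^{s-1}`, where `B` is the largest
of the squared brackets. -/
lemma IsSymbol.abs_sum_le {s C : ℝ} {φ φ₁ φ₂ : ℝ → ℝ} (hs : 0 ≤ s)
    (h : IsSymbol (s + 1 / 2) C φ φ₁ φ₂) (odd : ∀ x, φ (-x) = -φ x) {x y z w B : ℝ}
    (hsum : x + y + z + w = 0) (hx : bracketSq x ≤ B) (hy : bracketSq y ≤ B)
    (hz : bracketSq z ≤ B) (hw : bracketSq w ≤ B)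
    (hB : B = bracketSq x ∨ B = bracketSq y ∨ B = bracketSq z ∨ B = bracketSq w)
    (h1 : 1 ≤ |x + y|) (h2 : 1 ≤ |x + z|) (h3 : 1 ≤ |y + z|) :
    |φ x + φ y + φ z + φ w|
      ≤ (32 + 2 * 4 ^ |s - 1 / 2|) * C * (|x + y| * |x + z| * |y + z|) * B ^ (s - 1) := by
  have key : ∀ x y z : ℝ, x + y + z + w = 0 → bracketSq x ≤ B → bracketSq y ≤ B →
      bracketSq z ≤ B →
      (B = bracketSq x ∨ B = bracketSq y ∨ B = bracketSq z ∨ B = bracketSq w) →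
      1 ≤ |y + z| → |x + y| ≤ |x + z| → |x + z| ≤ |y + z| → |φ x + φ y + φ z + φ w|
      ≤ (32 + 2 * 4 ^ |s - 1 / 2|) * C * (|x + y| * |x + z| * |y + z|) * B ^ (s - 1) :=
    fun x y z a1 a2 a3 a4 a5 a6 a7 a8 => h.abs_sum_le_of_le hs odd a1 a2 a3 a4 hw a5 a6 a7 a8
  rcases le_total |x + y| |x + z| with p | p <;> rcases le_total |x + z| |y + z| with q | q <;>
    rcases le_total |x + y| |y + z| with r | r
  · exact key x y z hsum hx hy hz hB h3 p q
  · exact key x y z hsum hx hy hz hB h3 p q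
  · have := key y x z (by linarith) hy hx hz (by tauto) h2 (by rwa [add_comm y x]) q
    convert this using 2
    · ring
    · rw [add_comm y x]; ring
  · have := key y z x (by linarith) hy hz hx (by tauto) (by rwa [add_comm z x])
      (by rwa [add_comm y x]) (by rwa [add_comm y x, add_comm z x])
    convert this using 2
    · ring
    · rw [add_comm y x, add_comm z x]; ring
  · have := key x z y (by linarith) hx hz hy (by tauto) (by rwa [add_comm z y]) p
      (by rwa [add_comm z y])
    convert this using 2
    · ring
    · rw [add_comm z y]; ring
  · have := key z x y (by linarith) hz hx hy (by tauto) h1 (by rwa [add_comm z y, add_comm z x])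
      (by rwa [add_comm z y])
    convert this using 2
    · ring
    · rw [add_comm z y, add_comm z x]; ring
  · have := key z y x (by linarith) hz hy hx (by tauto) (by rwa [add_comm y x])
      (by rwa [add_comm z y, add_comm z x]) (by rwa [add_comm y x, add_comm z x])
    convert this using 2
    · ring
    · rw [add_comm z y, add_comm z x, add_comm y x]; ring
  · have := key z y x (by linarith) hz hy hx (by tauto) (by rwa [add_comm y x])
      (by rwa [add_comm z y, add_comm z x]) (by rwa [add_comm y x, add_comm z x])
    convert this using 2
    · ring
    · rw [add_comm z y, add_comm z x, add_comm y x]; ring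

end MKdV

namespace MKdV

/-! ### Sums over four frequencies with zero sum -/

/-- The weight `⟨k⟩^{2s}` as an extended nonnegative real. -/
def br (s : ℝ) (k : ℤ) : ℝ≥0∞ := ENNReal.ofReal (bracketSq k ^ s)

lemma br_add (s r : ℝ) (k : ℤ) : br (s + r) k = br s k * br r k := by
  rw [br, Real.rpow_add (bracketSq_pos _),
    ENNReal.ofReal_mul (Real.rpow_nonneg (bracketSq_pos _).le _)]; rfl

lemma br_zero (k : ℤ) : br 0 k = 1 := by simp [br]

lemma br_ne_top (s : ℝ) (k : ℤ) : br s k ≠ ⊤ := ENNReal.ofReal_ne_top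

lemma br_neg_mul (s : ℝ) (k : ℤ) : br (-s) k * br s k = 1 := by
  rw [← br_add, neg_add_cancel, br_zero]

/-- The norm of the weighted sequence space `h^s`, i.e. of `H^s(𝕋)` on the Fourier side. -/
def hNorm (s : ℝ) (f : ℤ → ℝ≥0∞) : ℝ≥0∞ := (∑' k, br s k * f k ^ 2) ^ (1 / 2 : ℝ)

lemma hNorm_sq (s : ℝ) (f : ℤ → ℝ≥0∞) : hNorm s f ^ 2 = ∑' k, br s k * f k ^ 2 := by
  rw [hNorm, ← ENNReal.rpow_natCast, ← ENNReal.rpow_mul]; norm_num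

lemma hNorm_br_mul (s r : ℝ) (f : ℤ → ℝ≥0∞) :
    hNorm s (fun k => br r k * f k) = hNorm (s + 2 * r) f := by
  unfold hNorm
  congr 1
  refine tsum_congr fun k => ?_
  rw [br_add, two_mul, br_add]; ring

lemma tsum_mul_le_sqrt {ι : Type*} (f g : ι → ℝ≥0∞) :
    ∑' k, f k * g k ≤ (∑' k, f k ^ 2) ^ (1 / 2 : ℝ) * (∑' k, g k ^ 2) ^ (1 / 2 : ℝ) := by
  let _ : MeasurableSpace ι := ⊤
  have := ENNReal.lintegral_mul_le_Lp_mul_Lq (Measure.count : Measure ι)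
    Real.HolderConjugate.two_two (f := f) (g := g) (by fun_prop) (by fun_prop)
  simpa [lintegral_count] using this

/-- The sum `∑ₖ ⟨k⟩^{-2r}`, finite for `r > 1/2`. -/
def brSum (r : ℝ) : ℝ≥0∞ := ∑' k : ℤ, br (-r) k

lemma brSum_lt_top {r : ℝ} (hr : 1 / 2 < r) : brSum r < ⊤ := by
  have h : Summable fun k : ℤ => |(k : ℝ)| ^ (-(2 * r)) + if k = 0 then (1 : ℝ) else 0 :=
    (Real.summable_abs_int_rpow (by linarith)).add
      (summable_of_hasFiniteSupport ((Set.finite_singleton 0).subset fun k hk => by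
        by_contra h; simp at h; simp [h] at hk))
  have h2 : Summable fun k : ℤ => bracketSq k ^ (-r) := by
    refine Summable.of_nonneg_of_le (fun k => Real.rpow_nonneg (bracketSq_pos _).le _)
      (fun k => ?_) h
    by_cases hk : k = 0
    · subst hk
      have := Real.rpow_nonneg (abs_nonneg (((0 : ℤ) : ℝ))) (-(2 * r))
      simp only [Int.cast_zero, if_true]
      simp only [Int.cast_zero] at this
      have e : bracketSq 0 = 1 := by simp [bracketSq]
      rw [e, Real.one_rpow]; linarith
    · have hk' : (k : ℝ) ≠ 0 := by exact_mod_cast hk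
      rw [if_neg hk, add_zero, show -(2 * r) = 2 * (-r) by ring, Real.rpow_mul (abs_nonneg _)]
      refine Real.rpow_le_rpow_of_nonpos (by positivity) ?_ (by linarith)
      rw [Real.rpow_two, sq_abs]
      unfold bracketSq; linarith
  have := h2.tsum_ofReal_lt_top
  exact this

lemma tsum_le_hNorm (r : ℝ) (f : ℤ → ℝ≥0∞) :
    ∑' k, f k ≤ brSum r ^ (1 / 2 : ℝ) * hNorm r f := by
  have h := tsum_mul_le_sqrt (fun k => br (-r / 2) k) (fun k => br (r / 2) k * f k)
  have e1 : ∀ k, br (-r / 2) k * (br (r / 2) k * f k) = f k := fun k => by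
    rw [← mul_assoc, ← br_add, show -r / 2 + r / 2 = 0 by ring, br_zero, one_mul]
  have e2 : ∀ k, br (-r / 2) k ^ 2 = br (-r) k := fun k => by
    rw [sq, ← br_add]; congr 1; ring
  have e3 : ∀ k, (br (r / 2) k * f k) ^ 2 = br r k * f k ^ 2 := fun k => by
    rw [mul_pow, sq (br _ k), ← br_add]; congr 2; ring
  simp only [e1, e2, e3] at h
  exact h

/-- The fourth frequency on the hyperplane `k₁ + k₂ + k₃ + k₄ = 0`, which is parametrized by
the first three. -/
def last (p : ℤ × ℤ × ℤ) : ℤ := -(p.1 + p.2.1 + p.2.2)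

/-- The exchange of the first two frequencies. -/
def swap₁₂ : ℤ × ℤ × ℤ ≃ ℤ × ℤ × ℤ :=
  Function.Involutive.toPerm (fun p => (p.2.1, p.1, p.2.2)) fun _ => rfl

/-- The exchange of the first and third frequencies. -/
def swap₁₃ : ℤ × ℤ × ℤ ≃ ℤ × ℤ × ℤ :=
  Function.Involutive.toPerm (fun p => (p.2.2, p.2.1, p.1)) fun _ => rfl

/-- The exchange of the first and fourth frequencies. -/
def swap₁₄ : ℤ × ℤ × ℤ ≃ ℤ × ℤ × ℤ :=
  Function.Involutive.toPerm (fun p => (last p, p.2.1, p.2.2)) fun p => by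
    refine Prod.ext ?_ rfl
    change -(-(p.1 + p.2.1 + p.2.2) + p.2.1 + p.2.2) = p.1
    ring

section Reindex

variable {α : Type*} [AddCommMonoid α] [TopologicalSpace α]

lemma tsum_swap₁₂ (G : ℤ → ℤ → ℤ → ℤ → α) :
    ∑' p : ℤ × ℤ × ℤ, G p.2.1 p.1 p.2.2 (last p) = ∑' p : ℤ × ℤ × ℤ, G p.1 p.2.1 p.2.2 (last p) := by
  rw [← swap₁₂.tsum_eq]
  refine tsum_congr fun p => ?_
  have : last (swap₁₂ p) = last p := by
    change -(p.2.1 + p.1 + p.2.2) = -(p.1 + p.2.1 + p.2.2); ring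
  rw [this]; rfl

lemma tsum_swap₁₃ (G : ℤ → ℤ → ℤ → ℤ → α) :
    ∑' p : ℤ × ℤ × ℤ, G p.2.2 p.2.1 p.1 (last p) = ∑' p : ℤ × ℤ × ℤ, G p.1 p.2.1 p.2.2 (last p) := by
  rw [← swap₁₃.tsum_eq]
  refine tsum_congr fun p => ?_
  have : last (swap₁₃ p) = last p := by
    change -(p.2.2 + p.2.1 + p.1) = -(p.1 + p.2.1 + p.2.2); ring
  rw [this]; rfl

lemma tsum_swap₁₄ (G : ℤ → ℤ → ℤ → ℤ → α) :
    ∑' p : ℤ × ℤ × ℤ, G (last p) p.2.1 p.2.2 p.1 = ∑' p : ℤ × ℤ × ℤ, G p.1 p.2.1 p.2.2 (last p) := by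
  rw [← swap₁₄.tsum_eq]
  refine tsum_congr fun p => ?_
  have : last (swap₁₄ p) = p.1 := by
    change -(-(p.1 + p.2.1 + p.2.2) + p.2.1 + p.2.2) = p.1; ring
  rw [this]; rfl

end Reindex

/-- The quadrilinear form `∑ f₁(k₁) f₂(k₂) f₃(k₃) f₄(k₄)` over `k₁ + k₂ + k₃ + k₄ = 0`. -/
def quad (f₁ f₂ f₃ f₄ : ℤ → ℝ≥0∞) : ℝ≥0∞ :=
  ∑' p : ℤ × ℤ × ℤ, f₁ p.1 * f₂ p.2.1 * f₃ p.2.2 * f₄ (last p)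

lemma quad_swap₁₂ (f₁ f₂ f₃ f₄ : ℤ → ℝ≥0∞) : quad f₁ f₂ f₃ f₄ = quad f₂ f₁ f₃ f₄ := by
  unfold quad
  rw [← tsum_swap₁₂ fun a b c d => f₁ a * f₂ b * f₃ c * f₄ d]
  exact tsum_congr fun p => by ring

lemma quad_swap₁₃ (f₁ f₂ f₃ f₄ : ℤ → ℝ≥0∞) : quad f₁ f₂ f₃ f₄ = quad f₃ f₂ f₁ f₄ := by
  unfold quad
  rw [← tsum_swap₁₃ fun a b c d => f₁ a * f₂ b * f₃ c * f₄ d]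
  exact tsum_congr fun p => by ring

lemma quad_swap₁₄ (f₁ f₂ f₃ f₄ : ℤ → ℝ≥0∞) : quad f₁ f₂ f₃ f₄ = quad f₄ f₂ f₃ f₁ := by
  unfold quad
  rw [← tsum_swap₁₄ fun a b c d => f₁ a * f₂ b * f₃ c * f₄ d]
  exact tsum_congr fun p => by ring

lemma quad_le (f₁ f₂ f₃ f₄ : ℤ → ℝ≥0∞) :
    quad f₁ f₂ f₃ f₄ ≤ (∑' k, f₁ k) * (∑' k, f₂ k) * (hNorm 0 f₃ * hNorm 0 f₄) := by
  have inner : ∀ a b : ℤ, ∑' c, f₁ a * f₂ b * f₃ c * f₄ (last (a, b, c))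
      ≤ f₁ a * f₂ b * (hNorm 0 f₃ * hNorm 0 f₄) := by
    intro a b
    have h := tsum_mul_le_sqrt f₃ fun c => f₄ (last (a, b, c))
    have e : ∑' c, f₄ (last (a, b, c)) ^ 2 = ∑' c, f₄ c ^ 2 := by
      have := (Equiv.subLeft (-(a + b))).tsum_eq (fun c => f₄ c ^ 2)
      rw [← this]
      refine tsum_congr fun c => ?_
      congr 2
      simp [last]; ring
    simp only [mul_assoc _ (f₃ _), ENNReal.tsum_mul_left]
    gcongr
    rw [e] at h
    simpa [hNorm, br_zero] using h
  unfold quad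
  rw [ENNReal.tsum_prod']
  simp_rw [ENNReal.tsum_prod']
  calc _ ≤ ∑' (a : ℤ) (b : ℤ), f₁ a * f₂ b * (hNorm 0 f₃ * hNorm 0 f₄) := by
        gcongr with a b; exact inner a b
    _ = _ := by simp_rw [ENNReal.tsum_mul_right, ENNReal.tsum_mul_left, ENNReal.tsum_mul_right]

lemma hNorm_zero_br_mul (s : ℝ) (f : ℤ → ℝ≥0∞) :
    hNorm 0 (fun k => br (s / 2) k * f k) = hNorm s f := by
  rw [hNorm_br_mul]; congr 1; ring

lemma tsum_br_mul_le (s r : ℝ) (f : ℤ → ℝ≥0∞) :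
    ∑' k, br (-r) k * f k ≤ brSum (s + 2 * r) ^ (1 / 2 : ℝ) * hNorm s f := by
  refine (tsum_le_hNorm (s + 2 * r) _).trans_eq ?_
  rw [hNorm_br_mul]; congr 2; ring

/-- The largest of the squared brackets of the four frequencies. -/
def maxBr (p : ℤ × ℤ × ℤ) : ℝ :=
  max (max (bracketSq p.1) (bracketSq p.2.1)) (max (bracketSq p.2.2) (bracketSq (last p)))

lemma one_le_maxBr (p : ℤ × ℤ × ℤ) : 1 ≤ maxBr p :=
  (one_le_bracketSq p.1).trans ((le_max_left _ _).trans (le_max_left _ _))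

lemma le_maxBr₁ (p : ℤ × ℤ × ℤ) : bracketSq p.1 ≤ maxBr p :=
  (le_max_left _ _).trans (le_max_left _ _)

lemma le_maxBr₂ (p : ℤ × ℤ × ℤ) : bracketSq p.2.1 ≤ maxBr p :=
  (le_max_right _ _).trans (le_max_left _ _)

lemma le_maxBr₃ (p : ℤ × ℤ × ℤ) : bracketSq p.2.2 ≤ maxBr p :=
  (le_max_left _ _).trans (le_max_right _ _)

lemma le_maxBr₄ (p : ℤ × ℤ × ℤ) : bracketSq (last p) ≤ maxBr p :=
  (le_max_right _ _).trans (le_max_right _ _)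

lemma maxBr_eq (p : ℤ × ℤ × ℤ) : maxBr p = bracketSq p.1 ∨ maxBr p = bracketSq p.2.1 ∨
    maxBr p = bracketSq p.2.2 ∨ maxBr p = bracketSq (last p) := by
  unfold maxBr
  rcases max_choice (max (bracketSq p.1) (bracketSq p.2.1))
    (max (bracketSq p.2.2) (bracketSq (last p))) with h | h <;> rw [h]
  · rcases max_choice (bracketSq (p.1 : ℝ)) (bracketSq p.2.1) with h | h <;> rw [h] <;> simp
  · rcases max_choice (bracketSq (p.2.2 : ℝ)) (bracketSq (last p)) with h | h <;> rw [h] <;> simp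

lemma maxBr_rpow_le_of_le {s : ℝ} (hs : 0 ≤ s) {x y z w B : ℝ} (hsum : x + y + z + w = 0)
    (hB : B = bracketSq x) (hy : bracketSq y ≤ B) (hz : bracketSq z ≤ bracketSq y)
    (hw : bracketSq w ≤ bracketSq y) :
    B ^ (s - 9 / 20) ≤ 9 ^ (s / 2) * (bracketSq x ^ (s / 2) * bracketSq y ^ (s / 2) *
      (bracketSq z ^ (-(9 / 40) : ℝ) * bracketSq w ^ (-(9 / 40) : ℝ))) := by
  have hB0 : 0 < B := hB ▸ bracketSq_pos x
  have hxy : B ≤ 9 * bracketSq y := by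
    have e1 : |z| ≤ |y| := sq_le_sq.1 (by unfold bracketSq at hz; linarith)
    have e2 : |w| ≤ |y| := sq_le_sq.1 (by unfold bracketSq at hw; linarith)
    have e3 : |x| ≤ |3 * y| := by
      rw [show x = -(y + z + w) by linarith, abs_neg, abs_mul, abs_of_pos (by norm_num : (0:ℝ) < 3)]
      linarith [abs_add_three y z w]
    have := sq_le_sq.2 e3
    rw [hB]; unfold bracketSq; nlinarith
  have h1 : B ^ (s / 2) ≤ 9 ^ (s / 2) * bracketSq y ^ (s / 2) := by
    rw [← Real.mul_rpow (by norm_num) (bracketSq_pos y).le]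
    exact Real.rpow_le_rpow hB0.le hxy (by linarith)
  have h2 : B ^ (-(9 / 40) : ℝ) ≤ bracketSq z ^ (-(9 / 40) : ℝ) :=
    Real.rpow_le_rpow_of_nonpos (bracketSq_pos z) (hz.trans hy) (by norm_num)
  have h3 : B ^ (-(9 / 40) : ℝ) ≤ bracketSq w ^ (-(9 / 40) : ℝ) :=
    Real.rpow_le_rpow_of_nonpos (bracketSq_pos w) (hw.trans hy) (by norm_num)
  have e : B ^ (s - 9 / 20) = B ^ (s / 2) * B ^ (s / 2) * (B ^ (-(9 / 40) : ℝ) *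
      B ^ (-(9 / 40) : ℝ)) := by
    rw [← Real.rpow_add hB0, ← Real.rpow_add hB0, ← Real.rpow_add hB0]; ring_nf
  have p : ∀ r t : ℝ, 0 ≤ bracketSq r ^ t := fun r t => Real.rpow_nonneg (bracketSq_pos r).le _
  have pB : ∀ t : ℝ, 0 ≤ B ^ t := fun t => Real.rpow_nonneg hB0.le _
  rw [e, ← hB]
  calc _ ≤ B ^ (s / 2) * (9 ^ (s / 2) * bracketSq y ^ (s / 2)) *
        (bracketSq z ^ (-(9 / 40) : ℝ) * bracketSq w ^ (-(9 / 40) : ℝ)) :=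
        mul_le_mul (mul_le_mul_of_nonneg_left h1 (pB _)) (mul_le_mul h2 h3 (pB _) (p _ _))
          (mul_nonneg (pB _) (pB _)) (mul_nonneg (pB _) (mul_nonneg (by positivity) (p _ _)))
    _ = _ := by ring

/-- The two largest frequencies are comparable, and carry the weight `B^s`; the factor `B^{-9/20}`
is given to the other two. -/
lemma maxBr_rpow_le {s : ℝ} (hs : 0 ≤ s) (p : ℤ × ℤ × ℤ) :
    let g := fun k : ℤ => bracketSq k ^ (s / 2)
    let h := fun k : ℤ => bracketSq k ^ (-(9 / 40) : ℝ)
    maxBr p ^ (s - 9 / 20) ≤ 9 ^ (s / 2) *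
      (h p.1 * h p.2.1 * (g p.2.2 * g (last p)) + h p.1 * h p.2.2 * (g p.2.1 * g (last p))
      + h p.1 * h (last p) * (g p.2.1 * g p.2.2) + h p.2.1 * h p.2.2 * (g p.1 * g (last p))
      + h p.2.1 * h (last p) * (g p.1 * g p.2.2) + h p.2.2 * h (last p) * (g p.1 * g p.2.1)) := by
  intro g h
  obtain ⟨a, b, c⟩ := p
  set d := last (a, b, c) with hd
  have hsum : (a : ℝ) + b + c + d = 0 := by rw [hd]; simp [last]
  have b1 := le_maxBr₁ (a, b, c)
  have b2 := le_maxBr₂ (a, b, c)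
  have b3 := le_maxBr₃ (a, b, c)
  have b4 := le_maxBr₄ (a, b, c)
  have hmax := maxBr_eq (a, b, c)
  rw [← hd] at b4 hmax
  simp only at b1 b2 b3 b4 hmax ⊢
  set B := maxBr (a, b, c)
  have gp : ∀ k, 0 ≤ g k := fun k => Real.rpow_nonneg (bracketSq_pos _).le _
  have hp : ∀ k, 0 ≤ h k := fun k => Real.rpow_nonneg (bracketSq_pos _).le _
  have pos : ∀ i j k l, 0 ≤ h i * h j * (g k * g l) := fun i j k l =>
    mul_nonneg (mul_nonneg (hp _) (hp _)) (mul_nonneg (gp _) (gp _))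
  have key : ∀ x y z w : ℤ, (x : ℝ) + y + z + w = 0 → B = bracketSq x → bracketSq y ≤ B →
      bracketSq z ≤ B → bracketSq w ≤ B → ∀ S : ℝ,
      g x * g y * (h z * h w) ≤ S → g x * g z * (h y * h w) ≤ S →
      g x * g w * (h z * h y) ≤ S → B ^ (s - 9 / 20) ≤ 9 ^ (s / 2) * S := by
    intro x y z w h0 hx hy hz hw S s1 s2 s3
    have h9 : (0 : ℝ) ≤ 9 ^ (s / 2) := by positivity
    rcases le_total (bracketSq (z : ℝ)) (bracketSq y) with p | p
    · rcases le_total (bracketSq (w : ℝ)) (bracketSq y) with q | q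
      · exact (maxBr_rpow_le_of_le hs h0 hx hy p q).trans (mul_le_mul_of_nonneg_left s1 h9)
      · exact (maxBr_rpow_le_of_le hs (y := w) (z := z) (w := y) (by linarith) hx hw (p.trans q)
          q).trans (mul_le_mul_of_nonneg_left s3 h9)
    · rcases le_total (bracketSq (w : ℝ)) (bracketSq z) with q | q
      · exact (maxBr_rpow_le_of_le hs (y := z) (z := y) (w := w) (by linarith) hx hz p q).trans
          (mul_le_mul_of_nonneg_left s2 h9)
      · exact (maxBr_rpow_le_of_le hs (y := w) (z := z) (w := y) (by linarith) hx hw q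
          (p.trans q)).trans (mul_le_mul_of_nonneg_left s3 h9)
  have q1 := pos a b c d
  have q2 := pos a c b d
  have q3 := pos a d b c
  have q4 := pos b c a d
  have q5 := pos b d a c
  have q6 := pos c d a b
  rcases hmax with e | e | e | e
  · exact key a b c d hsum e b2 b3 b4 _ (by linarith) (by linarith) (by linarith)
  · exact key b a c d (by linarith) e b1 b3 b4 _ (by linarith) (by linarith) (by linarith)
  · exact key c a b d (by linarith) e b1 b2 b4 _ (by linarith) (by linarith) (by linarith)
  · exact key d a b c (by linarith) e b1 b2 b3 _ (by linarith) (by linarith) (by linarith)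

/-- The quadrilinear estimate: with the weight `B^{s - 9/20}`, the sum over four frequencies with
zero sum is bounded by the `h^s` norms as soon as `s > 1/20`. -/
lemma tsum_maxBr_mul_le {s : ℝ} (hs : 1 / 20 < s) : ∃ C : ℝ≥0, ∀ f₁ f₂ f₃ f₄ : ℤ → ℝ≥0∞,
    ∑' p : ℤ × ℤ × ℤ, ENNReal.ofReal (maxBr p ^ (s - 9 / 20)) *
      (f₁ p.1 * f₂ p.2.1 * f₃ p.2.2 * f₄ (last p))
      ≤ C * (hNorm s f₁ * hNorm s f₂ * hNorm s f₃ * hNorm s f₄) := by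
  set D : ℝ≥0∞ := brSum (s + 2 * (9 / 40)) ^ (1 / 2 : ℝ) with hD
  have hDt : D ≠ ⊤ := (ENNReal.rpow_lt_top_of_nonneg (by norm_num)
    (brSum_lt_top (by linarith)).ne).ne
  set K : ℝ≥0∞ := ENNReal.ofReal (9 ^ (s / 2)) * (6 * (D * D)) with hK
  have hKt : K ≠ ⊤ := by
    rw [hK]
    exact ENNReal.mul_ne_top ENNReal.ofReal_ne_top
      (ENNReal.mul_ne_top (by norm_num) (ENNReal.mul_ne_top hDt hDt))
  refine ⟨K.toNNReal, fun f₁ f₂ f₃ f₄ => ?_⟩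
  rw [ENNReal.coe_toNNReal hKt]
  let G : (ℤ → ℝ≥0∞) → ℤ → ℝ≥0∞ := fun f k => br (s / 2) k * f k
  let H : (ℤ → ℝ≥0∞) → ℤ → ℝ≥0∞ := fun f k => br (-(9 / 40)) k * f k
  have base : ∀ u₁ u₂ u₃ u₄ : ℤ → ℝ≥0∞, quad (H u₁) (H u₂) (G u₃) (G u₄)
      ≤ D * D * (hNorm s u₁ * hNorm s u₂ * hNorm s u₃ * hNorm s u₄) := by
    intro u₁ u₂ u₃ u₄
    refine (quad_le _ _ _ _).trans ?_
    simp only [G, H, hNorm_zero_br_mul]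
    calc _ ≤ (D * hNorm s u₁) * (D * hNorm s u₂) * (hNorm s u₃ * hNorm s u₄) := by
          gcongr <;> exact tsum_br_mul_le _ _ _
      _ = _ := by ring
  set N := hNorm s f₁ * hNorm s f₂ * hNorm s f₃ * hNorm s f₄ with hN
  have e12 := base f₁ f₂ f₃ f₄
  have e13 : quad (H f₁) (G f₂) (H f₃) (G f₄) ≤ D * D * N := by
    rw [quad_swap₁₂, quad_swap₁₃]
    exact (base f₃ f₁ f₂ f₄).trans_eq (by rw [hN]; ring)
  have e14 : quad (H f₁) (G f₂) (G f₃) (H f₄) ≤ D * D * N := by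
    rw [quad_swap₁₂, quad_swap₁₄]
    exact (base f₄ f₁ f₃ f₂).trans_eq (by rw [hN]; ring)
  have e23 : quad (G f₁) (H f₂) (H f₃) (G f₄) ≤ D * D * N := by
    rw [quad_swap₁₃]
    exact (base f₃ f₂ f₁ f₄).trans_eq (by rw [hN]; ring)
  have e24 : quad (G f₁) (H f₂) (G f₃) (H f₄) ≤ D * D * N := by
    rw [quad_swap₁₄]
    exact (base f₄ f₂ f₃ f₁).trans_eq (by rw [hN]; ring)
  have e34 : quad (G f₁) (G f₂) (H f₃) (H f₄) ≤ D * D * N := by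
    rw [quad_swap₁₃, quad_swap₁₂, quad_swap₁₄]
    exact (base f₄ f₃ f₁ f₂).trans_eq (by rw [hN]; ring)
  calc _ ≤ ∑' p : ℤ × ℤ × ℤ, ENNReal.ofReal (9 ^ (s / 2)) *
        (H f₁ p.1 * H f₂ p.2.1 * G f₃ p.2.2 * G f₄ (last p)
        + H f₁ p.1 * G f₂ p.2.1 * H f₃ p.2.2 * G f₄ (last p)
        + H f₁ p.1 * G f₂ p.2.1 * G f₃ p.2.2 * H f₄ (last p)
        + G f₁ p.1 * H f₂ p.2.1 * H f₃ p.2.2 * G f₄ (last p)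
        + G f₁ p.1 * H f₂ p.2.1 * G f₃ p.2.2 * H f₄ (last p)
        + G f₁ p.1 * G f₂ p.2.1 * H f₃ p.2.2 * H f₄ (last p)) := by
        refine ENNReal.tsum_le_tsum fun p => ?_
        have hp := ENNReal.ofReal_le_ofReal (maxBr_rpow_le (s := s) (by linarith) p)
        have P : ∀ (r : ℝ) (k : ℤ), 0 ≤ bracketSq k ^ r := fun r k =>
          Real.rpow_nonneg (bracketSq_pos _).le _
        have PH : ∀ (i j k l : ℤ), 0 ≤ bracketSq i ^ (-(9 / 40) : ℝ) *
            bracketSq j ^ (-(9 / 40) : ℝ) * (bracketSq k ^ (s / 2) * bracketSq l ^ (s / 2)) :=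
          fun i j k l => mul_nonneg (mul_nonneg (P _ _) (P _ _)) (mul_nonneg (P _ _) (P _ _))
        have split : ∀ (i j k l : ℤ), ENNReal.ofReal (bracketSq i ^ (-(9 / 40) : ℝ) *
            bracketSq j ^ (-(9 / 40) : ℝ) * (bracketSq k ^ (s / 2) * bracketSq l ^ (s / 2)))
            = br (-(9 / 40)) i * br (-(9 / 40)) j * (br (s / 2) k * br (s / 2) l) := by
          intro i j k l
          rw [ENNReal.ofReal_mul (mul_nonneg (P _ _) (P _ _)), ENNReal.ofReal_mul (P _ _),
            ENNReal.ofReal_mul (P _ _)]; rfl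
        rw [ENNReal.ofReal_mul (by positivity),
          ENNReal.ofReal_add (by repeat' first | exact PH _ _ _ _ | apply add_nonneg) (PH _ _ _ _),
          ENNReal.ofReal_add (by repeat' first | exact PH _ _ _ _ | apply add_nonneg) (PH _ _ _ _),
          ENNReal.ofReal_add (by repeat' first | exact PH _ _ _ _ | apply add_nonneg) (PH _ _ _ _),
          ENNReal.ofReal_add (by repeat' first | exact PH _ _ _ _ | apply add_nonneg) (PH _ _ _ _),
          ENNReal.ofReal_add (PH _ _ _ _) (PH _ _ _ _)] at hp
        simp only [split] at hp
        refine (mul_le_mul_left hp _).trans_eq ?_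
        simp only [G, H]
        ring
    _ ≤ ENNReal.ofReal (9 ^ (s / 2)) * (D * D * N + D * D * N + D * D * N + D * D * N + D * D * N
        + D * D * N) := by
        simp only [ENNReal.tsum_mul_left, ENNReal.tsum_add]
        gcongr
        · exact e12
        · exact e13
        · exact e14
        · exact e23
        · exact e24
        · exact e34
    _ = K * N := by rw [hK]; ring

/-- The trilinear estimate behind `H^s ⊆ L³` for `s > 1/6`: the weights of the two larger of three
frequencies dominate a negative power of the smallest one. -/
lemma quad_le_tsum_mul {s : ℝ} (hs : 1 / 6 < s) : ∃ C : ℝ≥0, ∀ f₁ f₂ f₃ f₄ : ℤ → ℝ≥0∞,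
    quad f₁ f₂ f₃ f₄ ≤ C * ((∑' k, f₁ k) * (hNorm s f₂ * hNorm s f₃ * hNorm s f₄)) := by
  set D : ℝ≥0∞ := brSum (s + 2 * s) ^ (1 / 2 : ℝ) with hD
  have hDt : D ≠ ⊤ := (ENNReal.rpow_lt_top_of_nonneg (by norm_num)
    (brSum_lt_top (by linarith)).ne).ne
  have hKt : 3 * D ≠ ⊤ := ENNReal.mul_ne_top (by norm_num) hDt
  refine ⟨(3 * D).toNNReal, fun f₁ f₂ f₃ f₄ => ?_⟩
  rw [ENNReal.coe_toNNReal hKt]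
  let G : (ℤ → ℝ≥0∞) → ℤ → ℝ≥0∞ := fun f k => br (s / 2) k * f k
  let H : (ℤ → ℝ≥0∞) → ℤ → ℝ≥0∞ := fun f k => br (-s) k * f k
  have base : ∀ u₂ u₃ u₄ : ℤ → ℝ≥0∞, quad f₁ (H u₂) (G u₃) (G u₄)
      ≤ D * ((∑' k, f₁ k) * (hNorm s u₂ * hNorm s u₃ * hNorm s u₄)) := by
    intro u₂ u₃ u₄
    refine (quad_le _ _ _ _).trans ?_
    simp only [G, H, hNorm_zero_br_mul]
    calc _ ≤ (∑' k, f₁ k) * (D * hNorm s u₂) * (hNorm s u₃ * hNorm s u₄) := by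
          gcongr; exact tsum_br_mul_le _ _ _
      _ = _ := by ring
  set N := (∑' k, f₁ k) * (hNorm s f₂ * hNorm s f₃ * hNorm s f₄) with hN
  have e2 := base f₂ f₃ f₄
  have e3 : quad f₁ (G f₂) (H f₃) (G f₄) ≤ D * N := by
    rw [quad_swap₁₂, quad_swap₁₃, quad_swap₁₂]
    exact (base f₃ f₂ f₄).trans_eq (by rw [hN]; ring)
  have e4 : quad f₁ (G f₂) (G f₃) (H f₄) ≤ D * N := by
    rw [quad_swap₁₂, quad_swap₁₄, quad_swap₁₂]
    exact (base f₄ f₃ f₂).trans_eq (by rw [hN]; ring)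
  have low : ∀ x y z : ℤ, bracketSq x ≤ bracketSq y → bracketSq x ≤ bracketSq z →
      1 ≤ br (-s) x * br (s / 2) y * br (s / 2) z := by
    intro x y z hy hz
    have h1 : ∀ w : ℤ, bracketSq x ≤ bracketSq w → br (s / 2) x ≤ br (s / 2) w := fun w hw =>
      ENNReal.ofReal_le_ofReal (Real.rpow_le_rpow (bracketSq_pos _).le hw (by linarith))
    calc (1 : ℝ≥0∞) = br (-s) x * br (s / 2) x * br (s / 2) x := by
          rw [mul_assoc, ← br_add, add_halves, br_neg_mul]
      _ ≤ _ := by gcongr <;> [exact h1 y hy; exact h1 z hz]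
  calc quad f₁ f₂ f₃ f₄ ≤ ∑' p : ℤ × ℤ × ℤ,
        (f₁ p.1 * H f₂ p.2.1 * G f₃ p.2.2 * G f₄ (last p)
        + f₁ p.1 * G f₂ p.2.1 * H f₃ p.2.2 * G f₄ (last p)
        + f₁ p.1 * G f₂ p.2.1 * G f₃ p.2.2 * H f₄ (last p)) := by
        refine ENNReal.tsum_le_tsum fun ⟨a, b, c⟩ => ?_
        set d := last (a, b, c)
        set m := f₁ a * f₂ b * f₃ c * f₄ d
        have hm : ∀ x : ℝ≥0∞, 1 ≤ x → m ≤ x * m := fun x hx => le_mul_of_one_le_left' hx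
        simp only [G, H]
        rcases le_total (bracketSq (b : ℝ)) (bracketSq c) with p | p
        · rcases le_total (bracketSq (b : ℝ)) (bracketSq d) with q | q
          · refine (hm _ (low b c d p q)).trans (le_trans (le_of_eq ?_)
              (le_add_right (le_add_right le_rfl)))
            ring
          · refine (hm _ (low d b c q (q.trans p))).trans (le_trans (le_of_eq ?_)
              (le_add_left le_rfl))
            ring
        · rcases le_total (bracketSq (c : ℝ)) (bracketSq d) with q | q
          · refine (hm _ (low c b d p q)).trans (le_trans (le_of_eq ?_)
              (le_add_right (le_add_left le_rfl)))
            ring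
          · refine (hm _ (low d b c (q.trans p) q)).trans (le_trans (le_of_eq ?_)
              (le_add_left le_rfl))
            ring
    _ ≤ D * N + D * N + D * N := by
        simp only [ENNReal.tsum_add]
        gcongr
        · exact e2
        · exact e3
        · exact e4
    _ = _ := by ring

end MKdV

namespace MKdV

/-! ### Absolutely continuous functions of time and oscillatory integrals -/

/-- `f` is absolutely continuous on `[0, T]`, with almost everywhere derivative `f'`. -/
structure ACDeriv (T : ℝ) (f f' : ℝ → ℂ) : Prop where
  ac : AbsolutelyContinuousOnInterval f 0 T
  hasDerivAt : ∀ᵐ x, x ∈ uIcc 0 T → HasDerivAt f (f' x) x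
  integrable : IntervalIntegrable f' volume 0 T

lemma absolutelyContinuousOnInterval_integral {g : ℝ → ℂ} (hg : Integrable g) (T : ℝ) :
    AbsolutelyContinuousOnInterval (fun t => ∫ r in 0..t, g r) 0 T := by
  have hconst : ∀ c : ℂ, AbsolutelyContinuousOnInterval (fun _ : ℝ => c) 0 T := fun c =>
    contDiffOn_const.absolutelyContinuousOnInterval
  have hre := (hg.re.intervalIntegrable (a := 0)
    (b := T)).absolutelyContinuousOnInterval_intervalIntegral (c := 0) left_mem_uIcc
  have him := (hg.im.intervalIntegrable (a := 0)
    (b := T)).absolutelyContinuousOnInterval_intervalIntegral (c := 0) left_mem_uIcc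
  refine (congrArg (AbsolutelyContinuousOnInterval · 0 T) (funext fun t => ?_)).mpr
    ((hre.fun_smul (hconst 1)).fun_add (him.fun_smul (hconst Complex.I)))
  have e : ∀ r, g r = ((g r).re : ℂ) + ((g r).im : ℂ) * Complex.I := fun r =>
    (Complex.re_add_im _).symm
  have h1 : IntervalIntegrable (fun r => ((g r).re : ℂ)) volume 0 t :=
    hg.re.ofReal.intervalIntegrable
  have h2 : IntervalIntegrable (fun r => ((g r).im : ℂ) * Complex.I) volume 0 t :=
    (hg.im.ofReal.mul_const _).intervalIntegrable
  rw [intervalIntegral.integral_congr fun r _ => e r, intervalIntegral.integral_add h1 h2,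
    intervalIntegral.integral_mul_const, intervalIntegral.integral_ofReal,
    intervalIntegral.integral_ofReal]
  simp

namespace ACDeriv

variable {T : ℝ} {f f' g g' : ℝ → ℂ}

lemma mono (hf : ACDeriv T f f') {t : ℝ} (ht : t ∈ Icc 0 T) : ACDeriv t f f' := by
  have h0 : (0 : ℝ) ≤ T := ht.1.trans ht.2
  have hsub : uIcc 0 t ⊆ uIcc 0 T := by
    rw [uIcc_of_le ht.1, uIcc_of_le h0]; exact Icc_subset_Icc_right ht.2
  refine ⟨hf.ac.mono hsub, ?_, hf.integrable.mono_set hsub⟩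
  filter_upwards [hf.hasDerivAt] with x hx h using hx (hsub h)

lemma integral_eq (hf : ACDeriv T f f') : ∫ x in 0..T, f' x = f T - f 0 := by
  set G : ℝ → ℂ := (uIoc 0 T).indicator f' with hG
  have hGi : Integrable G := by
    rw [hG, integrable_indicator_iff measurableSet_uIoc]
    exact intervalIntegrable_iff.1 hf.integrable
  obtain ⟨C, hC⟩ := (hf.ac.fun_sub
    (absolutelyContinuousOnInterval_integral hGi T)).const_of_ae_hasDerivAt_zero (by
    have hne : ∀ᵐ x : ℝ, x ≠ min 0 T := by simp [ae_iff, measure_singleton]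
    filter_upwards [hf.hasDerivAt, LocallyIntegrable.ae_hasDerivAt_integral hGi.locallyIntegrable, hne]
      with x h1 h2 h3 hx
    have hx' : x ∈ uIoc 0 T := ⟨lt_of_le_of_ne hx.1 (Ne.symm h3), hx.2⟩
    have := (h1 hx).sub (h2 0)
    rwa [hG, indicator_of_mem hx', sub_self] at this)
  have h0 := hC 0 left_mem_uIcc
  have hT := hC T right_mem_uIcc
  have hint : ∫ x in 0..T, G x = ∫ x in 0..T, f' x := by
    refine intervalIntegral.integral_congr_ae (Filter.Eventually.of_forall fun x hx => ?_)
    rw [hG, indicator_of_mem hx]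
  simp only [intervalIntegral.integral_same, sub_zero] at h0
  rw [← hint, h0, ← hT]; simp

lemma mul (hf : ACDeriv T f f') (hg : ACDeriv T g g') :
    ACDeriv T (fun t => f t * g t) (fun t => f' t * g t + f t * g' t) := by
  refine ⟨hf.ac.fun_smul hg.ac, ?_, ?_⟩
  · filter_upwards [hf.hasDerivAt, hg.hasDerivAt] with x h1 h2 hx using (h1 hx).mul (h2 hx)
  · exact (hf.integrable.mul_continuousOn hg.ac.continuousOn).add
      (hg.integrable.continuousOn_mul hf.ac.continuousOn)

lemma of_integral (hg : Integrable g) (c : ℂ) (T : ℝ) :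
    ACDeriv T (fun t => c + ∫ r in 0..t, g r) g := by
  refine ⟨AbsolutelyContinuousOnInterval.fun_add ?_
    (absolutelyContinuousOnInterval_integral hg T), ?_, hg.intervalIntegrable⟩
  · exact contDiffOn_const.absolutelyContinuousOnInterval
  · filter_upwards [LocallyIntegrable.ae_hasDerivAt_integral hg.locallyIntegrable] with x h2 _
    exact (h2 0).const_add c

lemma of_contDiff (hf : ContDiff ℝ 1 f) : ACDeriv T f (deriv f) :=
  ⟨hf.contDiffOn.absolutelyContinuousOnInterval,
    Filter.Eventually.of_forall fun x _ => (hf.differentiable (by simp) x).hasDerivAt,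
    (hf.continuous_deriv le_rfl).intervalIntegrable _ _⟩

end ACDeriv

/-- The oscillating factor `e^{iΩt}`. -/
def osc (Ω t : ℝ) : ℂ := Complex.exp ((Ω * t : ℝ) * Complex.I)

lemma norm_osc (Ω t : ℝ) : ‖osc Ω t‖ = 1 := Complex.norm_exp_ofReal_mul_I _

lemma osc_zero (Ω : ℝ) : osc Ω 0 = 1 := by simp [osc]

lemma osc_add (Ω Ω' t : ℝ) : osc (Ω + Ω') t = osc Ω t * osc Ω' t := by
  rw [osc, osc, osc, ← Complex.exp_add]; congr 1; push_cast; ring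

lemma conj_osc (Ω t : ℝ) : (starRingEnd ℂ) (osc Ω t) = osc (-Ω) t := by
  rw [osc, osc, ← Complex.exp_conj]; congr 1; simp

lemma osc_neg_mul (Ω t : ℝ) : osc (-Ω) t * osc Ω t = 1 := by
  rw [← osc_add]; simp [osc]

lemma contDiff_osc (Ω : ℝ) {n : WithTop ℕ∞} : ContDiff ℝ n (osc Ω) := by
  unfold osc
  refine ContDiff.cexp (ContDiff.mul ?_ contDiff_const)
  exact Complex.ofRealCLM.contDiff.comp (contDiff_const.mul contDiff_id)

lemma continuous_osc (Ω : ℝ) : Continuous (osc Ω) := (contDiff_osc Ω (n := 0)).continuous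

lemma hasDerivAt_osc (Ω t : ℝ) : HasDerivAt (osc Ω) (Ω * Complex.I * osc Ω t) t := by
  have h : HasDerivAt (fun t : ℝ => ((Ω * t : ℝ) : ℂ) * Complex.I) (Ω * Complex.I) t := by
    have := ((hasDerivAt_id t).const_mul Ω).ofReal_comp.mul_const Complex.I
    simpa using this
  have := h.cexp
  rwa [mul_comm] at this

lemma enorm_integral_le_lintegral {T t : ℝ} (ht : t ∈ Icc 0 T) (f : ℝ → ℂ) :
    ‖∫ r in 0..t, f r‖ₑ ≤ ∫⁻ r in Ioc 0 T, ‖f r‖ₑ := by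
  rw [intervalIntegral.integral_of_le ht.1]
  exact (enorm_integral_le_lintegral_enorm _).trans
    (lintegral_mono_set (Ioc_subset_Ioc_right ht.2))

/-- One integration by parts in an oscillatory integral. -/
lemma ACDeriv.enorm_integral_osc_le {T t Ω : ℝ} {P P' : ℝ → ℂ} (hP : ACDeriv T P P')
    (ht : t ∈ Icc 0 T) (hΩ : Ω ≠ 0) :
    ‖∫ r in 0..t, osc Ω r * P r‖ₑ ≤ ENNReal.ofReal |Ω|⁻¹ *
      (‖P t‖ₑ + ‖P 0‖ₑ + ∫⁻ r in Ioc 0 T, ‖P' r‖ₑ) := by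
  have hosc : ACDeriv T (fun r => osc Ω r * (Ω * Complex.I)⁻¹) (osc Ω) := by
    have h : ContDiff ℝ 1 (fun r => osc Ω r * (Ω * Complex.I)⁻¹) :=
      (contDiff_osc Ω).mul contDiff_const
    convert ACDeriv.of_contDiff h using 1
    ext r
    have hne : (Ω : ℂ) * Complex.I ≠ 0 := by simp [hΩ]
    rw [((hasDerivAt_osc Ω r).mul_const _).deriv, mul_right_comm, mul_inv_cancel₀ hne, one_mul]
  have h := hosc.mul hP
  have hQ := (h.mono ht).integral_eq
  have h1 : IntervalIntegrable (fun r => osc Ω r * P r) volume 0 t :=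
    (hosc.mono ht).integrable.mul_continuousOn (hP.mono ht).ac.continuousOn
  have h2 : IntervalIntegrable (fun r => osc Ω r * (Ω * Complex.I)⁻¹ * P' r) volume 0 t :=
    (hP.mono ht).integrable.continuousOn_mul (hosc.mono ht).ac.continuousOn
  rw [intervalIntegral.integral_add h1 h2] at hQ
  have e : ∫ r in 0..t, osc Ω r * P r = (Ω * Complex.I)⁻¹ * (osc Ω t * P t - P 0
      - ∫ r in 0..t, osc Ω r * P' r) := by
    have e2 : ∫ r in 0..t, osc Ω r * (Ω * Complex.I)⁻¹ * P' r
        = (Ω * Complex.I)⁻¹ * ∫ r in 0..t, osc Ω r * P' r := by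
      rw [← intervalIntegral.integral_const_mul]
      congr 1; ext r; ring
    rw [e2, osc_zero] at hQ
    linear_combination hQ
  have en : ∀ r : ℝ, ‖osc Ω r‖ₑ = 1 := fun r => by
    rw [← ofReal_norm, norm_osc, ENNReal.ofReal_one]
  rw [e, enorm_mul]
  gcongr
  · rw [← ofReal_norm]; simp
  · refine (enorm_sub_le).trans (add_le_add ((enorm_sub_le).trans ?_) ?_)
    · rw [enorm_mul, en, one_mul]
    · refine (enorm_integral_le_lintegral ht _).trans (lintegral_mono fun r => ?_)
      rw [enorm_mul, en, one_mul]

/-- The trivial bound and the integration by parts, interpolated: the boundary terms gain a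
power of the length of the time interval at the cost of a small power of `Ω`. -/
lemma ACDeriv.enorm_integral_osc_le_interp {T t Ω : ℝ} {P P' : ℝ → ℂ} (hP : ACDeriv T P P')
    (ht : t ∈ Icc 0 T) (hT : 0 < T) (hΩ : Ω ≠ 0) :
    ‖∫ r in 0..t, osc Ω r * P r‖ₑ ≤
      ENNReal.ofReal (|Ω| ^ (-(7 / 8) : ℝ)) * ENNReal.ofReal (T ^ (1 / 8 : ℝ)) *
        (ENNReal.ofReal T⁻¹ * (∫⁻ r in Ioc 0 T, ‖P r‖ₑ) + ‖P t‖ₑ + ‖P 0‖ₑ) +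
      ENNReal.ofReal |Ω|⁻¹ * ∫⁻ r in Ioc 0 T, ‖P' r‖ₑ := by
  have hO : 0 < |Ω| := abs_pos.2 hΩ
  set A := ∫⁻ r in Ioc 0 T, ‖P r‖ₑ with hA
  rcases le_total (|Ω| * T) 1 with h | h
  · have h1 : ‖∫ r in 0..t, osc Ω r * P r‖ₑ ≤ A := by
      refine (enorm_integral_le_lintegral ht _).trans_eq ?_
      rw [hA]
      refine lintegral_congr fun r => ?_
      rw [enorm_mul, ← ofReal_norm, norm_osc, ENNReal.ofReal_one, one_mul]
    have h2 : 1 ≤ |Ω| ^ (-(7 / 8) : ℝ) * T ^ (1 / 8 : ℝ) * T⁻¹ := by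
      have : |Ω| ^ (-(7 / 8) : ℝ) * T ^ (1 / 8 : ℝ) * T⁻¹ = (|Ω| * T) ^ (-(7 / 8) : ℝ) := by
        rw [Real.mul_rpow hO.le hT.le, mul_assoc, ← Real.rpow_neg_one T, ← Real.rpow_add hT]
        norm_num
      rw [this]
      exact Real.one_le_rpow_of_pos_of_le_one_of_nonpos (by positivity) h (by norm_num)
    calc _ ≤ A := h1
      _ ≤ ENNReal.ofReal (|Ω| ^ (-(7 / 8) : ℝ) * T ^ (1 / 8 : ℝ) * T⁻¹) * A :=
        le_mul_of_one_le_left' (by rw [← ENNReal.ofReal_one]; exact ENNReal.ofReal_le_ofReal h2)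
      _ = ENNReal.ofReal (|Ω| ^ (-(7 / 8) : ℝ)) * ENNReal.ofReal (T ^ (1 / 8 : ℝ)) *
          (ENNReal.ofReal T⁻¹ * A) := by
        rw [ENNReal.ofReal_mul (by positivity), ENNReal.ofReal_mul (by positivity)]; ring
      _ ≤ _ := by
        refine le_add_right ?_
        gcongr
        rw [add_assoc]
        exact le_self_add
  · refine (hP.enorm_integral_osc_le ht hΩ).trans ?_
    rw [mul_add]
    gcongr
    · rw [← ENNReal.ofReal_mul (by positivity)]
      refine ENNReal.ofReal_le_ofReal ?_
      have : |Ω| ^ (-(7 / 8) : ℝ) * T ^ (1 / 8 : ℝ) = |Ω|⁻¹ * (|Ω| * T) ^ (1 / 8 : ℝ) := by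
        rw [Real.mul_rpow hO.le hT.le, ← mul_assoc, ← Real.rpow_neg_one, ← Real.rpow_add hO]
        norm_num
      rw [this]
      exact le_mul_of_one_le_right (by positivity) (Real.one_le_rpow h (by norm_num))
    · exact le_add_self

end MKdV

namespace MKdV

/-! ### The energy estimate for the profiles of the Fourier coefficients -/

/-- The dispersion relation `(2πk)³`. -/
def freq (k : ℤ) : ℝ := (2 * Real.pi * k) ^ 3

lemma freq_neg (k : ℤ) : freq (-k) = -freq k := by simp only [freq]; push_cast; ring

/-- The frequencies of an interaction that is not resonant. -/
def Nonres (p : ℤ × ℤ × ℤ) : Prop := p.1 + p.2.1 ≠ 0 ∧ p.1 + p.2.2 ≠ 0 ∧ p.2.1 + p.2.2 ≠ 0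

/-- The resonance function, i.e. the sum of the four values of the dispersion relation. -/
def reson (p : ℤ × ℤ × ℤ) : ℝ := freq p.1 + freq p.2.1 + freq p.2.2 + freq (last p)

lemma reson_eq (p : ℤ × ℤ × ℤ) : reson p = -(3 * (2 * Real.pi) ^ 3) *
    (((p.1 : ℝ) + p.2.1) * ((p.1 : ℝ) + p.2.2) * ((p.2.1 : ℝ) + p.2.2)) := by
  simp only [reson, freq, last]; push_cast; ring

/-- The product of the four profiles in an interaction. -/
def prod4 (v : ℤ → ℝ → ℂ) (p : ℤ × ℤ × ℤ) (r : ℝ) : ℂ :=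
  v p.1 r * v p.2.1 r * v p.2.2 r * v (last p) r

open Classical in
/-- The oscillatory integral of an interaction over `[0, t]`, set to zero if it is resonant. -/
def interaction (v : ℤ → ℝ → ℂ) (t : ℝ) (p : ℤ × ℤ × ℤ) : ℂ :=
  if Nonres p then ∫ r in 0..t, osc (reson p) r * prod4 v p r else 0

lemma last_swap₁₂ (p : ℤ × ℤ × ℤ) : last (swap₁₂ p) = last p := by
  change -(p.2.1 + p.1 + p.2.2) = -(p.1 + p.2.1 + p.2.2); ring

lemma last_swap₁₃ (p : ℤ × ℤ × ℤ) : last (swap₁₃ p) = last p := by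
  change -(p.2.2 + p.2.1 + p.1) = -(p.1 + p.2.1 + p.2.2); ring

lemma last_swap₁₄ (p : ℤ × ℤ × ℤ) : last (swap₁₄ p) = p.1 := by
  change -(-(p.1 + p.2.1 + p.2.2) + p.2.1 + p.2.2) = p.1; ring

lemma interaction_swap₁₂ (v : ℤ → ℝ → ℂ) (t : ℝ) (p : ℤ × ℤ × ℤ) :
    interaction v t (swap₁₂ p) = interaction v t p := by
  have h1 : Nonres (swap₁₂ p) ↔ Nonres p := by
    change (p.2.1 + p.1 ≠ 0 ∧ p.2.1 + p.2.2 ≠ 0 ∧ p.1 + p.2.2 ≠ 0) ↔ _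
    unfold Nonres; rw [add_comm p.2.1 p.1]; tauto
  have h2 : reson (swap₁₂ p) = reson p := by
    unfold reson; rw [last_swap₁₂]
    change freq p.2.1 + freq p.1 + freq p.2.2 + _ = _; ring
  have h3 : ∀ r, prod4 v (swap₁₂ p) r = prod4 v p r := fun r => by
    unfold prod4; rw [last_swap₁₂]
    change v p.2.1 r * v p.1 r * v p.2.2 r * _ = _; ring
  simp only [interaction, h2, h3]
  classical exact if_congr h1 rfl rfl

lemma interaction_swap₁₃ (v : ℤ → ℝ → ℂ) (t : ℝ) (p : ℤ × ℤ × ℤ) :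
    interaction v t (swap₁₃ p) = interaction v t p := by
  have h1 : Nonres (swap₁₃ p) ↔ Nonres p := by
    change (p.2.2 + p.2.1 ≠ 0 ∧ p.2.2 + p.1 ≠ 0 ∧ p.2.1 + p.1 ≠ 0) ↔ _
    unfold Nonres; rw [add_comm p.2.1 p.1, add_comm p.2.2 p.1, add_comm p.2.2 p.2.1]; tauto
  have h2 : reson (swap₁₃ p) = reson p := by
    unfold reson; rw [last_swap₁₃]
    change freq p.2.2 + freq p.2.1 + freq p.1 + _ = _; ring
  have h3 : ∀ r, prod4 v (swap₁₃ p) r = prod4 v p r := fun r => by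
    unfold prod4; rw [last_swap₁₃]
    change v p.2.2 r * v p.2.1 r * v p.1 r * _ = _; ring
  simp only [interaction, h2, h3]
  classical exact if_congr h1 rfl rfl

lemma interaction_swap₁₄ (v : ℤ → ℝ → ℂ) (t : ℝ) (p : ℤ × ℤ × ℤ) :
    interaction v t (swap₁₄ p) = interaction v t p := by
  have h1 : Nonres (swap₁₄ p) ↔ Nonres p := by
    change (-(p.1 + p.2.1 + p.2.2) + p.2.1 ≠ 0 ∧ -(p.1 + p.2.1 + p.2.2) + p.2.2 ≠ 0 ∧
      p.2.1 + p.2.2 ≠ 0) ↔ _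
    unfold Nonres; omega
  have h2 : reson (swap₁₄ p) = reson p := by
    unfold reson; rw [last_swap₁₄]
    change freq (last p) + freq p.2.1 + freq p.2.2 + _ = _; ring
  have h3 : ∀ r, prod4 v (swap₁₄ p) r = prod4 v p r := fun r => by
    unfold prod4; rw [last_swap₁₄]
    change v (last p) r * v p.2.1 r * v p.2.2 r * _ = _; ring
  simp only [interaction, h2, h3]
  classical exact if_congr h1 rfl rfl

/-- Symmetrization: the sum over the first frequency becomes the sum over all four. -/
lemma tsum_mul_interaction (φ : ℤ → ℂ) (v : ℤ → ℝ → ℂ) (t : ℝ)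
    (h : Summable fun p : ℤ × ℤ × ℤ => φ p.1 * interaction v t p) :
    4 * ∑' p : ℤ × ℤ × ℤ, φ p.1 * interaction v t p =
      ∑' p : ℤ × ℤ × ℤ, (φ p.1 + φ p.2.1 + φ p.2.2 + φ (last p)) * interaction v t p := by
  set F : ℤ × ℤ × ℤ → ℂ := fun p => φ p.1 * interaction v t p with hF
  have e2 : (fun p : ℤ × ℤ × ℤ => φ p.2.1 * interaction v t p) = F ∘ swap₁₂ := by
    ext p; simp only [hF, Function.comp, interaction_swap₁₂]; rfl
  have e3 : (fun p : ℤ × ℤ × ℤ => φ p.2.2 * interaction v t p) = F ∘ swap₁₃ := by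
    ext p; simp only [hF, Function.comp, interaction_swap₁₃]; rfl
  have e4 : (fun p : ℤ × ℤ × ℤ => φ (last p) * interaction v t p) = F ∘ swap₁₄ := by
    ext p; simp only [hF, Function.comp, interaction_swap₁₄]; rfl
  have s2 := swap₁₂.summable_iff.2 h
  have s3 := swap₁₃.summable_iff.2 h
  have s4 := swap₁₄.summable_iff.2 h
  have t2 := swap₁₂.tsum_eq F
  have t3 := swap₁₃.tsum_eq F
  have t4 := swap₁₄.tsum_eq F
  calc 4 * ∑' p, F p = ∑' p, F p + ∑' p, F (swap₁₂ p) + ∑' p, F (swap₁₃ p)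
        + ∑' p, F (swap₁₄ p) := by rw [t2, t3, t4]; ring
    _ = ∑' p, (F p + F (swap₁₂ p) + F (swap₁₃ p) + F (swap₁₄ p)) := by
        exact (((h.hasSum.add s2.hasSum).add s3.hasSum).add s4.hasSum).tsum_eq.symm
    _ = _ := by
        refine tsum_congr fun p => ?_
        have q2 := congrFun e2 p
        have q3 := congrFun e3 p
        have q4 := congrFun e4 p
        simp only [Function.comp] at q2 q3 q4
        rw [← q2, ← q3, ← q4]; simp only [hF]; ring

open Classical in
/-- The profiles `v k t = e^{-i(2πk)³t} û(t, k)` of a solution of the renormalized equation on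
`[0, T]`, with time derivatives `g k`. The resonant interactions only contribute a rotation of
the phase of each profile; `M` bounds the norm of the solution in `L^∞ H^s` and `X` that of its
Duhamel forcing. -/
structure IsProfile (T s : ℝ) (M X : ℝ≥0∞) (v g : ℤ → ℝ → ℂ) : Prop where
  integrable : ∀ k, Integrable (g k)
  eq_integral : ∀ k t, v k t = v k 0 + ∫ r in 0..t, g k r
  conj : ∀ k, ∀ t ∈ Icc 0 T, v (-k) t = (starRingEnd ℂ) (v k t)
  bound : ∀ t ∈ Icc 0 T, hNorm s (fun k => ‖v k t‖ₑ) ≤ M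
  bound_ne_top : M ≠ ⊤
  deriv_bound : ∑' k, br (s - 11 / 10) k * ∫⁻ r in Ioc 0 T, ‖g k r‖ₑ ^ 2 ≤ X ^ 2
  equation : ∀ᵐ r, r ∈ Ioc 0 T → ∀ k : ℤ, ∃ ρ : ℝ, g k r = ρ * Complex.I * v k r -
    2 * Real.pi * k * Complex.I * ∑' q : ℤ × ℤ, if Nonres (-k, q) then
      osc (reson (-k, q)) r * (v q.1 r * v q.2 r * v (last (-k, q)) r) else 0

lemma one_le_br {s : ℝ} (hs : 0 ≤ s) (k : ℤ) : 1 ≤ br s k := by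
  rw [br, ← ENNReal.ofReal_one]
  exact ENNReal.ofReal_le_ofReal (Real.one_le_rpow (one_le_bracketSq _) hs)

lemma le_hNorm {s : ℝ} (hs : 0 ≤ s) (f : ℤ → ℝ≥0∞) (k : ℤ) : f k ≤ hNorm s f := by
  have : f k ^ 2 ≤ hNorm s f ^ 2 := by
    rw [hNorm_sq]
    exact (le_mul_of_one_le_left' (one_le_br hs k)).trans
      (ENNReal.le_tsum (f := fun k => br s k * f k ^ 2) k)
  exact (ENNReal.pow_le_pow_left_iff two_ne_zero).1 this

lemma quad_enorm (c : ℤ → ℂ) (v : ℤ → ℝ → ℂ) (r : ℝ) :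
    ∑' p : ℤ × ℤ × ℤ, ‖c p.1 * prod4 v p r‖ₑ = quad (fun k => ‖c k‖ₑ * ‖v k r‖ₑ)
      (fun k => ‖v k r‖ₑ) (fun k => ‖v k r‖ₑ) (fun k => ‖v k r‖ₑ) := by
  refine tsum_congr fun p => ?_
  simp only [prod4, enorm_mul]; ring

namespace IsProfile

variable {T s : ℝ} {M X : ℝ≥0∞} {v g : ℤ → ℝ → ℂ}

lemma acDeriv (h : IsProfile T s M X v g) (k : ℤ) : ACDeriv T (v k) (g k) := by
  have := ACDeriv.of_integral (h.integrable k) (v k 0) T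
  rwa [← funext (h.eq_integral k)] at this

lemma continuous (h : IsProfile T s M X v g) (k : ℤ) : Continuous (v k) := by
  rw [funext (h.eq_integral k)]
  exact continuous_const.add (intervalIntegral.continuous_primitive
    (fun a b => (h.integrable k).intervalIntegrable) 0)

lemma continuous_prod4 (h : IsProfile T s M X v g) (p : ℤ × ℤ × ℤ) : Continuous (prod4 v p) :=
  (((h.continuous _).mul (h.continuous _)).mul (h.continuous _)).mul (h.continuous _)

lemma tsum_lintegral_ne_top (h : IsProfile T s M X v g) (hs : 1 / 6 < s) (c : ℤ → ℂ) {K : Finset ℤ}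
    (hc : ∀ k ∉ K, c k = 0) :
    ∑' p : ℤ × ℤ × ℤ, ∫⁻ r in Ioc 0 T, ‖c p.1 * prod4 v p r‖ₑ ≠ ⊤ := by
  obtain ⟨C, hC⟩ := quad_le_tsum_mul hs
  have hm : ∀ p : ℤ × ℤ × ℤ, AEMeasurable (fun r => ‖c p.1 * prod4 v p r‖ₑ)
      (volume.restrict (Ioc 0 T)) := fun p =>
    (continuous_const.mul (h.continuous_prod4 p)).enorm.measurable.aemeasurable
  rw [← lintegral_tsum hm]
  refine (lt_of_le_of_lt (setLIntegral_mono' (g := fun _ => C * ((∑ k ∈ K, ‖c k‖ₑ * M) *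
    (M * M * M))) measurableSet_Ioc fun r hr => ?_) ?_).ne
  · have hb := h.bound r ⟨hr.1.le, hr.2⟩
    rw [quad_enorm]
    refine (hC _ _ _ _).trans ?_
    have e : ∑' k, ‖c k‖ₑ * ‖v k r‖ₑ ≤ ∑ k ∈ K, ‖c k‖ₑ * M := by
      rw [tsum_eq_sum (s := K) fun k hk => by simp [hc k hk]]
      gcongr with k hk
      exact (le_hNorm (by linarith) (fun k => ‖v k r‖ₑ) k).trans hb
    gcongr
  · rw [setLIntegral_const]
    have hM := h.bound_ne_top.lt_top
    refine ENNReal.mul_lt_top (ENNReal.mul_lt_top ENNReal.coe_lt_top (ENNReal.mul_lt_top ?_ ?_))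
      (by simp)
    · exact ENNReal.sum_lt_top.2 fun k _ => ENNReal.mul_lt_top enorm_lt_top hM
    · exact ENNReal.mul_lt_top (ENNReal.mul_lt_top hM hM) hM

lemma enorm_interaction_le (v : ℤ → ℝ → ℂ) {t : ℝ} (ht : t ∈ Icc 0 T) (p : ℤ × ℤ × ℤ) :
    ‖interaction v t p‖ₑ ≤ ∫⁻ r in Ioc 0 T, ‖prod4 v p r‖ₑ := by
  unfold interaction
  split_ifs
  · refine (enorm_integral_le_lintegral ht _).trans_eq (lintegral_congr fun r => ?_)
    rw [enorm_mul, ← ofReal_norm, norm_osc, ENNReal.ofReal_one, one_mul]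
  · simp

lemma summable_interaction (h : IsProfile T s M X v g) (hs : 1 / 6 < s) (c : ℤ → ℂ) {K : Finset ℤ}
    (hc : ∀ k ∉ K, c k = 0) {t : ℝ} (ht : t ∈ Icc 0 T) :
    Summable fun p : ℤ × ℤ × ℤ => c p.1 * interaction v t p := by
  refine Summable.of_enorm (ne_top_of_le_ne_top (h.tsum_lintegral_ne_top hs c hc)
    (ENNReal.tsum_le_tsum fun p => ?_))
  simp only [enorm_mul]
  rw [lintegral_const_mul' _ _ enorm_ne_top]
  gcongr
  exact enorm_interaction_le v ht p

/-- The evolution of the modulus of a single profile. -/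
lemma norm_sq_sub (h : IsProfile T s M X v g) (hs : 1 / 6 < s) (a : ℤ) {t : ℝ}
    (ht : t ∈ Icc 0 T) :
    ‖v (-a) t‖ ^ 2 - ‖v (-a) 0‖ ^ 2 =
      2 * (2 * Real.pi * a * Complex.I * ∑' q : ℤ × ℤ, interaction v t (a, q)).re := by
  classical
  have hT : (0 : ℝ) ≤ T := ht.1.trans ht.2
  set w : ℝ → ℂ := fun r => 2 * Real.pi * a * Complex.I * ∑' q : ℤ × ℤ, if Nonres (a, q) then
      osc (reson (a, q)) r * prod4 v (a, q) r else 0 with hw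
  have hsum : ∑' q : ℤ × ℤ, ∫⁻ r in Ioc 0 t, ‖if Nonres (a, q) then
      osc (reson (a, q)) r * prod4 v (a, q) r else 0‖ₑ ≠ ⊤ := by
    refine ne_top_of_le_ne_top (h.tsum_lintegral_ne_top hs (Pi.single a 1) (K := {a})
      fun k hk => Pi.single_eq_of_ne (by simpa using hk) 1) ?_
    conv_rhs => rw [ENNReal.tsum_prod']
    refine le_trans ?_ (ENNReal.le_tsum a)
    refine ENNReal.tsum_le_tsum fun q => ?_
    refine (lintegral_mono_set (Ioc_subset_Ioc_right ht.2)).trans (lintegral_mono fun r => ?_)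
    simp only [Pi.single_eq_same, one_mul]
    split_ifs
    · rw [enorm_mul, ← ofReal_norm, norm_osc, ENNReal.ofReal_one, one_mul]
    · simp
  have hmeas : ∀ q : ℤ × ℤ, AEStronglyMeasurable (fun r => if Nonres (a, q) then
      osc (reson (a, q)) r * prod4 v (a, q) r else 0) (volume.restrict (Ioc 0 t)) := by
    intro q
    by_cases hq : Nonres (a, q)
    · simp only [hq, if_true]
      exact ((continuous_osc _).mul (h.continuous_prod4 _)).aestronglyMeasurable
    · simp only [hq, if_false]
      exact aestronglyMeasurable_const
  have hint : ∫ r in 0..t, w r = 2 * Real.pi * a * Complex.I *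
      ∑' q : ℤ × ℤ, interaction v t (a, q) := by
    rw [hw, intervalIntegral.integral_const_mul, intervalIntegral.integral_of_le ht.1,
      integral_tsum hmeas hsum]
    congr 1
    refine tsum_congr fun q => ?_
    rw [interaction]
    split_ifs
    · rw [intervalIntegral.integral_of_le ht.1]
    · simp
  -- the square of the modulus is absolutely continuous, and the phase rotation drops out
  have hv : ∀ r ∈ Icc 0 T, v a r = (starRingEnd ℂ) (v (-a) r) := fun r hr => by
    simpa using h.conj (-a) r hr
  have hconj : ACDeriv T (fun r => (starRingEnd ℂ) (v (-a) r))
      (fun r => (starRingEnd ℂ) (g (-a) r)) := by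
    have hi : Integrable (fun r => (starRingEnd ℂ) (g (-a) r)) :=
      (Complex.conjCLE : ℂ →L[ℝ] ℂ).integrable_comp (h.integrable (-a))
    have := ACDeriv.of_integral hi ((starRingEnd ℂ) (v (-a) 0)) T
    refine (congrArg (ACDeriv T · _) (funext fun r => ?_)).mpr this
    conv_lhs => rw [h.eq_integral (-a) r, map_add]
    congr 1
    exact ((Complex.conjCLE : ℂ →L[ℝ] ℂ).intervalIntegral_comp_comm
      (h.integrable (-a)).intervalIntegrable).symm
  have hE := (((h.acDeriv (-a)).mul hconj).mono ht).integral_eq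
  have hae : ∀ᵐ r, r ∈ uIoc 0 t → g (-a) r * (starRingEnd ℂ) (v (-a) r) +
      v (-a) r * (starRingEnd ℂ) (g (-a) r) = ((2 * (w r).re : ℝ) : ℂ) := by
    filter_upwards [h.equation] with r hr hrt
    rw [uIoc_of_le ht.1] at hrt
    have hrT : r ∈ Ioc 0 T := ⟨hrt.1, hrt.2.trans ht.2⟩
    obtain ⟨ρ, hρ⟩ := hr hrT (-a)
    have e1 : g (-a) r * (starRingEnd ℂ) (v (-a) r) = ((ρ * ‖v (-a) r‖ ^ 2 : ℝ) : ℂ) * Complex.I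
        + w r := by
      rw [hρ, sub_mul, mul_assoc _ (v (-a) r), Complex.mul_conj, Complex.normSq_eq_norm_sq,
        ← hv r ⟨hrT.1.le, hrT.2⟩]
      simp only [neg_neg, hw]
      rw [mul_assoc _ (tsum _), ← tsum_mul_right]
      have : ∀ q : ℤ × ℤ, (if Nonres (a, q) then osc (reson (a, q)) r * (v q.1 r * v q.2 r *
          v (last (a, q)) r) else 0) * v a r = if Nonres (a, q) then
          osc (reson (a, q)) r * prod4 v (a, q) r else 0 := by
        intro q
        split_ifs
        · simp only [prod4]; ring
        · simp
      simp only [this]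
      push_cast; ring
    have e2 : v (-a) r * (starRingEnd ℂ) (g (-a) r)
        = (starRingEnd ℂ) (g (-a) r * (starRingEnd ℂ) (v (-a) r)) := by
      rw [map_mul, Complex.conj_conj]; ring
    rw [e2, Complex.add_conj, e1, Complex.add_re, Complex.re_ofReal_mul, Complex.I_re]
    simp
  rw [intervalIntegral.integral_congr_ae hae, intervalIntegral.integral_ofReal] at hE
  have hre : ∫ r in 0..t, 2 * (w r).re = 2 * (∫ r in 0..t, w r).re := by
    have hwi : IntegrableOn w (Ioc 0 t) := by
      refine Integrable.const_mul ?_ _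
      refine ⟨?_, ?_⟩
      · exact AEStronglyMeasurable.tsum hmeas
      · refine lt_of_le_of_lt (lintegral_mono fun r => enorm_tsum_le_tsum_enorm) ?_
        rw [lintegral_tsum fun q => (hmeas q).enorm]
        exact hsum.lt_top
    rw [intervalIntegral.integral_const_mul, intervalIntegral.integral_of_le ht.1,
      intervalIntegral.integral_of_le ht.1]
    congr 1
    exact integral_re hwi
  rw [hre, hint] at hE
  simp only [Complex.mul_conj, Complex.normSq_eq_norm_sq] at hE
  exact_mod_cast hE.symm

/-- The energy identity, with the multiplier symmetrized over the four frequencies. -/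
lemma energy_identity (h : IsProfile T s M X v g) (hs : 1 / 6 < s) {wt : ℤ → ℝ} {K : Finset ℤ}
    (hwt : ∀ k, wt (-k) = wt k) (hK : ∀ k ∉ K, wt k = 0) {t : ℝ} (ht : t ∈ Icc 0 T) :
    ENNReal.ofReal (∑' k, wt k * (‖v k t‖ ^ 2 - ‖v k 0‖ ^ 2)) ≤ ENNReal.ofReal Real.pi *
      ∑' p : ℤ × ℤ × ℤ, ‖p.1 * wt p.1 + p.2.1 * wt p.2.1 + p.2.2 * wt p.2.2
        + last p * wt (last p)‖ₑ * ‖interaction v t p‖ₑ := by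
  set φ : ℤ → ℂ := fun k => ((k * wt k : ℝ) : ℂ) with hφ
  have hφK : ∀ k ∉ K, φ k = 0 := fun k hk => by simp [hφ, hK k hk]
  have hsum := h.summable_interaction hs φ hφK ht
  have e1 : ∑' k, wt k * (‖v k t‖ ^ 2 - ‖v k 0‖ ^ 2)
      = ∑' a, wt a * (‖v (-a) t‖ ^ 2 - ‖v (-a) 0‖ ^ 2) := by
    rw [← (Equiv.neg ℤ).tsum_eq]
    exact tsum_congr fun a => by simp only [Equiv.neg_apply, hwt]
  have e2 : ∑' a, wt a * (‖v (-a) t‖ ^ 2 - ‖v (-a) 0‖ ^ 2)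
      = (4 * Real.pi * Complex.I * ∑' p : ℤ × ℤ × ℤ, φ p.1 * interaction v t p).re := by
    rw [hsum.tsum_prod]
    rw [tsum_eq_sum (s := K) fun k hk => by simp [hK k hk],
      tsum_eq_sum (s := K) fun k hk => by simp [hφK k hk], Finset.mul_sum, Complex.re_sum]
    refine Finset.sum_congr rfl fun a _ => ?_
    rw [h.norm_sq_sub hs a ht]
    simp only [tsum_mul_left]
    have : 4 * (Real.pi : ℂ) * Complex.I * (φ a * ∑' q : ℤ × ℤ, interaction v t (a, q))
        = ((2 * wt a : ℝ) : ℂ) * (2 * Real.pi * a * Complex.I *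
          ∑' q : ℤ × ℤ, interaction v t (a, q)) := by
      simp only [hφ]; push_cast; ring
    rw [this, Complex.re_ofReal_mul]; ring
  have e3 : 4 * Real.pi * Complex.I * ∑' p : ℤ × ℤ × ℤ, φ p.1 * interaction v t p
      = Real.pi * Complex.I * ∑' p : ℤ × ℤ × ℤ, (φ p.1 + φ p.2.1 + φ p.2.2 + φ (last p)) *
        interaction v t p := by
    rw [← tsum_mul_interaction φ v t hsum]; ring
  rw [e1, e2, e3]
  calc _ ≤ ‖Real.pi * Complex.I * ∑' p : ℤ × ℤ × ℤ, (φ p.1 + φ p.2.1 + φ p.2.2 + φ (last p)) *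
        interaction v t p‖ₑ := by
        rw [← ofReal_norm]
        exact ENNReal.ofReal_le_ofReal ((le_abs_self _).trans (Complex.abs_re_le_norm _))
    _ ≤ _ := by
        rw [enorm_mul]
        gcongr
        · rw [← ofReal_norm]; simp [abs_of_pos Real.pi_pos]
        · refine enorm_tsum_le_tsum_enorm.trans_eq (tsum_congr fun p => ?_)
          rw [enorm_mul]
          congr 1
          simp only [hφ]
          rw [← Complex.ofReal_add, ← Complex.ofReal_add, ← Complex.ofReal_add]
          rw [← ofReal_norm, Complex.norm_real, ofReal_norm]

end IsProfile

end MKdV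

namespace MKdV

/-- The symmetrized multiplier divided by the gains of the two bounds for the oscillatory integral.
With `Ω` the resonance function, the multiplier is at most `|Ω| B^{s-1}` and `|Ω|^{1/8}` at most
`B^{3/16}` up to constants; the exponent `s - 9/20` leaves room for the `11/10` derivatives lost by
the forcing. -/
lemma exists_multiplier_bound {s : ℝ} (hs : 0 ≤ s) : ∃ K : ℝ≥0, ∀ R : ℝ, 1 ≤ R →
    ∀ p : ℤ × ℤ × ℤ, Nonres p →
      |p.1 * weight s R p.1 + p.2.1 * weight s R p.2.1 + p.2.2 * weight s R p.2.2
        + last p * weight s R (last p)| * |reson p| ^ (-(7 / 8) : ℝ)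
          ≤ K * maxBr p ^ (s - 9 / 20) ∧
      |p.1 * weight s R p.1 + p.2.1 * weight s R p.2.1 + p.2.2 * weight s R p.2.2
        + last p * weight s R (last p)| * |reson p|⁻¹ ≤ K * maxBr p ^ (s - 1) := by
  obtain ⟨C, hC⟩ := exists_isSymbol_weight s
  have hC0 : 0 ≤ C := by
    obtain ⟨_, _, h⟩ := hC 1 le_rfl
    exact h.nonneg
  set K₀ : ℝ := (32 + 2 * 4 ^ |s - 1 / 2|) * C with hK₀
  have hK0 : 0 ≤ K₀ := by positivity
  refine ⟨⟨8 * K₀, by positivity⟩, fun R hR p hp => ?_⟩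
  obtain ⟨f₁, f₂, h⟩ := hC R hR
  have one : ∀ x y : ℤ, x + y ≠ 0 → (1 : ℝ) ≤ |(x : ℝ) + y| := fun x y hxy => by
    exact_mod_cast Int.one_le_abs hxy
  have hm := h.abs_sum_le hs (fun x => by rw [weight_neg, neg_mul])
    (x := p.1) (y := p.2.1) (z := p.2.2) (w := last p) (B := maxBr p)
    (by simp only [last]; push_cast; ring) (le_maxBr₁ p) (le_maxBr₂ p) (le_maxBr₃ p) (le_maxBr₄ p)
    (maxBr_eq p) (one _ _ hp.1) (one _ _ hp.2.1) (one _ _ hp.2.2)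
  set m := |p.1 * weight s R p.1 + p.2.1 * weight s R p.2.1 + p.2.2 * weight s R p.2.2
        + last p * weight s R (last p)|
  set B := maxBr p
  set D := |(p.1 : ℝ) + p.2.1| * |(p.1 : ℝ) + p.2.2| * |(p.2.1 : ℝ) + p.2.2| with hD
  have hB1 : 1 ≤ B := one_le_maxBr p
  have hB0 : 0 < B := by linarith
  have hD1 : 1 ≤ D := one_le_mul_of_one_le_of_one_le
    (one_le_mul_of_one_le_of_one_le (one _ _ hp.1) (one _ _ hp.2.1)) (one _ _ hp.2.2)
  have hD0 : 0 < D := by linarith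
  have hΩ : D ≤ |reson p| := by
    have hpi : (1 : ℝ) ≤ 3 * (2 * Real.pi) ^ 3 := by
      have : (1 : ℝ) ≤ 2 * Real.pi := by linarith [Real.pi_gt_three]
      nlinarith [one_le_pow₀ this (n := 3)]
    rw [reson_eq, abs_mul, abs_neg, abs_of_nonneg (by linarith : 0 ≤ 3 * (2 * Real.pi) ^ 3),
      abs_mul, abs_mul, ← hD]
    exact le_mul_of_one_le_left hD0.le hpi
  have hDB : D ≤ 8 * B ^ (3 / 2 : ℝ) := by
    have sq : ∀ x : ℝ, bracketSq x ≤ B → |x| ≤ B ^ (1 / 2 : ℝ) := fun x hx =>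
      (abs_le_bracketSq_rpow x).trans (Real.rpow_le_rpow (bracketSq_pos x).le hx (by norm_num))
    have h1 := sq _ (le_maxBr₁ p)
    have h2 := sq _ (le_maxBr₂ p)
    have h3 := sq _ (le_maxBr₃ p)
    set q := B ^ (1 / 2 : ℝ) with hq
    have e : B ^ (3 / 2 : ℝ) = q * q * q := by
      rw [hq, ← Real.rpow_add hB0, ← Real.rpow_add hB0]; norm_num
    have hq0 : 0 ≤ q := (abs_nonneg _).trans h1
    calc D ≤ (q + q) * (q + q) * (q + q) := by
          rw [hD]
          gcongr
          · exact (abs_add_le _ _).trans (add_le_add h1 h2)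
          · exact (abs_add_le _ _).trans (add_le_add h1 h3)
          · exact (abs_add_le _ _).trans (add_le_add h2 h3)
      _ = _ := by rw [e]; ring
  have pB : ∀ r : ℝ, 0 ≤ B ^ r := fun r => Real.rpow_nonneg hB0.le r
  have hm' : m ≤ K₀ * D * B ^ (s - 1) := hm
  constructor
  · change _ ≤ 8 * K₀ * _
    calc m * |reson p| ^ (-(7 / 8) : ℝ) ≤ (K₀ * D * B ^ (s - 1)) * D ^ (-(7 / 8) : ℝ) := by
          refine mul_le_mul hm' (Real.rpow_le_rpow_of_nonpos hD0 hΩ (by norm_num))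
            (by positivity) ?_
          exact mul_nonneg (by positivity) (pB _)
      _ = K₀ * B ^ (s - 1) * D ^ (1 / 8 : ℝ) := by
          have : D * D ^ (-(7 / 8) : ℝ) = D ^ (1 / 8 : ℝ) := by
            rw [← Real.rpow_one_add' hD0.le (by norm_num)]; norm_num
          rw [← this]; ring
      _ ≤ K₀ * B ^ (s - 1) * (8 * B ^ (3 / 16 : ℝ)) := by
          refine mul_le_mul_of_nonneg_left ?_ (mul_nonneg hK0 (pB _))
          refine (Real.rpow_le_rpow hD0.le hDB (by norm_num)).trans ?_
          rw [Real.mul_rpow (by norm_num) (pB _), ← Real.rpow_mul hB0.le]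
          refine mul_le_mul ?_ (by norm_num) (pB _) (by norm_num)
          exact Real.rpow_le_self_of_one_le (by norm_num) (by norm_num)
      _ = 8 * K₀ * B ^ (s - 13 / 16) := by
          have : B ^ (s - 13 / 16) = B ^ (s - 1) * B ^ (3 / 16 : ℝ) := by
            rw [← Real.rpow_add hB0]; ring_nf
          rw [this]; ring
      _ ≤ _ := by
          refine mul_le_mul_of_nonneg_left ?_ (by positivity)
          exact Real.rpow_le_rpow_of_exponent_le hB1 (by linarith)
  · change _ ≤ 8 * K₀ * _
    calc m * |reson p|⁻¹ ≤ (K₀ * D * B ^ (s - 1)) * D⁻¹ := by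
          refine mul_le_mul hm' (inv_anti₀ hD0 hΩ) (by positivity) ?_
          exact mul_nonneg (by positivity) (pB _)
      _ = K₀ * B ^ (s - 1) := by field_simp
      _ ≤ _ := by nlinarith [mul_nonneg hK0 (pB (s - 1))]

/-- The quadrilinear estimate with one factor measured `11/10` derivatives below the others. -/
lemma tsum_maxBr_mul_le' {s : ℝ} {C : ℝ≥0} (hC : ∀ f₁ f₂ f₃ f₄ : ℤ → ℝ≥0∞,
    ∑' p : ℤ × ℤ × ℤ, ENNReal.ofReal (maxBr p ^ (s - 9 / 20)) *
      (f₁ p.1 * f₂ p.2.1 * f₃ p.2.2 * f₄ (last p))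
      ≤ C * (hNorm s f₁ * hNorm s f₂ * hNorm s f₃ * hNorm s f₄)) (γ f : ℤ → ℝ≥0∞) :
    ∑' p : ℤ × ℤ × ℤ, ENNReal.ofReal (maxBr p ^ (s - 1)) *
      (γ p.1 * f p.2.1 * f p.2.2 * f (last p) + f p.1 * γ p.2.1 * f p.2.2 * f (last p)
      + f p.1 * f p.2.1 * γ p.2.2 * f (last p) + f p.1 * f p.2.1 * f p.2.2 * γ (last p))
      ≤ 4 * C * (hNorm (s - 11 / 10) γ * hNorm s f ^ 3) := by
  set γ' : ℤ → ℝ≥0∞ := fun k => br (-(11 / 20)) k * γ k with hγ'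
  have hN : hNorm s γ' = hNorm (s - 11 / 10) γ := by
    rw [hγ', hNorm_br_mul]; congr 1; ring
  have hk : ∀ (p : ℤ × ℤ × ℤ) (k : ℤ), bracketSq k ≤ maxBr p →
      ENNReal.ofReal (maxBr p ^ (s - 1))
        ≤ ENNReal.ofReal (maxBr p ^ (s - 9 / 20)) * br (-(11 / 20)) k := by
    intro p k hpk
    have hB0 : 0 < maxBr p := lt_of_lt_of_le one_pos (one_le_maxBr p)
    rw [br, ← ENNReal.ofReal_mul (Real.rpow_nonneg hB0.le _)]
    refine ENNReal.ofReal_le_ofReal ?_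
    rw [show s - 1 = (s - 9 / 20) + -(11 / 20) by ring, Real.rpow_add hB0]
    exact mul_le_mul_of_nonneg_left (Real.rpow_le_rpow_of_nonpos (bracketSq_pos _) hpk
      (by norm_num)) (Real.rpow_nonneg hB0.le _)
  calc _ ≤ ∑' p : ℤ × ℤ × ℤ, (ENNReal.ofReal (maxBr p ^ (s - 9 / 20)) *
        (γ' p.1 * f p.2.1 * f p.2.2 * f (last p)) + ENNReal.ofReal (maxBr p ^ (s - 9 / 20)) *
        (f p.1 * γ' p.2.1 * f p.2.2 * f (last p)) + ENNReal.ofReal (maxBr p ^ (s - 9 / 20)) *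
        (f p.1 * f p.2.1 * γ' p.2.2 * f (last p)) + ENNReal.ofReal (maxBr p ^ (s - 9 / 20)) *
        (f p.1 * f p.2.1 * f p.2.2 * γ' (last p))) := by
        refine ENNReal.tsum_le_tsum fun p => ?_
        rw [mul_add, mul_add, mul_add]
        refine add_le_add (add_le_add (add_le_add ?_ ?_) ?_) ?_
        · refine (mul_le_mul_left (hk p _ (le_maxBr₁ p)) _).trans_eq ?_
          simp only [hγ']; ring
        · refine (mul_le_mul_left (hk p _ (le_maxBr₂ p)) _).trans_eq ?_
          simp only [hγ']; ring
        · refine (mul_le_mul_left (hk p _ (le_maxBr₃ p)) _).trans_eq ?_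
          simp only [hγ']; ring
        · refine (mul_le_mul_left (hk p _ (le_maxBr₄ p)) _).trans_eq ?_
          simp only [hγ']; ring
    _ ≤ C * (hNorm s γ' * hNorm s f * hNorm s f * hNorm s f)
        + C * (hNorm s f * hNorm s γ' * hNorm s f * hNorm s f)
        + C * (hNorm s f * hNorm s f * hNorm s γ' * hNorm s f)
        + C * (hNorm s f * hNorm s f * hNorm s f * hNorm s γ') := by
        simp only [ENNReal.tsum_add]
        exact add_le_add (add_le_add (add_le_add (hC _ _ _ _) (hC _ _ _ _)) (hC _ _ _ _))
          (hC _ _ _ _)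
    _ = _ := by rw [hN]; ring

namespace IsProfile

variable {T s : ℝ} {M X : ℝ≥0∞} {v g : ℤ → ℝ → ℂ}

lemma acDeriv_prod4 (h : IsProfile T s M X v g) (p : ℤ × ℤ × ℤ) :
    ACDeriv T (prod4 v p) (fun r =>
      ((g p.1 r * v p.2.1 r + v p.1 r * g p.2.1 r) * v p.2.2 r
        + (v p.1 r * v p.2.1 r) * g p.2.2 r) * v (last p) r
        + (v p.1 r * v p.2.1 r * v p.2.2 r) * g (last p) r) :=
  (((h.acDeriv _).mul (h.acDeriv _)).mul (h.acDeriv _)).mul (h.acDeriv _)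

/-- The forcing in `L¹_t h^{s - 11/10}`, by the Cauchy-Schwarz inequality in time. -/
lemma lintegral_hNorm_le (h : IsProfile T s M X v g) (hT : 0 < T) (hT1 : T ≤ 1) :
    ∫⁻ r in Ioc 0 T, hNorm (s - 11 / 10) (fun k => ‖g k r‖ₑ)
      ≤ ENNReal.ofReal (T ^ (1 / 8 : ℝ)) * X := by
  have hm : ∀ k, AEMeasurable (fun r => ‖g k r‖ₑ) (volume.restrict (Ioc 0 T)) := fun k =>
    (h.integrable k).aestronglyMeasurable.restrict.enorm
  have hm2 : ∀ k, AEMeasurable (fun r => br (s - 11 / 10) k * ‖g k r‖ₑ ^ 2)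
      (volume.restrict (Ioc 0 T)) := fun k => ((hm k).pow_const 2).const_mul _
  have hmN : AEMeasurable (fun r => hNorm (s - 11 / 10) (fun k => ‖g k r‖ₑ))
      (volume.restrict (Ioc 0 T)) := (AEMeasurable.tsum hm2).pow_const _
  have cs := ENNReal.lintegral_mul_le_Lp_mul_Lq (volume.restrict (Ioc 0 T))
    Real.HolderConjugate.two_two (f := fun _ => 1) aemeasurable_const hmN
  simp only [Pi.mul_apply, one_mul, one_pow, lintegral_const, Measure.restrict_apply_univ,
    Real.volume_Ioc, sub_zero, ENNReal.rpow_ofNat, hNorm_sq] at cs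
  refine cs.trans (mul_le_mul' ?_ ?_)
  · rw [ENNReal.ofReal_rpow_of_pos hT]
    exact ENNReal.ofReal_le_ofReal (Real.rpow_le_rpow_of_exponent_ge hT hT1 (by norm_num))
  · rw [lintegral_tsum hm2]
    simp_rw [fun k => lintegral_const_mul'' (br (s - 11 / 10) k) ((hm k).pow_const 2)]
    refine (ENNReal.rpow_le_rpow h.deriv_bound (by norm_num)).trans_eq ?_
    rw [← ENNReal.rpow_natCast, ← ENNReal.rpow_mul]; norm_num

end IsProfile

/-- The energy estimate on the Fourier side. -/
theorem exists_profile_estimate {s : ℝ} (hs : 1 / 6 < s) : ∃ C : ℝ≥0, ∀ (T : ℝ) (M X : ℝ≥0∞)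
    (v g : ℤ → ℝ → ℂ), 0 < T → T ≤ 1 → IsProfile T s M X v g → ∀ t ∈ Icc 0 T,
      hNorm s (fun k => ‖v k t‖ₑ) ^ 2 ≤ hNorm s (fun k => ‖v k 0‖ₑ) ^ 2 +
        C * (ENNReal.ofReal (T ^ (1 / 8 : ℝ)) * (M ^ 4 + X * M ^ 3)) := by
  obtain ⟨C, hC⟩ := tsum_maxBr_mul_le (s := s) (by linarith)
  obtain ⟨K, hK⟩ := exists_multiplier_bound (s := s) (by linarith)
  refine ⟨Real.pi.toNNReal * (K * (4 * C)), fun T M X v g hT hT1 h t ht => ?_⟩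
  set τ := ENNReal.ofReal (T ^ (1 / 8 : ℝ)) with hτ
  let f : ℝ → ℤ → ℝ≥0∞ := fun r k => ‖v k r‖ₑ
  let γ : ℝ → ℤ → ℝ≥0∞ := fun r k => ‖g k r‖ₑ
  let W : ℤ × ℤ × ℤ → ℝ≥0∞ := fun p => ENNReal.ofReal (maxBr p ^ (s - 9 / 20))
  let W' : ℤ × ℤ × ℤ → ℝ≥0∞ := fun p => ENNReal.ofReal (maxBr p ^ (s - 1))
  let P : ℤ × ℤ × ℤ → ℝ → ℝ≥0∞ := fun p r => ‖prod4 v p r‖ₑ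
  let Q : ℤ × ℤ × ℤ → ℝ → ℝ≥0∞ := fun p r =>
    γ r p.1 * f r p.2.1 * f r p.2.2 * f r (last p) + f r p.1 * γ r p.2.1 * f r p.2.2 * f r (last p)
    + f r p.1 * f r p.2.1 * γ r p.2.2 * f r (last p)
    + f r p.1 * f r p.2.1 * f r p.2.2 * γ r (last p)
  have h0 : (0 : ℝ) ∈ Icc 0 T := ⟨le_rfl, hT.le⟩
  -- the products without time derivative, at a fixed time
  have hP : ∀ r ∈ Icc 0 T, ∑' p, W p * P p r ≤ C * M ^ 4 := by
    intro r hr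
    have := hC (f r) (f r) (f r) (f r)
    have hb : hNorm s (f r) ≤ M := h.bound r hr
    calc _ = ∑' p : ℤ × ℤ × ℤ, W p * (f r p.1 * f r p.2.1 * f r p.2.2 * f r (last p)) := by
          refine tsum_congr fun p => ?_
          simp only [P, prod4, enorm_mul, f]
      _ ≤ C * (hNorm s (f r) * hNorm s (f r) * hNorm s (f r) * hNorm s (f r)) := this
      _ ≤ C * (M * M * M * M) := by gcongr
      _ = _ := by ring
  have hPm : ∀ p, AEMeasurable (P p) (volume.restrict (Ioc 0 T)) := fun p =>
    (h.continuous_prod4 p).enorm.measurable.aemeasurable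
  have hPint : ∑' p, W p * (ENNReal.ofReal T⁻¹ * ∫⁻ r in Ioc 0 T, P p r) ≤ C * M ^ 4 := by
    have e : ∀ p, W p * (ENNReal.ofReal T⁻¹ * ∫⁻ r in Ioc 0 T, P p r)
        = ENNReal.ofReal T⁻¹ * ∫⁻ r in Ioc 0 T, W p * P p r := fun p => by
      rw [lintegral_const_mul'' _ (hPm p)]; ring
    simp_rw [e]
    rw [ENNReal.tsum_mul_left, ← lintegral_tsum fun p => (hPm p).const_mul _]
    calc _ ≤ ENNReal.ofReal T⁻¹ * ∫⁻ r in Ioc 0 T, C * M ^ 4 := by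
          gcongr 1
          exact setLIntegral_mono' measurableSet_Ioc fun r hr => hP r ⟨hr.1.le, hr.2⟩
      _ = _ := by
          rw [setLIntegral_const, Real.volume_Ioc, sub_zero, mul_comm (_ * _), ← mul_assoc,
            ← ENNReal.ofReal_mul (by positivity), inv_mul_cancel₀ hT.ne', ENNReal.ofReal_one,
            one_mul]
  -- the products with one time derivative
  have hγm : ∀ k, AEMeasurable (fun r => γ r k) (volume.restrict (Ioc 0 T)) := fun k =>
    (h.integrable k).aestronglyMeasurable.restrict.enorm
  have hfm : ∀ k, AEMeasurable (fun r => f r k) (volume.restrict (Ioc 0 T)) := fun k =>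
    (h.continuous k).enorm.measurable.aemeasurable
  have hQm : ∀ p, AEMeasurable (Q p) (volume.restrict (Ioc 0 T)) := fun p =>
    ((((((hγm _).mul (hfm _)).mul (hfm _)).mul (hfm _)).add
      ((((hfm _).mul (hγm _)).mul (hfm _)).mul (hfm _))).add
      ((((hfm _).mul (hfm _)).mul (hγm _)).mul (hfm _))).add
      ((((hfm _).mul (hfm _)).mul (hfm _)).mul (hγm _))
  have hQint : ∑' p, W' p * ∫⁻ r in Ioc 0 T, Q p r ≤ 4 * C * (τ * X * M ^ 3) := by
    have e : ∀ p, W' p * ∫⁻ r in Ioc 0 T, Q p r = ∫⁻ r in Ioc 0 T, W' p * Q p r := fun p => by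
      rw [lintegral_const_mul'' _ (hQm p)]
    simp_rw [e]
    rw [← lintegral_tsum fun p => (hQm p).const_mul _]
    calc _ ≤ ∫⁻ r in Ioc 0 T, 4 * C * (hNorm (s - 11 / 10) (γ r) * M ^ 3) := by
          refine setLIntegral_mono' measurableSet_Ioc fun r hr => ?_
          refine (tsum_maxBr_mul_le' hC (γ r) (f r)).trans ?_
          gcongr
          exact h.bound r ⟨hr.1.le, hr.2⟩
      _ = 4 * C * ((∫⁻ r in Ioc 0 T, hNorm (s - 11 / 10) (γ r)) * M ^ 3) := by
          rw [lintegral_const_mul' _ _ (ENNReal.mul_ne_top (by norm_num) ENNReal.coe_ne_top),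
            lintegral_mul_const' _ _ (ENNReal.pow_ne_top h.bound_ne_top)]
      _ ≤ _ := by
          gcongr
          exact h.lintegral_hNorm_le hT hT1
  -- the estimate of the truncated energy
  have trunc : ∀ R : ℝ, 1 ≤ R → ENNReal.ofReal (∑' k : ℤ, weight s R k *
      (‖v k t‖ ^ 2 - ‖v k 0‖ ^ 2)) ≤ ENNReal.ofReal Real.pi * (K * (4 * C *
        (τ * (M ^ 4 + X * M ^ 3)))) := by
    intro R hR
    have hR0 : 0 < R := by linarith
    have hsupp : ∀ k ∉ Finset.Icc (-⌈2 * R⌉) ⌈2 * R⌉, weight s R (k : ℤ) = 0 := by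
      intro k hk
      apply weight_eq_zero hR0
      by_contra hlt
      push Not at hlt
      apply hk
      have h2 : |(k : ℝ)| ≤ ⌈2 * R⌉ := hlt.le.trans (Int.le_ceil _)
      have h3 : |k| ≤ ⌈2 * R⌉ := by exact_mod_cast h2
      rw [Finset.mem_Icc]; exact abs_le.1 h3
    refine (h.energy_identity hs (wt := fun k => weight s R k) (fun k => by
      push_cast; exact weight_neg _ _ _) hsupp ht).trans (mul_le_mul_right ?_ _)
    calc _ ≤ ∑' p, (K * τ * (W p * (ENNReal.ofReal T⁻¹ * ∫⁻ r in Ioc 0 T, P p r) + W p * P p t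
          + W p * P p 0) + K * (W' p * ∫⁻ r in Ioc 0 T, Q p r)) := by
          refine ENNReal.tsum_le_tsum fun p => ?_
          by_cases hp : Nonres p
          swap
          · simp [interaction, hp]
          obtain ⟨k1, k2⟩ := hK R hR p hp
          have hΩ : reson p ≠ 0 := by
            rw [reson_eq]
            have hpi := Real.pi_pos
            refine mul_ne_zero (neg_ne_zero.2 (by positivity)) (mul_ne_zero (mul_ne_zero ?_ ?_) ?_)
            · exact_mod_cast hp.1
            · exact_mod_cast hp.2.1
            · exact_mod_cast hp.2.2
          have hI := (h.acDeriv_prod4 p).enorm_integral_osc_le_interp ht hT hΩ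
          have hI' : ‖interaction v t p‖ₑ ≤ ENNReal.ofReal (|reson p| ^ (-(7 / 8) : ℝ)) * τ *
              (ENNReal.ofReal T⁻¹ * (∫⁻ r in Ioc 0 T, P p r) + P p t + P p 0) +
              ENNReal.ofReal |reson p|⁻¹ * ∫⁻ r in Ioc 0 T, Q p r := by
            rw [interaction, if_pos hp]
            refine hI.trans ?_
            gcongr with r
            refine (enorm_add_le _ _).trans ?_
            rw [enorm_mul, enorm_mul _ (g (last p) r)]
            refine (add_le_add_left (mul_le_mul_left (enorm_add_le _ _) _) _).trans ?_
            rw [enorm_mul, enorm_mul _ (g p.2.2 r)]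
            refine (add_le_add_left (mul_le_mul_left (add_le_add_left (mul_le_mul_left
              (enorm_add_le _ _) _) _) _) _).trans_eq ?_
            simp only [enorm_mul, Q, f, γ]
            ring
          set m := p.1 * weight s R p.1 + p.2.1 * weight s R p.2.1 + p.2.2 * weight s R p.2.2
            + last p * weight s R (last p)
          have m1 : ‖m‖ₑ * ENNReal.ofReal (|reson p| ^ (-(7 / 8) : ℝ)) ≤ K * W p := by
            rw [← ofReal_norm, Real.norm_eq_abs, ← ENNReal.ofReal_mul (abs_nonneg _),
              ← ENNReal.ofReal_coe_nnreal, ← ENNReal.ofReal_mul NNReal.zero_le_coe]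
            exact ENNReal.ofReal_le_ofReal k1
          have m2 : ‖m‖ₑ * ENNReal.ofReal |reson p|⁻¹ ≤ K * W' p := by
            rw [← ofReal_norm, Real.norm_eq_abs, ← ENNReal.ofReal_mul (abs_nonneg _),
              ← ENNReal.ofReal_coe_nnreal, ← ENNReal.ofReal_mul NNReal.zero_le_coe]
            exact ENNReal.ofReal_le_ofReal k2
          calc _ ≤ ‖m‖ₑ * (ENNReal.ofReal (|reson p| ^ (-(7 / 8) : ℝ)) * τ *
              (ENNReal.ofReal T⁻¹ * (∫⁻ r in Ioc 0 T, P p r) + P p t + P p 0) +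
              ENNReal.ofReal |reson p|⁻¹ * ∫⁻ r in Ioc 0 T, Q p r) := by gcongr
            _ = (‖m‖ₑ * ENNReal.ofReal (|reson p| ^ (-(7 / 8) : ℝ))) * (τ *
              (ENNReal.ofReal T⁻¹ * (∫⁻ r in Ioc 0 T, P p r) + P p t + P p 0)) +
              (‖m‖ₑ * ENNReal.ofReal |reson p|⁻¹) * ∫⁻ r in Ioc 0 T, Q p r := by ring
            _ ≤ (K * W p) * (τ *
              (ENNReal.ofReal T⁻¹ * (∫⁻ r in Ioc 0 T, P p r) + P p t + P p 0)) +
              (K * W' p) * ∫⁻ r in Ioc 0 T, Q p r := by gcongr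
            _ = _ := by ring
      _ ≤ K * τ * (C * M ^ 4 + C * M ^ 4 + C * M ^ 4) + K * (4 * C * (τ * X * M ^ 3)) := by
          simp only [ENNReal.tsum_add, ENNReal.tsum_mul_left]
          gcongr
          · exact hP t ht
          · exact hP 0 h0
      _ ≤ K * τ * (C * M ^ 4 + C * M ^ 4 + C * M ^ 4 + C * M ^ 4)
          + K * (4 * C * (τ * X * M ^ 3)) := by
          gcongr
          exact le_self_add
      _ = _ := by ring
  -- removal of the truncation
  rw [hNorm_sq, ENNReal.tsum_eq_iSup_sum]
  refine iSup_le fun F => ?_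
  obtain ⟨R, hR1, hRF⟩ : ∃ R : ℝ, 1 ≤ R ∧ ∀ k ∈ F, |(k : ℝ)| ≤ R := by
    refine ⟨1 + ∑ k ∈ F, |(k : ℝ)|, le_add_of_nonneg_right (Finset.sum_nonneg fun _ _ =>
      abs_nonneg _), fun k hk => ?_⟩
    have := Finset.single_le_sum (f := fun k : ℤ => |(k : ℝ)|) (fun _ _ => abs_nonneg _) hk
    linarith
  have hR0 : 0 < R := by linarith
  have hsupp : ∀ k ∉ F ∪ Finset.Icc (-⌈2 * R⌉) ⌈2 * R⌉, weight s R (k : ℤ) = 0 := by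
    intro k hk
    apply weight_eq_zero hR0
    by_contra hlt
    push Not at hlt
    apply hk
    have h2 : |(k : ℝ)| ≤ ⌈2 * R⌉ := hlt.le.trans (Int.le_ceil _)
    have h3 : |k| ≤ ⌈2 * R⌉ := by exact_mod_cast h2
    rw [Finset.mem_union, Finset.mem_Icc]; exact Or.inr (abs_le.1 h3)
  set L := F ∪ Finset.Icc (-⌈2 * R⌉) ⌈2 * R⌉
  have conv : ∀ r : ℝ, ENNReal.ofReal (∑ k ∈ L, weight s R k * ‖v k r‖ ^ 2)
      = ∑ k ∈ L, ENNReal.ofReal (weight s R k) * ‖v k r‖ₑ ^ 2 := by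
    intro r
    rw [ENNReal.ofReal_sum_of_nonneg fun k _ => mul_nonneg (weight_nonneg _ _ _) (sq_nonneg _)]
    refine Finset.sum_congr rfl fun k _ => ?_
    rw [ENNReal.ofReal_mul (weight_nonneg _ _ _), ENNReal.ofReal_pow (norm_nonneg _), ofReal_norm]
  calc ∑ k ∈ F, br s k * ‖v k t‖ₑ ^ 2
      ≤ ∑ k ∈ F, ENNReal.ofReal (weight s R k) * ‖v k t‖ₑ ^ 2 := by
        refine Finset.sum_le_sum fun k hk => ?_
        rw [weight_eq hR0 (hRF k hk)]; rfl
    _ ≤ ∑ k ∈ L, ENNReal.ofReal (weight s R k) * ‖v k t‖ₑ ^ 2 :=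
        Finset.sum_le_sum_of_subset Finset.subset_union_left
    _ = ENNReal.ofReal (∑ k ∈ L, weight s R k * ‖v k 0‖ ^ 2
          + ∑' k : ℤ, weight s R k * (‖v k t‖ ^ 2 - ‖v k 0‖ ^ 2)) := by
        rw [← conv, tsum_eq_sum (s := L) fun k hk => by rw [hsupp k hk, zero_mul],
          ← Finset.sum_add_distrib]
        congr 1
        exact Finset.sum_congr rfl fun k _ => by ring
    _ ≤ ENNReal.ofReal (∑ k ∈ L, weight s R k * ‖v k 0‖ ^ 2)
          + ENNReal.ofReal (∑' k : ℤ, weight s R k * (‖v k t‖ ^ 2 - ‖v k 0‖ ^ 2)) :=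
        ENNReal.ofReal_add_le
    _ ≤ _ := by
        refine add_le_add ?_ ((trunc R hR1).trans_eq ?_)
        · rw [conv, hNorm_sq]
          refine le_trans (Finset.sum_le_sum fun k _ => ?_) (ENNReal.sum_le_tsum L)
          exact mul_le_mul_left (ENNReal.ofReal_le_ofReal (weight_le _ _ _)) _
        · push_cast
          rw [ENNReal.ofReal]; ring

end MKdV

namespace MKdV

open AddCircle Filter Topology

/-! ### Fourier coefficients of integrable functions on the torus -/

theorem volume_torus : (volume : Measure Torus) = haarAddCircle := by
  rw [volume_eq_smul_haarAddCircle]; simp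

/-- An integrable function on the torus is determined by its Fourier coefficients: it is
orthogonal to the trigonometric polynomials, hence to continuous functions, hence to indicators of
closed sets. -/
theorem ae_eq_zero_of_fourierCoeff_eq_zero {f : Torus → ℂ} (hf : Integrable f haarAddCircle)
    (h : ∀ k, fourierCoeff f k = 0) : f =ᵐ[haarAddCircle] 0 := by
  have hint : ∀ g : C(Torus, ℂ), Integrable (fun x => g x * f x) haarAddCircle := fun g =>
    hf.bdd_mul g.continuous.aestronglyMeasurable (ae_of_all _ fun x => g.norm_coe_le_norm x)
  let L : C(Torus, ℂ) →L[ℂ] ℂ := LinearMap.mkContinuous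
    { toFun := fun g => ∫ x, g x * f x ∂haarAddCircle
      map_add' := fun g g' => by
        rw [← integral_add (hint g) (hint g')]
        simp [add_mul]
      map_smul' := fun a g => by
        rw [RingHom.id_apply, smul_eq_mul, ← integral_const_mul]
        simp [mul_assoc] }
    (∫ x, ‖f x‖ ∂haarAddCircle) (fun g => by
      simp only [LinearMap.coe_mk, AddHom.coe_mk]
      rw [mul_comm, ← integral_const_mul]
      refine norm_integral_le_of_norm_le (hf.norm.const_mul _) (ae_of_all _ fun x => ?_)
      rw [norm_mul]
      gcongr
      exact g.norm_coe_le_norm x)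
  have hL : L = 0 := by
    have hd : Dense (Submodule.span ℂ (range (@fourier 1)) : Set C(Torus, ℂ)) :=
      Submodule.dense_iff_topologicalClosure_eq_top.2 span_fourier_closure_eq_top
    refine ContinuousLinearMap.ext_on hd ?_
    rintro _ ⟨k, rfl⟩
    have := h (-k)
    rw [fourierCoeff, neg_neg] at this
    simpa [L] using this
  have hzero : ∀ g : C(Torus, ℂ), ∫ x, g x * f x ∂haarAddCircle = 0 := fun g => by
    have := congrArg (fun l : C(Torus, ℂ) →L[ℂ] ℂ => l g) hL
    simpa [L] using this
  refine ae_eq_zero_of_forall_setIntegral_isClosed_eq_zero hf fun F hF => ?_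
  have hpos : ∀ n : ℕ, (0 : ℝ) < 1 / (n + 1) := fun n => by positivity
  let G : ℕ → C(Torus, ℂ) := fun n =>
    ⟨fun x => ((thickenedIndicator (hpos n) F x : ℝ≥0) : ℂ), by fun_prop⟩
  have hlim : Tendsto (fun n => ∫ x, G n x * f x ∂haarAddCircle) atTop
      (𝓝 (∫ x, F.indicator f x ∂haarAddCircle)) := by
    refine tendsto_integral_of_dominated_convergence (fun x => ‖f x‖)
      (fun n => (hint (G n)).aestronglyMeasurable) hf.norm (fun n => ae_of_all _ fun x => ?_)
      (ae_of_all _ fun x => ?_)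
    · rw [norm_mul]
      refine mul_le_of_le_one_left (norm_nonneg _) ?_
      have := thickenedIndicator_le_one (hpos n) F x
      simpa [G] using this
    · have h1 := thickenedIndicator_tendsto_indicator_closure hpos
        tendsto_one_div_add_atTop_nhds_zero_nat F
      rw [hF.closure_eq] at h1
      have h2 := (tendsto_pi_nhds.1 h1) x
      have h3 : Tendsto (fun n => G n x) atTop
          (𝓝 (((F.indicator (fun _ => (1 : ℝ≥0)) x : ℝ≥0) : ℂ))) := by
        have hc : Continuous fun r : ℝ≥0 => ((r : ℝ) : ℂ) := by fun_prop
        exact (hc.tendsto _).comp h2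
      convert h3.mul_const (f x) using 2
      by_cases hx : x ∈ F <;> simp [hx]
  rw [integral_indicator hF.measurableSet] at hlim
  exact tendsto_nhds_unique hlim (by simp [hzero])

theorem integrable_fourier_mul {f : Torus → ℂ} (hf : Integrable f haarAddCircle) (k : ℤ) :
    Integrable (fun x => fourier k x * f x) haarAddCircle :=
  hf.bdd_mul (fourier k).continuous.aestronglyMeasurable
    (ae_of_all _ fun x => (fourier k).norm_coe_le_norm x)

theorem fourierCoeff_fourier_mul (f : Torus → ℂ) (b m : ℤ) :
    fourierCoeff (fun x => fourier b x * f x) m = fourierCoeff f (m - b) := by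
  simp only [fourierCoeff, smul_eq_mul]
  congr 1
  ext x
  rw [← mul_assoc, ← fourier_add]
  congr 3
  ring

theorem fourierCoeff_sub {f g : Torus → ℂ} (hf : Integrable f haarAddCircle)
    (hg : Integrable g haarAddCircle) (k : ℤ) :
    fourierCoeff (fun x => f x - g x) k = fourierCoeff f k - fourierCoeff g k := by
  simp only [fourierCoeff, smul_sub]
  exact integral_sub (hf.fourier_smul _) (hg.fourier_smul _)

theorem enorm_fourierCoeff_le (f : Torus → ℂ) (k : ℤ) :
    ‖fourierCoeff f k‖ₑ ≤ eLpNorm f 1 haarAddCircle := by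
  rw [eLpNorm_one_eq_lintegral_enorm, fourierCoeff]
  refine (enorm_integral_le_lintegral_enorm _).trans (lintegral_mono fun x => ?_)
  rw [enorm_smul]
  refine mul_le_of_le_one_left' ?_
  rw [← ofReal_norm, ← ENNReal.ofReal_one]
  refine ENNReal.ofReal_le_ofReal ?_
  have := (fourier (T := 1) (-k)).norm_coe_le_norm x
  rwa [fourier_norm] at this

theorem fourierCoeff_conj (f : Torus → ℂ) (k : ℤ) :
    fourierCoeff (fun x => (starRingEnd ℂ) (f x)) k = (starRingEnd ℂ) (fourierCoeff f (-k)) := by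
  simp only [fourierCoeff, smul_eq_mul]
  rw [← integral_conj]
  congr 1
  ext x
  rw [map_mul, fourier_neg, neg_neg]

/-- The trigonometric polynomial with frequencies in `B` and coefficients `c`. -/
def trigPoly (c : ℤ → ℂ) (B : Finset ℤ) : C(Torus, ℂ) := ∑ k ∈ B, c k • fourier k

theorem trigPoly_apply (c : ℤ → ℂ) (B : Finset ℤ) (x : Torus) :
    trigPoly c B x = ∑ k ∈ B, c k * fourier k x := by
  simp [trigPoly, ContinuousMap.sum_apply]

theorem fourierCoeff_trigPoly_mul (c : ℤ → ℂ) (B : Finset ℤ) {w : Torus → ℂ}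
    (hw : Integrable w haarAddCircle) (m : ℤ) :
    fourierCoeff (fun x => trigPoly c B x * w x) m = ∑ b ∈ B, c b * fourierCoeff w (m - b) := by
  have h1 : (fun x => trigPoly c B x * w x) = ∑ b ∈ B, c b • fun x => fourier b x * w x := by
    ext x
    simp [trigPoly_apply, Finset.sum_mul, mul_assoc]
  rw [h1, fourierCoeff.sum, Finset.sum_apply]
  · refine Finset.sum_congr rfl fun b _ => ?_
    rw [fourierCoeff.const_smul, fourierCoeff_fourier_mul, smul_eq_mul]
  · exact fun b _ => (integrable_fourier_mul hw b).smul (c b)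

theorem enorm_trigPoly_le (c : ℤ → ℂ) (B : Finset ℤ) (x : Torus) :
    ‖trigPoly c B x‖ₑ ≤ ∑ k ∈ B, ‖c k‖ₑ := by
  rw [trigPoly_apply]
  refine (enorm_sum_le _ _).trans (Finset.sum_le_sum fun k _ => ?_)
  rw [enorm_mul, ← ofReal_norm (fourier k x)]
  refine mul_le_of_le_one_right' ?_
  rw [← ENNReal.ofReal_one]
  refine ENNReal.ofReal_le_ofReal ?_
  have := (fourier (T := 1) k).norm_coe_le_norm x
  rwa [fourier_norm] at this

theorem fourierCoeff_one (j : ℤ) :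
    fourierCoeff (fun _ : Torus => (1 : ℂ)) j = if j = 0 then 1 else 0 := by
  have := congrFun (fourierCoeff_fourier (T := 1) 0) j
  simp only [Pi.single_apply] at this
  rw [← this]
  congr 1
  ext x
  simp

theorem fourierCoeff_trigPoly (c : ℤ → ℂ) (B : Finset ℤ) (m : ℤ) :
    fourierCoeff (trigPoly c B) m = if m ∈ B then c m else 0 := by
  have h := fourierCoeff_trigPoly_mul c B (w := fun _ => 1) (integrable_const _) m
  simp only [mul_one] at h
  rw [h, ← Finset.sum_ite_eq B m c]
  refine Finset.sum_congr rfl fun b _ => ?_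
  rw [fourierCoeff_one]
  by_cases hb : m = b
  · simp [hb]
  · rw [if_neg (by omega), if_neg hb, mul_zero]

/-- Parseval's identity for trigonometric polynomials. -/
theorem lintegral_trigPoly_sq (c : ℤ → ℂ) (B : Finset ℤ) :
    ∫⁻ x, ‖trigPoly c B x‖ₑ ^ 2 ∂haarAddCircle = ∑ k ∈ B, ‖c k‖ₑ ^ 2 := by
  have h0 : ∀ x : Torus, (‖trigPoly c B x‖ ^ 2 : ℝ) =
      (((starRingEnd ℂ) (trigPoly c B x)) * trigPoly c B x).re := fun x => by
    rw [mul_comm, Complex.mul_conj, Complex.ofReal_re, Complex.normSq_eq_norm_sq]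
  have h1 : ∫ x, ‖trigPoly c B x‖ ^ 2 ∂haarAddCircle = ∑ k ∈ B, ‖c k‖ ^ 2 := by
    have h2 : ∫ x, ((starRingEnd ℂ) (trigPoly c B x)) * trigPoly c B x ∂haarAddCircle =
        ∑ k ∈ B, ((‖c k‖ ^ 2 : ℝ) : ℂ) := by
      have h3 : ∀ x : Torus, ((starRingEnd ℂ) (trigPoly c B x)) * trigPoly c B x =
          ∑ k ∈ B, (starRingEnd ℂ) (c k) * (fourier (-k) x * (trigPoly c B x * 1)) := fun x => by
        conv_lhs => rw [trigPoly_apply c B x, map_sum, Finset.sum_mul]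
        refine Finset.sum_congr rfl fun k _ => ?_
        rw [map_mul, fourier_neg, ← trigPoly_apply]
        ring
      simp only [h3]
      have hi : Integrable (fun x => trigPoly c B x * 1) (haarAddCircle (T := 1)) := by
        simpa using (trigPoly c B).continuous.integrable_of_hasCompactSupport
          (HasCompactSupport.of_compactSpace _)
      rw [integral_finsetSum]
      · refine Finset.sum_congr rfl fun k hk => ?_
        rw [integral_const_mul]
        have h4 := fourierCoeff_trigPoly c B k
        rw [fourierCoeff, if_pos hk] at h4
        simp only [smul_eq_mul] at h4
        simp only [mul_one, h4]
        simp [Complex.conj_mul']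
      · exact fun k _ => (integrable_fourier_mul hi _).const_mul _
    rw [← Complex.ofReal_sum] at h2
    have h3 := congrArg Complex.re h2
    rw [Complex.ofReal_re] at h3
    rw [← h3]
    simp only [h0]
    have hc : Integrable (fun x : Torus => (starRingEnd ℂ) (trigPoly c B x) * trigPoly c B x)
        haarAddCircle :=
      Continuous.integrable_of_hasCompactSupport (by fun_prop) (HasCompactSupport.of_compactSpace _)
    exact integral_re hc
  have h2 : ∫⁻ x, ‖trigPoly c B x‖ₑ ^ 2 ∂haarAddCircle =
      ENNReal.ofReal (∫ x, ‖trigPoly c B x‖ ^ 2 ∂haarAddCircle) := by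
    rw [ofReal_integral_eq_lintegral_ofReal]
    · simp only [← ofReal_norm, ENNReal.ofReal_pow (norm_nonneg _)]
    · exact Continuous.integrable_of_hasCompactSupport (by fun_prop)
        (HasCompactSupport.of_compactSpace _)
    · exact ae_of_all _ fun x => by positivity
  rw [h2, h1, ENNReal.ofReal_sum_of_nonneg fun _ _ => by positivity]
  simp only [← ofReal_norm, ENNReal.ofReal_pow (norm_nonneg _)]

/-- The `L³` norm of a trigonometric polynomial is bounded by interpolating between `L^∞` and
`L²`. -/
theorem eLpNorm_trigPoly_pow_le (c : ℤ → ℂ) (B : Finset ℤ) :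
    eLpNorm (trigPoly c B) 3 haarAddCircle ^ 6 ≤ B.card * (∑ k ∈ B, ‖c k‖ₑ ^ 2) ^ 3 := by
  have h3 : eLpNorm (trigPoly c B) 3 haarAddCircle ^ 3 =
      ∫⁻ x, ‖trigPoly c B x‖ₑ ^ 3 ∂haarAddCircle := by
    have := eLpNorm_nnreal_pow_eq_lintegral (f := trigPoly c B)
      (μ := haarAddCircle) (p := 3) (by norm_num)
    simpa using this
  have h4 : ∫⁻ x, ‖trigPoly c B x‖ₑ ^ 3 ∂haarAddCircle ≤
      (∑ k ∈ B, ‖c k‖ₑ) * ∑ k ∈ B, ‖c k‖ₑ ^ 2 := by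
    rw [← lintegral_trigPoly_sq, ← lintegral_const_mul' _ _ (by simp [ENNReal.sum_eq_top])]
    refine lintegral_mono fun x => ?_
    rw [pow_succ']
    gcongr
    exact enorm_trigPoly_le c B x
  have h5 : (∑ k ∈ B, ‖c k‖ₑ) ^ 2 ≤ B.card * ∑ k ∈ B, ‖c k‖ₑ ^ 2 := by
    have : ((∑ k ∈ B, ‖c k‖₊ : ℝ≥0) : ℝ) ^ 2 ≤ B.card * ∑ k ∈ B, (‖c k‖₊ : ℝ) ^ 2 := by
      push_cast
      exact sq_sum_le_card_mul_sum_sq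
    have h6 : (∑ k ∈ B, ‖c k‖₊ : ℝ≥0) ^ 2 ≤ B.card * ∑ k ∈ B, ‖c k‖₊ ^ 2 := by
      exact_mod_cast this
    simp only [enorm_eq_nnnorm]
    exact_mod_cast h6
  calc eLpNorm (trigPoly c B) 3 haarAddCircle ^ 6
      = (eLpNorm (trigPoly c B) 3 haarAddCircle ^ 3) ^ 2 := by rw [← pow_mul]
    _ ≤ ((∑ k ∈ B, ‖c k‖ₑ) * ∑ k ∈ B, ‖c k‖ₑ ^ 2) ^ 2 := by rw [h3]; gcongr
    _ = (∑ k ∈ B, ‖c k‖ₑ) ^ 2 * (∑ k ∈ B, ‖c k‖ₑ ^ 2) ^ 2 := by ring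
    _ ≤ (B.card * ∑ k ∈ B, ‖c k‖ₑ ^ 2) * (∑ k ∈ B, ‖c k‖ₑ ^ 2) ^ 2 := by gcongr
    _ = _ := by ring

end MKdV

namespace MKdV

open AddCircle Filter Topology

/-! ### Functions of `H^s`, `s > 1/6`, belong to `L³` -/

/-- The dyadic frequency box `|k| < 2ⁿ`. -/
def dyadicBox (n : ℕ) : Finset ℤ := Finset.Ioo (-2 ^ n) (2 ^ n)

theorem dyadicBox_subset_succ (n : ℕ) : dyadicBox n ⊆ dyadicBox (n + 1) := by
  have : (0 : ℤ) < 2 ^ n := by positivity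
  refine Finset.Ioo_subset_Ioo ?_ ?_ <;> rw [pow_succ] <;> omega

theorem eventually_subset_dyadicBox (B : Finset ℤ) : ∀ᶠ n in atTop, B ⊆ dyadicBox n := by
  have hmono : Monotone dyadicBox := monotone_nat_of_le_succ dyadicBox_subset_succ
  have h1 : ∀ k ∈ B, ∀ᶠ n in atTop, k ∈ dyadicBox n := fun k _ => by
    refine (eventually_ge_atTop k.natAbs).mono fun n hn => ?_
    have h2 : n < 2 ^ n := Nat.lt_two_pow_self
    have h3 : (n : ℤ) < 2 ^ n := by exact_mod_cast h2
    rw [dyadicBox, Finset.mem_Ioo]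
    omega
  exact (Filter.eventually_all_finset B).2 h1

theorem tendsto_dyadicBox : Tendsto dyadicBox atTop atTop :=
  tendsto_atTop.2 eventually_subset_dyadicBox

/-- The contribution of the dyadic block `2ⁿ ≤ |k| < 2ⁿ⁺¹` to the `L³` norm. -/
theorem eLpNorm_trigPoly_block_le {s : ℝ} (hs : 0 ≤ s) (c : ℤ → ℂ)
    (hA : hNorm s (fun k => ‖c k‖ₑ) < ⊤) (n : ℕ) :
    (eLpNorm (trigPoly c (dyadicBox (n + 1) \ dyadicBox n)) 3 haarAddCircle).toReal ≤
      2 * (hNorm s (fun k => ‖c k‖ₑ)).toReal * ((2 : ℝ) ^ (1 / 6 - s)) ^ n := by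
  set B := dyadicBox (n + 1) \ dyadicBox n
  set A := hNorm s (fun k => ‖c k‖ₑ)
  set N := eLpNorm (trigPoly c B) 3 haarAddCircle
  have h1 : N ^ 6 ≤ B.card * (∑ k ∈ B, ‖c k‖ₑ ^ 2) ^ 3 := eLpNorm_trigPoly_pow_le c B
  have hcard : B.card ≤ 4 * 2 ^ n := by
    refine (Finset.card_le_card Finset.sdiff_subset).trans ?_
    rw [dyadicBox, Int.card_Ioo]
    have : (0 : ℤ) < 2 ^ n := by positivity
    have h2 : (2 ^ (n + 1) - (-2 ^ (n + 1)) - 1 : ℤ) ≤ (4 * 2 ^ n : ℕ) := by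
      push_cast; rw [pow_succ]; omega
    omega
  have h2 : ENNReal.ofReal (((2 : ℝ) ^ s) ^ n) ^ 2 * ∑ k ∈ B, ‖c k‖ₑ ^ 2 ≤ A ^ 2 := by
    rw [Finset.mul_sum, hNorm_sq]
    refine le_trans (Finset.sum_le_sum fun k hk => ?_) (ENNReal.sum_le_tsum B)
    gcongr
    rw [br, ← ENNReal.ofReal_pow (by positivity)]
    refine ENNReal.ofReal_le_ofReal ?_
    have hk2 : (2 : ℝ) ^ n ≤ |(k : ℝ)| := by
      rw [Finset.mem_sdiff, dyadicBox, dyadicBox, Finset.mem_Ioo, Finset.mem_Ioo] at hk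
      have : (2 : ℤ) ^ n ≤ |k| := by
        by_contra h
        rw [not_le, abs_lt] at h
        exact hk.2 h
      exact_mod_cast this
    have h3 : ((2 : ℝ) ^ n) ^ 2 ≤ bracketSq k := by
      rw [bracketSq, ← sq_abs (k : ℝ)]
      nlinarith [pow_pos (two_pos : (0 : ℝ) < 2) n]
    calc (((2 : ℝ) ^ s) ^ n) ^ 2 = (((2 : ℝ) ^ n) ^ 2) ^ s := by
          rw [← Real.rpow_natCast, ← Real.rpow_natCast, ← Real.rpow_natCast, ← Real.rpow_natCast,
            ← Real.rpow_mul (by positivity), ← Real.rpow_mul (by positivity),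
            ← Real.rpow_mul (by positivity), ← Real.rpow_mul (by positivity)]
          ring_nf
      _ ≤ bracketSq k ^ s := Real.rpow_le_rpow (by positivity) h3 hs
  have h3 : ENNReal.ofReal (((2 : ℝ) ^ s) ^ n) ^ 6 * N ^ 6 ≤ (4 * 2 ^ n : ℕ) * A ^ 6 :=
    calc ENNReal.ofReal (((2 : ℝ) ^ s) ^ n) ^ 6 * N ^ 6
        ≤ ENNReal.ofReal (((2 : ℝ) ^ s) ^ n) ^ 6 *
          (B.card * (∑ k ∈ B, ‖c k‖ₑ ^ 2) ^ 3) := by gcongr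
      _ = B.card * (ENNReal.ofReal (((2 : ℝ) ^ s) ^ n) ^ 2 * ∑ k ∈ B, ‖c k‖ₑ ^ 2) ^ 3 := by ring
      _ ≤ (4 * 2 ^ n : ℕ) * (A ^ 2) ^ 3 := by gcongr
      _ = _ := by ring
  have h4 := ENNReal.toReal_mono
    (ENNReal.mul_ne_top (ENNReal.natCast_ne_top _) (ENNReal.pow_ne_top hA.ne)) h3
  rw [ENNReal.toReal_mul, ENNReal.toReal_mul, ENNReal.toReal_pow, ENNReal.toReal_pow,
    ENNReal.toReal_pow, ENNReal.toReal_ofReal (by positivity), ENNReal.toReal_natCast] at h4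
  push_cast at h4
  refine le_of_pow_le_pow_left₀ (n := 6) (by norm_num) (by positivity) ?_
  have hq : ((2 : ℝ) ^ (1 / 6 - s)) ^ 6 * ((2 : ℝ) ^ s) ^ 6 = 2 := by
    rw [← mul_pow, ← Real.rpow_add two_pos, ← Real.rpow_natCast, ← Real.rpow_mul (by norm_num)]
    norm_num
  have hy : 0 < (((2 : ℝ) ^ s) ^ n) ^ 6 := by positivity
  refine le_of_mul_le_mul_left (h4.trans ?_) hy
  have h5 : (((2 : ℝ) ^ s) ^ n) ^ 6 * (2 * A.toReal * ((2 : ℝ) ^ (1 / 6 - s)) ^ n) ^ 6 =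
      64 * A.toReal ^ 6 * (((2 : ℝ) ^ (1 / 6 - s)) ^ 6 * ((2 : ℝ) ^ s) ^ 6) ^ n := by
    ring
  rw [h5, hq]
  have : 0 ≤ (2 : ℝ) ^ n * A.toReal ^ 6 := by positivity
  linarith

/-- A function with coefficients in the weighted `ℓ²` space of exponent `s > 1/6` is the limit in
`L³` of its dyadic partial Fourier sums. -/
theorem exists_memLp_three {s : ℝ} (hs : 1 / 6 < s) (c : ℤ → ℂ)
    (hA : hNorm s (fun k => ‖c k‖ₑ) < ⊤) : ∃ U : Torus → ℂ, MemLp U 3 haarAddCircle ∧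
      Tendsto (fun n => eLpNorm (fun x => trigPoly c (dyadicBox n) x - U x) 3 haarAddCircle)
        atTop (𝓝 0) ∧ ∀ k, fourierCoeff U k = c k := by
  have : Fact ((1 : ℝ≥0∞) ≤ 3) := ⟨by norm_num⟩
  let S : ℕ → Lp ℂ 3 (haarAddCircle (T := 1)) := fun n =>
    ContinuousMap.toLp 3 haarAddCircle ℂ (trigPoly c (dyadicBox n))
  have hS : ∀ n, (S n : Torus → ℂ) =ᵐ[haarAddCircle] trigPoly c (dyadicBox n) := fun n =>
    ContinuousMap.coeFn_toLp _ _
  have hc : CauchySeq S := by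
    refine cauchySeq_of_le_geometric ((2 : ℝ) ^ (1 / 6 - s))
      (2 * (hNorm s (fun k => ‖c k‖ₑ)).toReal)
      (Real.rpow_lt_one_of_one_lt_of_neg one_lt_two (by linarith)) fun n => ?_
    have h1 : trigPoly c (dyadicBox (n + 1)) - trigPoly c (dyadicBox n) =
        trigPoly c (dyadicBox (n + 1) \ dyadicBox n) := by
      rw [trigPoly, trigPoly, trigPoly, sub_eq_iff_eq_add,
        Finset.sum_sdiff (dyadicBox_subset_succ n)]
    rw [dist_comm, dist_eq_norm, ← map_sub, h1, Lp.norm_def,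
      eLpNorm_congr_ae (ContinuousMap.coeFn_toLp _ _)]
    exact eLpNorm_trigPoly_block_le (by linarith) c hA n
  obtain ⟨U, hU⟩ := cauchySeq_tendsto_of_complete hc
  have hlim : Tendsto (fun n => eLpNorm (fun x => trigPoly c (dyadicBox n) x - U x) 3
      haarAddCircle) atTop (𝓝 0) := by
    have h1 := (Lp.tendsto_Lp_iff_tendsto_eLpNorm' _ _).1 hU
    refine h1.congr fun n => eLpNorm_congr_ae ?_
    filter_upwards [hS n] with x hx
    simp [hx]
  refine ⟨U, Lp.memLp U, hlim, fun k => ?_⟩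
  have hint : Integrable U haarAddCircle := (Lp.memLp U).integrable (by norm_num)
  have h2 : ∀ᶠ n in atTop, ‖c k - fourierCoeff U k‖ₑ ≤
      eLpNorm (fun x => trigPoly c (dyadicBox n) x - U x) 3 haarAddCircle := by
    filter_upwards [eventually_subset_dyadicBox {k}] with n hn
    have hP : Integrable (trigPoly c (dyadicBox n)) haarAddCircle :=
      Continuous.integrable_of_hasCompactSupport (by fun_prop)
        (HasCompactSupport.of_compactSpace _)
    have h3 : fourierCoeff (fun x => trigPoly c (dyadicBox n) x - U x) k =
        c k - fourierCoeff U k := by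
      rw [fourierCoeff_sub hP hint, fourierCoeff_trigPoly, if_pos (hn (Finset.mem_singleton_self k))]
    rw [← h3]
    exact (enorm_fourierCoeff_le _ _).trans
      (eLpNorm_le_eLpNorm_of_exponent_le (by norm_num) (hP.sub hint).aestronglyMeasurable)
  have h6 : ‖c k - fourierCoeff U k‖ₑ ≤ 0 := ge_of_tendsto hlim h2
  rw [nonpos_iff_eq_zero, enorm_eq_zero, sub_eq_zero] at h6
  exact h6.symm

/-- An integrable function whose Fourier coefficients have finite `H^s` norm, `s > 1/6`, is the
limit in `L³` of its dyadic partial Fourier sums. -/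
theorem memLp_three_and_tendsto {s : ℝ} (hs : 1 / 6 < s) {f : Torus → ℂ}
    (hf : Integrable f haarAddCircle) (hA : hNorm s (fun k => ‖fourierCoeff f k‖ₑ) < ⊤) :
    MemLp f 3 haarAddCircle ∧ Tendsto (fun n => eLpNorm
      (fun x => trigPoly (fourierCoeff f) (dyadicBox n) x - f x) 3 haarAddCircle) atTop (𝓝 0) := by
  obtain ⟨U, hU, hlim, hcoef⟩ := exists_memLp_three hs (fourierCoeff f) hA
  have hUint : Integrable U haarAddCircle := hU.integrable (by norm_num)
  have hUf : U =ᵐ[haarAddCircle] f := by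
    have h1 : (fun x => U x - f x) =ᵐ[haarAddCircle] 0 := by
      refine ae_eq_zero_of_fourierCoeff_eq_zero (hUint.sub hf) fun k => ?_
      rw [fourierCoeff_sub hUint hf, hcoef, sub_self]
    filter_upwards [h1] with x hx
    exact sub_eq_zero.1 hx
  refine ⟨hU.ae_eq hUf, hlim.congr fun n => eLpNorm_congr_ae ?_⟩
  filter_upwards [hUf] with x hx
  rw [hx]

/-! ### Fourier coefficients of products -/

theorem holderTriple_three_three : ENNReal.HolderTriple 3 3 (3 / 2) :=
  ⟨by
    rw [ENNReal.inv_div (by norm_num) (by norm_num), ← two_mul, ENNReal.div_eq_inv_mul, mul_comm]⟩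

theorem holderTriple_three_one : ENNReal.HolderTriple 3 (3 / 2) 1 :=
  ⟨by
    rw [ENNReal.inv_div (by norm_num) (by norm_num), inv_one, ← one_div, ENNReal.div_add_div_same,
      show (1 + 2 : ℝ≥0∞) = 3 by norm_num, ENNReal.div_self (by norm_num) (by norm_num)]⟩

/-- The Fourier coefficients of a product are given by the convolution, as soon as it converges
absolutely. -/
theorem fourierCoeff_mul {s : ℝ} (hs : 1 / 6 < s) {f w : Torus → ℂ}
    (hf : Integrable f haarAddCircle) (hA : hNorm s (fun k => ‖fourierCoeff f k‖ₑ) < ⊤)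
    (hw : MemLp w (3 / 2) haarAddCircle) (m : ℤ)
    (hsum : Summable fun b => fourierCoeff f b * fourierCoeff w (m - b)) :
    fourierCoeff (fun x => f x * w x) m = ∑' b, fourierCoeff f b * fourierCoeff w (m - b) := by
  have := holderTriple_three_one
  obtain ⟨hf3, hlim⟩ := memLp_three_and_tendsto hs hf hA
  have h32 : (1 : ℝ≥0∞) ≤ 3 / 2 := by
    rw [ENNReal.le_div_iff_mul_le (by norm_num) (by norm_num)]
    norm_num
  have hwi : Integrable w haarAddCircle := hw.integrable h32
  have hfw : Integrable (fun x => f x * w x) haarAddCircle :=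
    memLp_one_iff_integrable.1 (hw.mul' hf3)
  have h1 : Tendsto (fun n => ∑ b ∈ dyadicBox n, fourierCoeff f b * fourierCoeff w (m - b)) atTop
      (𝓝 (∑' b, fourierCoeff f b * fourierCoeff w (m - b))) :=
    hsum.hasSum.comp tendsto_dyadicBox
  refine tendsto_nhds_unique ?_ h1
  have h2 : Tendsto (fun n => eLpNorm
      (fun x => trigPoly (fourierCoeff f) (dyadicBox n) x - f x) 3 haarAddCircle *
        eLpNorm w (3 / 2) haarAddCircle) atTop (𝓝 0) := by
    have := ENNReal.Tendsto.mul_const hlim (Or.inr hw.eLpNorm_ne_top)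
    rwa [zero_mul] at this
  rw [tendsto_iff_edist_tendsto_0]
  refine tendsto_of_tendsto_of_tendsto_of_le_of_le tendsto_const_nhds h2 (fun _ => zero_le)
    fun n => ?_
  simp only
  set P := trigPoly (fourierCoeff f) (dyadicBox n)
  have hP : Integrable (fun x => P x * w x) haarAddCircle :=
    hwi.bdd_mul P.continuous.aestronglyMeasurable (ae_of_all _ fun x => P.norm_coe_le_norm x)
  rw [← fourierCoeff_trigPoly_mul _ _ hwi, edist_eq_enorm_sub]
  have h3 : fourierCoeff (fun x => P x * w x) m - fourierCoeff (fun x => f x * w x) m =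
      fourierCoeff ((fun x => P x - f x) • w) m := by
    rw [← fourierCoeff_sub hP hfw]
    congr 1
    ext x
    simp [sub_mul]
  rw [h3]
  refine (enorm_fourierCoeff_le _ _).trans ?_
  exact eLpNorm_smul_le_mul_eLpNorm hw.1 (P.continuous.aestronglyMeasurable.sub hf.1)

end MKdV

namespace MKdV

open AddCircle Filter Topology

/-! ### Fourier coefficients of the renormalized nonlinearity -/

theorem exists_tsum_cubic_le {s : ℝ} (hs : 1 / 6 < s) : ∃ C : ℝ≥0, ∀ (c : ℤ → ℂ) (m : ℤ),
    ∑' q : ℤ × ℤ, ‖c q.1 * c q.2 * c (last (-m, q))‖ₑ ≤ C * hNorm s (fun k => ‖c k‖ₑ) ^ 3 := by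
  obtain ⟨C, hC⟩ := quad_le_tsum_mul hs
  refine ⟨C, fun c m => ?_⟩
  classical
  have h1 : ∑' k : ℤ, (if k = -m then (1 : ℝ≥0∞) else 0) = 1 := tsum_ite_eq _ _
  have h2 := hC (fun k => if k = -m then 1 else 0) (fun k => ‖c k‖ₑ) (fun k => ‖c k‖ₑ)
    (fun k => ‖c k‖ₑ)
  rw [h1, one_mul] at h2
  calc ∑' q : ℤ × ℤ, ‖c q.1 * c q.2 * c (last (-m, q))‖ₑ
      = ∑' q : ℤ × ℤ, (if (-m, q).1 = -m then (1 : ℝ≥0∞) else 0) * ‖c q.1‖ₑ * ‖c q.2‖ₑ *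
          ‖c (last (-m, q))‖ₑ := by
        refine tsum_congr fun q => ?_
        rw [if_pos rfl, one_mul, enorm_mul, enorm_mul]
    _ ≤ quad (fun k => if k = -m then 1 else 0) (fun k => ‖c k‖ₑ) (fun k => ‖c k‖ₑ)
          (fun k => ‖c k‖ₑ) :=
        ENNReal.tsum_comp_le_tsum_of_injective (f := fun q : ℤ × ℤ => (-m, q))
          (Prod.mk_right_injective _) (fun p : ℤ × ℤ × ℤ =>
            (if p.1 = -m then (1 : ℝ≥0∞) else 0) * ‖c p.2.1‖ₑ * ‖c p.2.2‖ₑ * ‖c (last p)‖ₑ)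
    _ ≤ _ := h2.trans_eq (by ring)

theorem summable_sq_of_hNorm_lt_top {s : ℝ} (hs : 0 ≤ s) {c : ℤ → ℂ}
    (hA : hNorm s (fun k => ‖c k‖ₑ) < ⊤) : Summable fun k => ‖c k‖ ^ 2 := by
  have h1 : ∑' k, ‖c k‖ₑ ^ 2 ≠ ⊤ := by
    refine ne_top_of_le_ne_top (ENNReal.pow_ne_top (n := 2) hA.ne) ?_
    rw [hNorm_sq]
    exact ENNReal.tsum_le_tsum fun k => le_mul_of_one_le_left' (one_le_br hs k)
  have h2 := ENNReal.summable_toReal h1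
  simpa using h2

theorem summable_mul_sub {c : ℤ → ℂ} (hc : Summable fun k => ‖c k‖ ^ 2) (l : ℤ) :
    Summable fun b => c b * c (l - b) := by
  have h1 : Summable fun b => ‖c (l - b)‖ ^ 2 := (Equiv.subLeft l).summable_iff.2 hc
  refine Summable.of_norm_bounded (hc.add h1) fun b => ?_
  rw [norm_mul]
  nlinarith [sq_nonneg (‖c b‖ - ‖c (l - b)‖), sq_nonneg (‖c b‖), sq_nonneg (‖c (l - b)‖)]

open Classical in
/-- Inclusion–exclusion over the three resonant lines: each contributes `E c_m`, where `E` is the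
total mass, and the pairwise intersections contribute three times `c_m² c_{-m}`. -/
theorem hasSum_nonres {c : ℤ → ℂ} {E N : ℂ} {m : ℤ} (hm : m ≠ 0)
    (hG : HasSum (fun q : ℤ × ℤ => c q.1 * c q.2 * c (last (-m, q))) N)
    (hE : HasSum (fun b => c b * c (-b)) E) :
    HasSum (fun q : ℤ × ℤ => if Nonres (-m, q) then c q.1 * c q.2 * c (last (-m, q)) else 0)
      (N - 3 * E * c m + 3 * c m ^ 2 * c (-m)) := by
  set G : ℤ × ℤ → ℂ := fun q => c q.1 * c q.2 * c (last (-m, q)) with hGdef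
  have hline : ∀ (g : ℤ → ℤ × ℤ) (S : ℤ × ℤ → Prop) [DecidablePred S], Function.Injective g →
      (∀ q, S q ↔ q ∈ range g) → (∀ b, G (g b) = c b * c (-b) * c m) →
      HasSum (fun q => if S q then G q else 0) (E * c m) := by
    intro g S _ hg hS hGg
    refine (hg.hasSum_iff fun q hq => if_neg fun h => hq ((hS q).1 h)).1 ?_
    have h1 : (fun q => if S q then G q else 0) ∘ g = fun b => c b * c (-b) * c m := by
      ext b
      rw [Function.comp_apply, if_pos ((hS _).2 (mem_range_self b)), hGg]
    rw [h1]
    exact hE.mul_right _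
  have h1 : HasSum (fun q : ℤ × ℤ => if q.1 = m then G q else 0) (E * c m) := by
    refine hline (fun b => (m, b)) (fun q => q.1 = m) (fun a b h => (Prod.mk.inj h).2) (fun q => ⟨fun h =>
      ⟨q.2, Prod.ext h.symm rfl⟩, fun ⟨b, h⟩ => by rw [← h]⟩) fun b => ?_
    simp only [hGdef, last]
    rw [show -(-m + m + b) = -b by ring]
    ring
  have h2 : HasSum (fun q : ℤ × ℤ => if q.2 = m then G q else 0) (E * c m) := by
    refine hline (fun b => (b, m)) (fun q => q.2 = m) (fun a b h => (Prod.mk.inj h).1) (fun q => ⟨fun h =>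
      ⟨q.1, Prod.ext rfl h.symm⟩, fun ⟨b, h⟩ => by rw [← h]⟩) fun b => ?_
    simp only [hGdef, last]
    rw [show -(-m + b + m) = -b by ring]
    ring
  have h3 : HasSum (fun q : ℤ × ℤ => if q.1 + q.2 = 0 then G q else 0) (E * c m) := by
    refine hline (fun b => (b, -b)) (fun q => q.1 + q.2 = 0) (fun a b h => (Prod.mk.inj h).1) (fun q => ⟨fun h =>
      ⟨q.1, Prod.ext rfl (by simp only; omega)⟩, fun ⟨b, h⟩ => by rw [← h]; simp⟩) fun b => ?_
    simp only [hGdef, last]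
    rw [show -(-m + b + -b) = m by ring]
  have hpt : ∀ p : ℤ × ℤ, G p = c m ^ 2 * c (-m) →
      HasSum (fun q : ℤ × ℤ => if q = p then G q else 0) (c m ^ 2 * c (-m)) := fun p hp => by
    have := hasSum_ite_eq p (G p)
    rw [hp] at this
    convert this using 2 with q
    split_ifs with h
    · rw [h, hp]
    · rfl
  have h4 := hpt (m, m) (by simp only [hGdef, last]; rw [show -(-m + m + m) = -m by ring]; ring)
  have h5 := hpt (m, -m) (by simp only [hGdef, last]; rw [show -(-m + m + -m) = m by ring]; ring)
  have h6 := hpt (-m, m) (by simp only [hGdef, last]; rw [show -(-m + -m + m) = m by ring]; ring)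
  have h7 := (((((hG.sub h1).sub h2).sub h3).add h4).add h5).add h6
  have h8 : ∀ a b : ℂ, N - E * a - E * a - E * a + a ^ 2 * b + a ^ 2 * b + a ^ 2 * b =
      N - 3 * E * a + 3 * a ^ 2 * b := fun a b => by ring
  rw [h8] at h7
  refine h7.congr_fun ?_
  · rintro ⟨b, d⟩
    simp only [Nonres, Prod.mk.injEq]
    by_cases hb : b = m
    · subst hb
      by_cases hd : d = b
      · subst hd
        have : d + d ≠ 0 := by omega
        have : d ≠ -d := by omega
        simp [*]
      · by_cases hd' : d = -b
        · subst hd'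
          have : b ≠ -b := by omega
          simp [*]
        · have : b + d ≠ 0 := by omega
          simp [*]
    · by_cases hd : d = m
      · subst hd
        by_cases hb' : b = -d
        · subst hb'
          have : d ≠ -d := by omega
          simp [*]
        · have : b + d ≠ 0 := by omega
          simp [*]
      · have h8 : -m + b ≠ 0 := by omega
        have h9 : -m + d ≠ 0 := by omega
        by_cases h0 : b + d = 0 <;> simp [hb, hd, h8, h9, h0, hGdef]

section Cubic

variable {s : ℝ} {f : Torus → ℂ}

theorem memLp_sq (hs : 1 / 6 < s) (hf : Integrable f haarAddCircle)
    (hA : hNorm s (fun k => ‖fourierCoeff f k‖ₑ) < ⊤) :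
    MemLp (fun x => f x * f x) (3 / 2) haarAddCircle := by
  have := holderTriple_three_three
  have h3 := (memLp_three_and_tendsto hs hf hA).1
  exact h3.mul' h3

theorem integrable_cube (hs : 1 / 6 < s) (hf : Integrable f haarAddCircle)
    (hA : hNorm s (fun k => ‖fourierCoeff f k‖ₑ) < ⊤) :
    Integrable (fun x => f x * (f x * f x)) haarAddCircle := by
  have := holderTriple_three_one
  exact memLp_one_iff_integrable.1
    ((memLp_sq hs hf hA).mul' (memLp_three_and_tendsto hs hf hA).1)

theorem hasSum_fourierCoeff_sq (hs : 1 / 6 < s) (hf : Integrable f haarAddCircle)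
    (hA : hNorm s (fun k => ‖fourierCoeff f k‖ₑ) < ⊤) (l : ℤ) :
    HasSum (fun b => fourierCoeff f b * fourierCoeff f (l - b))
      (fourierCoeff (fun x => f x * f x) l) := by
  have h1 := summable_mul_sub (summable_sq_of_hNorm_lt_top (by linarith) hA) l
  rw [fourierCoeff_mul hs hf hA ?_ l h1]
  · exact h1.hasSum
  · refine (memLp_three_and_tendsto hs hf hA).1.mono_exponent ?_
    exact ENNReal.div_le_of_le_mul (by norm_num)

theorem hasSum_fourierCoeff_cube (hs : 1 / 6 < s) (hf : Integrable f haarAddCircle)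
    (hA : hNorm s (fun k => ‖fourierCoeff f k‖ₑ) < ⊤) (m : ℤ) :
    HasSum (fun q : ℤ × ℤ => fourierCoeff f q.1 * fourierCoeff f q.2 *
      fourierCoeff f (last (-m, q))) (fourierCoeff (fun x => f x * (f x * f x)) m) := by
  obtain ⟨C, hC⟩ := exists_tsum_cubic_le hs
  have h1 : Summable fun q : ℤ × ℤ => fourierCoeff f q.1 * fourierCoeff f q.2 *
      fourierCoeff f (last (-m, q)) := by
    refine Summable.of_norm ?_
    have h2 := ENNReal.summable_toReal (ne_top_of_le_ne_top
      (ENNReal.mul_ne_top ENNReal.coe_ne_top (ENNReal.pow_ne_top hA.ne))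
      (hC (fourierCoeff f) m))
    simpa only [toReal_enorm] using h2
  have h2 : ∀ b, ∑' c, fourierCoeff f b * fourierCoeff f c * fourierCoeff f (last (-m, (b, c))) =
      fourierCoeff f b * fourierCoeff (fun x => f x * f x) (m - b) := fun b => by
    rw [← (hasSum_fourierCoeff_sq hs hf hA (m - b)).tsum_eq, ← tsum_mul_left]
    refine tsum_congr fun c => ?_
    rw [mul_assoc, last]
    congr 3
    ring
  have h3 := h1.prod
  simp only [h2] at h3
  rw [fourierCoeff_mul hs hf hA (memLp_sq hs hf hA) m h3]
  simp only [← h2]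
  rw [← h1.tsum_prod]
  exact h1.hasSum

open Classical in
/-- The renormalization removes the contribution of the resonant lines, up to their
intersections. -/
theorem hasSum_fourierCoeff_nonres (hs : 1 / 6 < s) (hf : Integrable f haarAddCircle)
    (hA : hNorm s (fun k => ‖fourierCoeff f k‖ₑ) < ⊤) {m : ℤ} (hm : m ≠ 0) :
    HasSum (fun q : ℤ × ℤ => if Nonres (-m, q) then fourierCoeff f q.1 * fourierCoeff f q.2 *
      fourierCoeff f (last (-m, q)) else 0) (fourierCoeff (fun x => f x * (f x * f x)) m -
        3 * fourierCoeff (fun x => f x * f x) 0 * fourierCoeff f m +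
        3 * fourierCoeff f m ^ 2 * fourierCoeff f (-m)) := by
  refine hasSum_nonres hm (hasSum_fourierCoeff_cube hs hf hA m) ?_
  have := hasSum_fourierCoeff_sq hs hf hA 0
  simpa only [zero_sub] using this

end Cubic

section Real

variable {s : ℝ} {f : Torus → ℝ}

theorem coe_nonlinearity (f : Torus → ℝ) (x : Torus) : (nonlinearity f x : ℂ) =
    (f x : ℂ) * ((f x : ℂ) * f x) -
      3 * fourierCoeff (fun y => (f y : ℂ) * f y) 0 * (f x : ℂ) := by
  have h1 : fourierCoeff (fun y => (f y : ℂ) * f y) 0 = ((∫ y, f y ^ 2 : ℝ) : ℂ) := by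
    rw [fourierCoeff, ← integral_complex_ofReal, volume_torus]
    congr 1
    ext y
    rw [neg_zero, fourier_zero, one_smul, Complex.ofReal_pow, sq]
  rw [h1, nonlinearity]
  push_cast
  ring

theorem integrable_nonlinearity (hs : 1 / 6 < s)
    (hf : Integrable (fun x => (f x : ℂ)) haarAddCircle)
    (hA : hNorm s (fun k => ‖fourierCoeff (fun x => (f x : ℂ)) k‖ₑ) < ⊤) :
    Integrable (fun x => (nonlinearity f x : ℂ)) haarAddCircle := by
  simp only [coe_nonlinearity]
  exact (integrable_cube hs hf hA).sub (hf.const_mul _)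

open Classical in
theorem fourierCoeff_nonlinearity (hs : 1 / 6 < s)
    (hf : Integrable (fun x => (f x : ℂ)) haarAddCircle)
    (hA : hNorm s (fun k => ‖fourierCoeff (fun x => (f x : ℂ)) k‖ₑ) < ⊤) {m : ℤ} (hm : m ≠ 0) :
    fourierCoeff (fun x => (nonlinearity f x : ℂ)) m =
      (∑' q : ℤ × ℤ, if Nonres (-m, q) then fourierCoeff (fun x => (f x : ℂ)) q.1 *
        fourierCoeff (fun x => (f x : ℂ)) q.2 *
        fourierCoeff (fun x => (f x : ℂ)) (last (-m, q)) else 0) -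
      3 * fourierCoeff (fun x => (f x : ℂ)) m ^ 2 * fourierCoeff (fun x => (f x : ℂ)) (-m) := by
  rw [(hasSum_fourierCoeff_nonres hs hf hA hm).tsum_eq]
  simp only [coe_nonlinearity]
  rw [fourierCoeff_sub (integrable_cube hs hf hA) (hf.const_mul _), fourierCoeff.const_mul]
  ring

/-- Uniform bound for the Fourier coefficients of the nonlinearity. -/
theorem exists_enorm_fourierCoeff_nonlinearity_le (hs : 1 / 6 < s) :
    ∃ C : ℝ≥0, ∀ f : Torus → ℝ, Integrable (fun x => (f x : ℂ)) haarAddCircle →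
      hNorm s (fun k => ‖fourierCoeff (fun x => (f x : ℂ)) k‖ₑ) < ⊤ → ∀ m : ℤ, m ≠ 0 →
      ‖fourierCoeff (fun x => (nonlinearity f x : ℂ)) m‖ₑ ≤
        C * hNorm s (fun k => ‖fourierCoeff (fun x => (f x : ℂ)) k‖ₑ) ^ 3 := by
  obtain ⟨C, hC⟩ := exists_tsum_cubic_le hs
  refine ⟨C + 3, fun f hf hA m hm => ?_⟩
  classical
  rw [fourierCoeff_nonlinearity hs hf hA hm]
  set c := fourierCoeff fun x => (f x : ℂ)
  have hle : ∀ k, ‖c k‖ₑ ≤ hNorm s (fun k => ‖c k‖ₑ) :=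
    fun k => le_hNorm (by linarith) (fun k => ‖c k‖ₑ) k
  refine (enorm_sub_le).trans ?_
  push_cast
  rw [add_mul]
  refine add_le_add ((enorm_tsum_le_tsum_enorm).trans ((ENNReal.tsum_le_tsum fun q => ?_).trans
    (hC c m))) ?_
  · split_ifs
    · exact le_rfl
    · simp
  · rw [enorm_mul, enorm_mul, enorm_pow, mul_assoc]
    have : ‖(3 : ℂ)‖ₑ = 3 := by
      rw [← ofReal_norm]; norm_num
    rw [this, pow_succ (hNorm s _)]
    gcongr
    · exact hle m
    · exact hle (-m)

end Real

end MKdV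

namespace MKdV

open AddCircle Filter Topology

/-! ### The weak formulation for one Fourier coefficient -/

theorem _root_.MeasureTheory.IntegrableOn.ofReal_mul {a b : ℝ} {F : ℝ → ℂ}
    (hF : IntegrableOn F (Ioo a b)) {p : ℝ → ℝ} (hp : Continuous p) :
    IntegrableOn (fun t => (p t : ℂ) * F t) (Ioo a b) := by
  obtain ⟨K, hK⟩ := (isCompact_Icc (a := a) (b := b)).exists_bound_of_continuousOn hp.continuousOn
  refine Integrable.bdd_mul hF (c := K)
    (Complex.continuous_ofReal.comp hp).aestronglyMeasurable ?_
  refine (ae_restrict_mem measurableSet_Ioo).mono fun t ht => ?_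
  simpa using hK t (Ioo_subset_Icc_self ht)

theorem exists_lt_of_tsupport_subset_Ioo {a T : ℝ} {ρ : ℝ → ℝ} (hρc : HasCompactSupport ρ)
    (hρs : tsupport ρ ⊆ Ioo a T) : ∃ b < T, ∀ t, b ≤ t → ρ t = 0 := by
  rcases (tsupport ρ).eq_empty_or_nonempty with he | hne
  · refine ⟨T - 1, by linarith, fun t _ => ?_⟩
    exact image_eq_zero_of_notMem_tsupport (by simp [he])
  · obtain ⟨b, hbs, hb⟩ := hρc.isCompact.exists_isGreatest hne
    have hb' := hρs hbs
    refine ⟨(b + T) / 2, by linarith [hb'.2], fun t ht => ?_⟩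
    refine image_eq_zero_of_notMem_tsupport fun hts => ?_
    have := hb hts
    linarith [hb'.2]

/-- A weak formulation in time, with initial datum, of `V' = G` on `]0, T[` determines `V` almost
everywhere. -/
theorem ae_eq_integral_of_weak {T : ℝ} (hT : 0 < T) {V G : ℝ → ℂ}
    (hV : IntegrableOn V (Ioo 0 T)) (hG : Integrable G) (v₀ : ℂ)
    (h : ∀ η : ℝ → ℝ, ContDiff ℝ ∞ η → (∃ a < T, ∀ t, a ≤ |t| → η t = 0) →
      (∫ t in Ioo 0 T, (((deriv η t : ℝ) : ℂ) * V t + η t * G t)) + η 0 * v₀ = 0) :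
    ∀ᵐ t, t ∈ Ioo 0 T → V t = v₀ + ∫ r in 0..t, G r := by
  set W : ℝ → ℂ := fun t => v₀ + ∫ r in 0..t, G r with hW
  have hWd : ACDeriv T W G := ACDeriv.of_integral hG v₀ T
  have hWc : Continuous W := continuous_const.add (intervalIntegral.continuous_primitive
    (fun _ _ => hG.intervalIntegrable) 0)
  have hWi : IntegrableOn W (Ioo 0 T) :=
    (hWc.integrableOn_Icc (a := 0) (b := T)).mono_set Ioo_subset_Icc_self
  have hDi : IntegrableOn (fun t => V t - W t) (Ioo 0 T) := hV.sub hWi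
  have hmain : ∀ᵐ t, t ∈ Ioo 0 T → V t - W t = 0 := by
    refine isOpen_Ioo.ae_eq_zero_of_integral_contDiff_smul_eq_zero hDi.locallyIntegrableOn
      fun ρ hρ hρc hρs => ?_
    obtain ⟨b, hbT, hb⟩ := exists_lt_of_tsupport_subset_Ioo hρc hρs
    -- a primitive of `ρ` that vanishes near `T`, cut off at negative times, is a test function
    set m := ∫ r in 0..b, ρ r with hm
    set P : ℝ → ℝ := fun t => (∫ r in 0..t, ρ r) - m with hP
    have hPd : ∀ t, HasDerivAt P (ρ t) t := fun t =>
      (intervalIntegral.integral_hasDerivAt_right (hρ.continuous.intervalIntegrable _ _)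
        (hρ.continuous.stronglyMeasurableAtFilter _ _) hρ.continuous.continuousAt).sub_const m
    have hPs : ContDiff ℝ ∞ P := by
      refine contDiff_infty_iff_deriv.2 ⟨fun t => (hPd t).differentiableAt, ?_⟩
      rwa [show deriv P = ρ from funext fun t => (hPd t).deriv]
    have hPb : ∀ t, b ≤ t → P t = 0 := fun t ht => by
      have h1 : ∫ r in b..t, ρ r = 0 := by
        rw [intervalIntegral.integral_congr (g := fun _ => 0)]
        · simp
        · intro r hr
          rw [uIcc_of_le ht] at hr
          exact hb r hr.1
      have h2 := intervalIntegral.integral_add_adjacent_intervals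
        (hρ.continuous.intervalIntegrable (μ := volume) 0 b)
        (hρ.continuous.intervalIntegrable b t)
      simp only [hP, ← h2, h1, ← hm, add_zero, sub_self]
    let χ : ℝ → ℝ := fun t => Real.smoothTransition (1 + 2 / T * t)
    have hχ : ContDiff ℝ ∞ χ :=
      Real.smoothTransition.contDiff.comp (contDiff_const.add (contDiff_const.mul contDiff_id))
    have hχ1 : ∀ t, 0 ≤ t → χ t = 1 := fun t ht =>
      Real.smoothTransition.one_of_one_le (by have : 0 ≤ 2 / T * t := by positivity
                                              linarith)
    have hη : ContDiff ℝ ∞ (fun t => χ t * P t) := hχ.mul hPs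
    have hηd : ∀ t ∈ Ioo 0 T, deriv (fun t => χ t * P t) t = ρ t := fun t ht => by
      have : (fun t => χ t * P t) =ᶠ[𝓝 t] P := by
        filter_upwards [lt_mem_nhds ht.1] with r hr
        rw [hχ1 r hr.le, one_mul]
      rw [this.deriv_eq, (hPd t).deriv]
    have h1 := h _ hη ⟨max b (T / 2), max_lt hbT (by linarith), fun t ht => by
      rcases le_or_gt 0 t with h0 | h0
      · rw [abs_of_nonneg h0] at ht
        rw [hPb t ((le_max_left _ _).trans ht), mul_zero]
      · rw [abs_of_neg h0] at ht
        have h2 : T / 2 ≤ -t := (le_max_right _ _).trans ht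
        have h3 : χ t = 0 := by
          refine Real.smoothTransition.zero_of_nonpos ?_
          have : 2 / T * t ≤ 2 / T * (-(T / 2)) := by
            refine mul_le_mul_of_nonneg_left (by linarith) (by positivity)
          have h4 : 2 / T * (-(T / 2)) = -1 := by field_simp
          linarith
        rw [h3, zero_mul]⟩
    have hPac : ACDeriv T (fun t => (P t : ℂ)) (fun t => (ρ t : ℂ)) := by
      have h2 : ContDiff ℝ 1 (fun t => (P t : ℂ)) :=
        Complex.ofRealCLM.contDiff.comp (hPs.of_le (by norm_num))
      convert ACDeriv.of_contDiff h2 using 1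
      exact funext fun t => ((hPd t).ofReal_comp.deriv).symm
    have h2 := (hPac.mul hWd).integral_eq
    rw [intervalIntegral.integral_of_le hT.le, integral_Ioc_eq_integral_Ioo, hPb T hbT.le,
      Complex.ofReal_zero, zero_mul, zero_sub] at h2
    have h3 : ∫ t in Ioo 0 T, (((deriv (fun t => χ t * P t) t : ℝ) : ℂ) * V t +
        ((χ t * P t : ℝ) : ℂ) * G t) = ∫ t in Ioo 0 T, ((ρ t : ℂ) * V t + P t * G t) := by
      refine setIntegral_congr_fun measurableSet_Ioo fun t ht => ?_
      simp only [hηd t ht, hχ1 t ht.1.le, one_mul]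
    rw [h3, hχ1 0 le_rfl, one_mul] at h1
    have h4 : ∫ t in Ioo 0 T, ((ρ t : ℂ) * V t + P t * G t) -
        ((ρ t : ℂ) * W t + P t * G t) = 0 := by
      have hi : ∀ F : ℝ → ℂ, IntegrableOn F (Ioo 0 T) →
          IntegrableOn (fun t => (ρ t : ℂ) * F t + P t * G t) (Ioo 0 T) := fun F hF =>
        (hF.ofReal_mul hρ.continuous).add (hG.integrableOn.ofReal_mul hPs.continuous)
      rw [integral_sub (hi V hV) (hi W hWi), h2]
      have h5 : W 0 = v₀ := by simp [hW]
      rw [h5]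
      linear_combination h1
    have h6 : ∀ t, ρ t • (V t - W t) = ((Ioo 0 T).indicator
        (fun t => ((ρ t : ℂ) * V t + P t * G t) - ((ρ t : ℂ) * W t + P t * G t)) t) := fun t => by
      by_cases ht : t ∈ Ioo 0 T
      · rw [indicator_of_mem ht, Complex.real_smul]
        ring
      · rw [indicator_of_notMem ht, image_eq_zero_of_notMem_tsupport fun h' => ht (hρs h'),
          zero_smul]
    simp only [h6]
    rw [integral_indicator measurableSet_Ioo, h4]
  filter_upwards [hmain] with t ht h'
  exact sub_eq_zero.1 (ht h')

/-- The real part of `a η(t) e^{-i(2πk)³t - 2iπkx}`: the test functions that read off one Fourier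
coefficient. -/
def planeWave (k : ℤ) (a : ℂ) (η : ℝ → ℝ) (t : ℝ) (x : Torus) : ℝ :=
  (η t * (a * osc (-freq k) t) * fourier (-k) x).re

theorem fourier_add_coe (k : ℤ) (x : Torus) (h : ℝ) :
    fourier k (x + (h : Torus)) = fourier k x * Complex.exp (2 * Real.pi * Complex.I * k * h) := by
  have h1 : fourier k (h : Torus) = Complex.exp (2 * Real.pi * Complex.I * k * h) := by
    rw [fourier_coe_apply]; simp
  rw [← h1, fourier_apply, fourier_apply, fourier_apply, smul_add, toCircle_add, Circle.coe_mul]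

theorem iteratedDeriv_re_exp (A B : ℂ) (n : ℕ) :
    iteratedDeriv n (fun h : ℝ => (A * Complex.exp (B * h)).re) =
      fun h : ℝ => (A * B ^ n * Complex.exp (B * h)).re := by
  induction n with
  | zero => simp [iteratedDeriv_zero]
  | succ n ih =>
    rw [iteratedDeriv_succ, ih]
    ext h
    have h1 : HasDerivAt (fun z : ℂ => A * B ^ n * Complex.exp (B * z))
        (A * B ^ n * (Complex.exp (B * h) * B)) (h : ℂ) := by
      have := ((hasDerivAt_id (h : ℂ)).const_mul B).cexp
      simpa using this.const_mul (A * B ^ n)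
    rw [h1.real_of_complex.deriv]
    congr 1
    ring

theorem dx_planeWave (k : ℤ) (a : ℂ) (η : ℝ → ℝ) (t : ℝ) (x : Torus) (n : ℕ) :
    dx n (planeWave k a η) t x = (η t * (a * osc (-freq k) t) *
      (-(2 * Real.pi * k * Complex.I)) ^ n * fourier (-k) x).re := by
  have h1 : (fun h : ℝ => planeWave k a η t (x + (h : Torus))) = fun h : ℝ =>
      ((η t * (a * osc (-freq k) t) * fourier (-k) x) *
        Complex.exp (-(2 * Real.pi * k * Complex.I) * h)).re := by
    ext h
    rw [planeWave, fourier_add_coe, ← mul_assoc]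
    congr 4
    push_cast
    ring
  rw [dx, h1, iteratedDeriv_re_exp]
  simp only [Complex.ofReal_zero, mul_zero, Complex.exp_zero, mul_one]
  congr 1
  ring

theorem dt_planeWave (k : ℤ) (a : ℂ) {η : ℝ → ℝ} (hη : Differentiable ℝ η) (t : ℝ) (x : Torus) :
    dt (planeWave k a η) t x = (((deriv η t : ℝ) * (a * osc (-freq k) t) +
      η t * (a * (-freq k * Complex.I * osc (-freq k) t))) * fourier (-k) x).re := by
  have h1 : HasDerivAt (fun r : ℝ => (η r : ℂ)) ((deriv η t : ℝ) : ℂ) t :=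
    (hη t).hasDerivAt.ofReal_comp
  have h2 := ((h1.mul ((hasDerivAt_osc (-freq k) t).const_mul a)).mul_const (fourier (-k) x))
  have h3 := Complex.reCLM.hasFDerivAt.comp_hasDerivAt t h2
  simp only [Complex.reCLM_apply, Complex.ofReal_neg] at h3
  exact h3.deriv

/-- Plane waves are solutions of the linear equation. -/
theorem dt_add_dx_planeWave (k : ℤ) (a : ℂ) {η : ℝ → ℝ} (hη : Differentiable ℝ η) (t : ℝ)
    (x : Torus) : dt (planeWave k a η) t x + dx 3 (planeWave k a η) t x =
      ((deriv η t : ℝ) * (a * osc (-freq k) t) * fourier (-k) x).re := by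
  rw [dt_planeWave k a hη, dx_planeWave, ← Complex.add_re]
  congr 1
  have h1 : (-(2 * Real.pi * k * Complex.I)) ^ 3 = freq k * Complex.I := by
    rw [freq]
    push_cast
    linear_combination (-(2 * Real.pi * k : ℂ) ^ 3 * Complex.I) * Complex.I_sq
  rw [h1]
  ring

theorem isTestFunction_planeWave (k : ℤ) (a : ℂ) {T : ℝ} {η : ℝ → ℝ} (hη : ContDiff ℝ ∞ η)
    (hs : ∃ b < T, ∀ t, b ≤ |t| → η t = 0) : IsTestFunction T (planeWave k a η) := by
  refine ⟨?_, ?_⟩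
  · have h1 : (fun p : ℝ × ℝ => planeWave k a η p.1 (p.2 : Torus)) = fun p : ℝ × ℝ =>
        Complex.reCLM ((η p.1 : ℂ) * (a * osc (-freq k) p.1) *
          Complex.exp (2 * Real.pi * Complex.I * (-k : ℤ) * p.2)) := by
      ext p
      rw [planeWave, fourier_coe_apply, Complex.reCLM_apply]
      simp
    rw [h1]
    refine Complex.reCLM.contDiff.comp ((ContDiff.mul ?_ (contDiff_const.mul ?_)).mul ?_)
    · exact Complex.ofRealCLM.contDiff.comp (hη.comp contDiff_fst)
    · exact (contDiff_osc _).comp contDiff_fst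
    · exact (contDiff_const.mul (Complex.ofRealCLM.contDiff.comp contDiff_snd)).cexp
  · obtain ⟨b, hb, hb0⟩ := hs
    exact ⟨b, hb, fun t x ht => by simp [planeWave, hb0 t ht]⟩

/-- Integrating a real function against a plane wave. -/
theorem integral_re_fourier_mul {f : Torus → ℝ} (hf : Integrable (fun x => (f x : ℂ)) haarAddCircle)
    (A : ℂ) (k : ℤ) : ∫ x, (A * fourier (-k) x).re * f x =
      (A * fourierCoeff (fun x => (f x : ℂ)) k).re := by
  rw [fourierCoeff, ← integral_const_mul, volume_torus]
  have h1 : ∀ x, (A * fourier (-k) x).re * f x = (A * (fourier (-k) x • (f x : ℂ))).re :=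
    fun x => by
      rw [smul_eq_mul, ← mul_assoc, Complex.re_mul_ofReal]
  simp only [h1]
  exact integral_re ((hf.fourier_smul (-k)).const_mul A)

end MKdV

namespace MKdV

open Filter Topology

/-! ### The time derivative controlled by the Bourgain norm -/

/-- Plancherel's identity between a Schwartz function and an `L²` function. -/
theorem integral_conj_schwartz_mul (ζ : SchwartzMap ℝ ℂ) (g : Lp ℂ 2 (volume : Measure ℝ)) :
    ∫ t, (starRingEnd ℂ) (ζ t) * g t =
      ∫ τ, (starRingEnd ℂ) (𝓕 (ζ : ℝ → ℂ) τ) * (𝓕 g : Lp ℂ 2 (volume : Measure ℝ)) τ := by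
  have h1 := Lp.inner_fourier_eq (ζ.toLp 2) g
  rw [SchwartzMap.toLp_fourier_eq, L2.inner_def, L2.inner_def] at h1
  have h2 : ∫ t, (starRingEnd ℂ) (ζ t) * g t = ∫ t, inner ℂ (ζ.toLp 2 volume t) (g t) := by
    refine integral_congr_ae ?_
    filter_upwards [ζ.coeFn_toLp 2 volume] with t ht
    rw [ht, RCLike.inner_apply, mul_comm]
  rw [h2, ← h1]
  refine integral_congr_ae ?_
  filter_upwards [(𝓕 ζ).coeFn_toLp 2 volume] with t ht
  rw [ht, RCLike.inner_apply, mul_comm, SchwartzMap.fourier_coe]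

/-- If the Fourier transform of `f ∈ L²(ℝ)` is square integrable for the weight
`⟨2πτ - Ω⟩²`, then `e^{-iΩt} f` has a weak derivative `e^{-iΩt} W` whose `L²` norm is bounded by
the weighted norm. -/
theorem exists_weak_deriv {f : ℝ → ℂ} (hf : MemLp f 2 volume) (Ω : ℝ)
    (h : ∫⁻ τ, ENNReal.ofReal (bracketSq (2 * Real.pi * τ - Ω)) *
      ‖(𝓕 hf.toLp : Lp ℂ 2 (volume : Measure ℝ)) τ‖ₑ ^ 2 ≠ ⊤) :
    ∃ W : ℝ → ℂ, MemLp W 2 volume ∧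
      ∫⁻ t, ‖W t‖ₑ ^ 2 ≤ ∫⁻ τ, ENNReal.ofReal (bracketSq (2 * Real.pi * τ - Ω)) *
        ‖(𝓕 hf.toLp : Lp ℂ 2 (volume : Measure ℝ)) τ‖ₑ ^ 2 ∧
      ∀ ρ : ℝ → ℝ, ContDiff ℝ ∞ ρ → HasCompactSupport ρ →
        ∫ t, (ρ t : ℂ) * (osc (-Ω) t * W t) =
          -∫ t, ((deriv ρ t : ℝ) : ℂ) * (osc (-Ω) t * f t) := by
  set F : Lp ℂ 2 (volume : Measure ℝ) := 𝓕 hf.toLp with hF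
  let m : ℝ → ℂ := fun τ => ((2 * Real.pi * τ - Ω : ℝ) : ℂ) * Complex.I
  have hm : Continuous m := by fun_prop
  have hmF : ∀ τ, ‖m τ * F τ‖ₑ ^ 2 ≤
      ENNReal.ofReal (bracketSq (2 * Real.pi * τ - Ω)) * ‖F τ‖ₑ ^ 2 := fun τ => by
    rw [enorm_mul, mul_pow]
    gcongr
    rw [← ofReal_norm, ← ENNReal.ofReal_pow (norm_nonneg _)]
    refine ENNReal.ofReal_le_ofReal ?_
    simp only [m, norm_mul, Complex.norm_I, mul_one, Complex.norm_real, Real.norm_eq_abs, sq_abs,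
      bracketSq]
    linarith
  have hsq : ∀ g : ℝ → ℂ, eLpNorm g 2 volume ^ 2 = ∫⁻ t, ‖g t‖ₑ ^ 2 := fun g => by
    have := eLpNorm_nnreal_pow_eq_lintegral (f := g) (μ := volume) (p := 2) (by norm_num)
    simpa using this
  have hmem : MemLp (fun τ => m τ * F τ) 2 volume := by
    refine ⟨hm.aestronglyMeasurable.mul (Lp.aestronglyMeasurable F), ?_⟩
    have h1 : eLpNorm (fun τ => m τ * F τ) 2 volume ^ 2 < ⊤ := by
      rw [hsq]
      exact (lintegral_mono hmF).trans_lt h.lt_top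
    by_contra h2
    rw [not_lt, top_le_iff] at h2
    rw [h2] at h1
    simp at h1
  let W : Lp ℂ 2 (volume : Measure ℝ) := 𝓕⁻ hmem.toLp
  have hW : (𝓕 W : Lp ℂ 2 (volume : Measure ℝ)) = hmem.toLp := FourierTransform.fourier_fourierInv_eq _
  refine ⟨W, Lp.memLp W, ?_, fun ρ hρ hρc => ?_⟩
  · rw [← hsq]
    have h1 : eLpNorm W 2 volume = eLpNorm (fun τ => m τ * F τ) 2 volume := by
      have h2 := Lp.norm_fourier_eq W
      rw [hW, Lp.norm_toLp, Lp.norm_def] at h2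
      exact ((ENNReal.toReal_eq_toReal_iff' hmem.eLpNorm_ne_top (Lp.eLpNorm_ne_top W)).1 h2).symm
    rw [h1, hsq]
    exact lintegral_mono hmF
  have hρ' : ContDiff ℝ ∞ (fun t => (ρ t : ℂ)) := Complex.ofRealCLM.contDiff.comp hρ
  have hρc' : HasCompactSupport (fun t => (ρ t : ℂ)) :=
    hρc.comp_left (g := fun r : ℝ => (r : ℂ)) Complex.ofReal_zero
  have hz : ContDiff ℝ ∞ (fun t => (ρ t : ℂ) * osc Ω t) := hρ'.mul (contDiff_osc Ω)
  have hzc : HasCompactSupport (fun t => (ρ t : ℂ) * osc Ω t) := hρc'.mul_right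
  have hd : ContDiff ℝ ∞ (fun t => ((deriv ρ t : ℝ) : ℂ) * osc Ω t) :=
    (Complex.ofRealCLM.contDiff.comp (contDiff_infty_iff_deriv.1 hρ).2).mul (contDiff_osc Ω)
  have hdc : HasCompactSupport (fun t => ((deriv ρ t : ℝ) : ℂ) * osc Ω t) :=
    (hρc.deriv.comp_left (g := fun r : ℝ => (r : ℂ)) Complex.ofReal_zero).mul_right
  let ζ : SchwartzMap ℝ ℂ := hzc.toSchwartzMap hz
  let ξ : SchwartzMap ℝ ℂ := hdc.toSchwartzMap hd
  have hζd : ∀ t, HasDerivAt (ζ : ℝ → ℂ) (ξ t + Ω * Complex.I * ζ t) t := fun t => by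
    have h1 := ((hρ.differentiable (by simp) t).hasDerivAt.ofReal_comp).mul (hasDerivAt_osc Ω t)
    have h2 : ((deriv ρ t : ℝ) : ℂ) * osc Ω t + (ρ t : ℂ) * (Ω * Complex.I * osc Ω t) =
        ξ t + Ω * Complex.I * ζ t := by
      change _ = ((deriv ρ t : ℝ) : ℂ) * osc Ω t + Ω * Complex.I * ((ρ t : ℂ) * osc Ω t)
      ring
    rw [h2] at h1
    exact h1
  have hderiv : deriv (ζ : ℝ → ℂ) = fun t => ξ t + Ω * Complex.I * ζ t :=
    funext fun t => (hζd t).deriv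
  have hξ : ∀ τ, 𝓕 (ξ : ℝ → ℂ) τ = m τ * 𝓕 (ζ : ℝ → ℂ) τ := fun τ => by
    have hi : Integrable (deriv (ζ : ℝ → ℂ)) := by
      rw [hderiv]
      exact ξ.integrable.add (ζ.integrable.const_mul _)
    have h1 := congrFun (Real.fourier_deriv ζ.integrable (fun t => (hζd t).differentiableAt) hi) τ
    have h2 : 𝓕 (deriv (ζ : ℝ → ℂ)) τ =
        𝓕 (ξ : ℝ → ℂ) τ + Ω * Complex.I * 𝓕 (ζ : ℝ → ℂ) τ := by
      rw [hderiv, Real.fourier_eq, Real.fourier_eq, Real.fourier_eq, ← integral_const_mul,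
        ← integral_add]
      · refine integral_congr_ae (ae_of_all _ fun t => ?_)
        simp only [smul_add, Circle.smul_def, smul_eq_mul]
        ring
      · exact (Real.fourierIntegral_convergent_iff τ).2 ξ.integrable
      · exact ((Real.fourierIntegral_convergent_iff τ).2 ζ.integrable).const_mul _
    rw [h2] at h1
    simp only [smul_eq_mul] at h1
    simp only [m]
    push_cast
    linear_combination h1
  have h1 : ∀ t, (ρ t : ℂ) * (osc (-Ω) t * W t) = (starRingEnd ℂ) (ζ t) * W t := fun t => by
    change _ = (starRingEnd ℂ) ((ρ t : ℂ) * osc Ω t) * W t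
    rw [map_mul, conj_osc, Complex.conj_ofReal, mul_assoc]
  have h2 : ∫ t, ((deriv ρ t : ℝ) : ℂ) * (osc (-Ω) t * f t) =
      ∫ t, (starRingEnd ℂ) (ξ t) * (hf.toLp f) t := by
    refine integral_congr_ae ?_
    filter_upwards [hf.coeFn_toLp] with t ht
    rw [ht]
    change _ = (starRingEnd ℂ) (((deriv ρ t : ℝ) : ℂ) * osc Ω t) * f t
    rw [map_mul, conj_osc, Complex.conj_ofReal, mul_assoc]
  rw [h2]
  simp only [h1]
  rw [integral_conj_schwartz_mul, integral_conj_schwartz_mul, hW, ← hF, ← integral_neg]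
  refine integral_congr_ae ?_
  filter_upwards [hmem.coeFn_toLp] with τ hτ
  rw [hτ, hξ, map_mul]
  have h3 : (starRingEnd ℂ) (m τ) = -m τ := by
    simp only [m, map_mul, Complex.conj_ofReal, Complex.conj_I]
    ring
  rw [h3]
  ring

end MKdV

namespace MKdV

open AddCircle Filter Topology

/-! ### The profiles of a solution -/

theorem sobolevNorm_eq_hNorm (s : ℝ) {f : Torus → ℂ} (hf : Integrable f haarAddCircle) :
    sobolevNorm s f = hNorm s fun k => ‖fourierCoeff f k‖ₑ := by
  rw [sobolevNorm, if_pos (by rwa [volume_torus])]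
  rfl

theorem integrable_of_sobolevNorm_ne_top {s : ℝ} {f : Torus → ℂ} (hf : sobolevNorm s f ≠ ⊤) :
    Integrable f haarAddCircle := by
  by_contra h
  rw [sobolevNorm, if_neg (by rwa [volume_torus])] at hf
  exact hf rfl

theorem aestronglyMeasurable_fourierCoeff {μ : Measure ℝ} [SFinite μ] {w : ℝ → Torus → ℂ}
    (hw : AEStronglyMeasurable (fun p : ℝ × Torus => w p.1 p.2) (μ.prod volume)) (k : ℤ) :
    AEStronglyMeasurable (fun t => fourierCoeff (w t) k) μ := by
  rw [volume_torus] at hw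
  refine AEStronglyMeasurable.integral_prod_right' (f := fun p : ℝ × Torus =>
    fourier (-k) p.2 • w p.1 p.2) ?_
  exact (by fun_prop : Continuous fun p : ℝ × Torus => fourier (-k) p.2).aestronglyMeasurable.smul hw

theorem aestronglyMeasurable_nonlinearity {μ : Measure ℝ} [SFinite μ] {u : ℝ → Torus → ℝ}
    (hu : AEStronglyMeasurable (fun p : ℝ × Torus => u p.1 p.2) (μ.prod volume)) :
    AEStronglyMeasurable (fun p : ℝ × Torus => (nonlinearity (u p.1) p.2 : ℂ))
      (μ.prod volume) := by
  refine Complex.continuous_ofReal.comp_aestronglyMeasurable ?_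
  have h1 : AEStronglyMeasurable (fun t => ∫ y, u t y ^ 2) μ :=
    AEStronglyMeasurable.integral_prod_right' (f := fun p : ℝ × Torus => u p.1 p.2 ^ 2) (hu.pow 2)
  exact (hu.pow 3).sub ((h1.comp_fst.const_mul 3).mul hu)

theorem fourierCoeff_neg_of_real (f : Torus → ℝ) (k : ℤ) :
    fourierCoeff (fun x => (f x : ℂ)) (-k) =
      (starRingEnd ℂ) (fourierCoeff (fun x => (f x : ℂ)) k) := by
  have h := fourierCoeff_conj (fun x => (f x : ℂ)) (-k)
  simpa only [Complex.conj_ofReal, neg_neg] using h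

/-- A closed set containing almost every point of `]0, T[` contains `[0, T]`. -/
theorem Icc_subset_of_ae {T : ℝ} (hT : 0 < T) {S : Set ℝ} (hS : IsClosed S)
    (h : ∀ᵐ t, t ∈ Ioo 0 T → t ∈ S) : Icc 0 T ⊆ S := by
  have h1 : Ioo 0 T \ S = ∅ := by
    refine (isOpen_Ioo.sdiff hS).eq_empty_of_measure_zero (μ := volume) ?_
    have h2 : {t | ¬(t ∈ Ioo 0 T → t ∈ S)} = Ioo 0 T \ S := by
      ext t; simp [Classical.not_imp, and_assoc]
    rw [← h2]
    exact h
  rw [← closure_Ioo hT.ne]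
  exact hS.closure_subset_iff.2 (sdiff_eq_empty.1 h1)

/-- The coefficient `e^{-i(2πk)³t} û(t, k)`, in which the linear evolution is undone. -/
def modCoeff (u : ℝ → Torus → ℂ) (k : ℤ) (t : ℝ) : ℂ := osc (-freq k) t * fourierCoeff (u t) k

/-- The right-hand side of the equation for `modCoeff u k` on `]0, T[`, extended by zero. -/
def modForcing (T : ℝ) (u : ℝ → Torus → ℝ) (k : ℤ) : ℝ → ℂ :=
  (Ioo 0 T).indicator fun t => -(2 * Real.pi * k * Complex.I) *
    (osc (-freq k) t * fourierCoeff (fun x => (nonlinearity (u t) x : ℂ)) k)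

theorem enorm_modCoeff (u : ℝ → Torus → ℂ) (k : ℤ) (t : ℝ) :
    ‖modCoeff u k t‖ₑ = ‖fourierCoeff (u t) k‖ₑ := by
  rw [modCoeff, enorm_mul, ← ofReal_norm, norm_osc, ENNReal.ofReal_one, one_mul]

theorem fourierCoeff_eq_osc_mul_modCoeff (u : ℝ → Torus → ℂ) (k : ℤ) (t : ℝ) :
    fourierCoeff (u t) k = osc (freq k) t * modCoeff u k t := by
  rw [modCoeff, ← mul_assoc, mul_comm (osc _ _), osc_neg_mul, one_mul]

theorem modCoeff_neg (u : ℝ → Torus → ℝ) (k : ℤ) (t : ℝ) :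
    modCoeff (toComplex u) (-k) t = (starRingEnd ℂ) (modCoeff (toComplex u) k t) := by
  rw [modCoeff, modCoeff, map_mul, conj_osc, freq_neg]
  exact congrArg _ (fourierCoeff_neg_of_real (u t) k)

/-- The initial value plus the primitive of the forcing: the continuous representative of
`modCoeff u k` on `[0, T]`. -/
def profile (T : ℝ) (u₀ : Torus → ℝ) (u : ℝ → Torus → ℝ) (k : ℤ) (t : ℝ) : ℂ :=
  fourierCoeff (fun x => (u₀ x : ℂ)) k + ∫ r in 0..t, modForcing T u k r

theorem profile_zero (T : ℝ) (u₀ : Torus → ℝ) (u : ℝ → Torus → ℝ) (k : ℤ) :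
    profile T u₀ u k 0 = fourierCoeff (fun x => (u₀ x : ℂ)) k := by
  simp [profile]

namespace IsSolution

variable {T s : ℝ} {u₀ : Torus → ℝ} {u : ℝ → Torus → ℝ}

theorem ae_regular (h : IsSolution T s u₀ u) : ∀ᵐ t, t ∈ Ioo 0 T →
    Integrable (toComplex u t) haarAddCircle ∧ hNorm s (fun k => ‖fourierCoeff (toComplex u t) k‖ₑ) ≤
      linftySobolevNorm (Ioo 0 T) s (toComplex u) := by
  have h1 := ENNReal.ae_le_essSup (μ := volume.restrict (Ioo 0 T))
    (fun t => sobolevNorm s (toComplex u t))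
  filter_upwards [(ae_restrict_iff' measurableSet_Ioo).1 h1] with t ht htT
  have h2 : sobolevNorm s (toComplex u t) ≤ linftySobolevNorm (Ioo 0 T) s (toComplex u) := ht htT
  have h3 := integrable_of_sobolevNorm_ne_top (ne_top_of_le_ne_top h.bounded.ne h2)
  exact ⟨h3, by rwa [← sobolevNorm_eq_hNorm s h3]⟩

theorem integrableOn_modCoeff (hs : 1 / 6 < s) (h : IsSolution T s u₀ u) (k : ℤ) :
    IntegrableOn (modCoeff (toComplex u) k) (Ioo 0 T) := by
  refine Integrable.of_bound (μ := volume.restrict (Ioo 0 T)) ?_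
    (linftySobolevNorm (Ioo 0 T) s (toComplex u)).toReal ?_
  · exact (continuous_osc _).aestronglyMeasurable.mul (aestronglyMeasurable_fourierCoeff
      (Complex.continuous_ofReal.comp_aestronglyMeasurable h.aestronglyMeasurable) k)
  · refine (ae_restrict_iff' measurableSet_Ioo).2 ?_
    filter_upwards [h.ae_regular] with t ht htT
    rw [← toReal_enorm, enorm_modCoeff]
    exact ENNReal.toReal_mono h.bounded.ne
      ((le_hNorm (by linarith) (fun k => ‖fourierCoeff (toComplex u t) k‖ₑ) k).trans (ht htT).2)

theorem integrable_modForcing (hs : 1 / 6 < s) (h : IsSolution T s u₀ u) (k : ℤ) :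
    Integrable (modForcing T u k) := by
  rw [modForcing, integrable_indicator_iff measurableSet_Ioo]
  rcases eq_or_ne k 0 with rfl | hk
  · simp
  refine Integrable.const_mul ?_ _
  obtain ⟨C, hC⟩ := exists_enorm_fourierCoeff_nonlinearity_le hs
  refine Integrable.of_bound (μ := volume.restrict (Ioo 0 T)) ?_
    (C * linftySobolevNorm (Ioo 0 T) s (toComplex u) ^ 3).toReal ?_
  · exact (continuous_osc _).aestronglyMeasurable.mul (aestronglyMeasurable_fourierCoeff
      (aestronglyMeasurable_nonlinearity h.aestronglyMeasurable) k)
  · refine (ae_restrict_iff' measurableSet_Ioo).2 ?_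
    filter_upwards [h.ae_regular] with t ht htT
    rw [norm_mul, norm_osc, one_mul, ← toReal_enorm]
    refine ENNReal.toReal_mono (ENNReal.mul_ne_top ENNReal.coe_ne_top
      (ENNReal.pow_ne_top h.bounded.ne)) ?_
    refine (hC (u t) (ht htT).1 ((ht htT).2.trans_lt h.bounded) k hk).trans ?_
    gcongr
    exact (ht htT).2

/-- The weak formulation tested with plane waves. -/
theorem weak_modCoeff (hs : 1 / 6 < s) (h : IsSolution T s u₀ u) (k : ℤ) {η : ℝ → ℝ}
    (hη : ContDiff ℝ ∞ η) (hηs : ∃ a < T, ∀ t, a ≤ |t| → η t = 0) :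
    (∫ t in Ioo 0 T, (((deriv η t : ℝ) : ℂ) * modCoeff (toComplex u) k t +
      η t * modForcing T u k t)) + η 0 * fourierCoeff (fun x => (u₀ x : ℂ)) k = 0 := by
  set I : ℝ → ℂ := fun t => ((deriv η t : ℝ) : ℂ) * modCoeff (toComplex u) k t +
    η t * modForcing T u k t with hI
  have hIi : IntegrableOn I (Ioo 0 T) :=
    ((h.integrableOn_modCoeff hs k).ofReal_mul (hη.continuous_deriv (by simp))).add
      ((h.integrable_modForcing hs k).integrableOn.ofReal_mul hη.continuous)
  have hmul : ∀ {f : Torus → ℝ}, Integrable (fun x => (f x : ℂ)) haarAddCircle → ∀ A : ℂ,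
      Integrable (fun x => (A * fourier (-k) x).re * f x) (volume : Measure Torus) := by
    intro f hf A
    rw [volume_torus]
    have h1 := ((hf.fourier_smul (-k)).const_mul A).re
    refine h1.congr (ae_of_all _ fun x => ?_)
    simp only [smul_eq_mul, RCLike.re_to_complex]
    rw [← mul_assoc, Complex.re_mul_ofReal]
  have hre : ∀ a : ℂ, (a * ((∫ t in Ioo 0 T, I t) +
      η 0 * fourierCoeff (fun x => (u₀ x : ℂ)) k)).re = 0 := by
    intro a
    have h1 := h.weak _ (isTestFunction_planeWave k a hη hηs)
    have h2 : ∫ t in Ioo 0 T, ∫ x : Torus, ((dt (planeWave k a η) t x + dx 3 (planeWave k a η) t x) *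
        u t x + dx 1 (planeWave k a η) t x * nonlinearity (u t) x) =
        ∫ t in Ioo 0 T, (a * I t).re := by
      refine setIntegral_congr_ae measurableSet_Ioo ?_
      filter_upwards [h.ae_regular] with t ht htT
      have hu := (ht htT).1
      have hN : Integrable (fun x => (nonlinearity (u t) x : ℂ)) haarAddCircle :=
        integrable_nonlinearity hs hu ((ht htT).2.trans_lt h.bounded)
      simp only [dt_add_dx_planeWave k a (hη.differentiable (by simp))]
      simp only [dx_planeWave]
      rw [integral_add (hmul hu _) (hmul hN _), integral_re_fourier_mul hu,
        integral_re_fourier_mul hN, ← Complex.add_re]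
      congr 1
      simp only [hI, modForcing, indicator_of_mem htT, modCoeff]
      change _ * fourierCoeff (toComplex u t) k + _ = _
      ring
    have h3 : ∫ t in Ioo 0 T, (a * I t).re = (a * ∫ t in Ioo 0 T, I t).re := by
      rw [← integral_const_mul]
      exact integral_re (hIi.const_mul a)
    have h4 : ∫ x, planeWave k a η 0 x * u₀ x =
        (a * (η 0 * fourierCoeff (fun x => (u₀ x : ℂ)) k)).re := by
      have h5 := integral_re_fourier_mul (integrable_of_sobolevNorm_ne_top h.datum.ne)
        (η 0 * (a * osc (-freq k) 0)) k
      rw [osc_zero] at h5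
      simp only [planeWave, osc_zero]
      rw [h5]
      congr 1
      ring
    rw [h2, h3, h4, ← Complex.add_re, ← mul_add] at h1
    exact h1
  -- the factors `1` and `-i` give the real and the imaginary part
  refine Complex.ext ?_ ?_
  · simpa using hre 1
  · have := hre (-Complex.I)
    rw [neg_mul, Complex.neg_re, Complex.I_mul_re, neg_neg] at this
    exact this

theorem ae_profile_eq (hT : 0 < T) (hs : 1 / 6 < s) (h : IsSolution T s u₀ u) :
    ∀ᵐ t, t ∈ Ioo 0 T → ∀ k, modCoeff (toComplex u) k t = profile T u₀ u k t := by
  have h1 : ∀ k, ∀ᵐ t, t ∈ Ioo 0 T → modCoeff (toComplex u) k t = profile T u₀ u k t := fun k =>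
    ae_eq_integral_of_weak hT (h.integrableOn_modCoeff hs k) (h.integrable_modForcing hs k) _
      fun η hη hηs => h.weak_modCoeff hs k hη hηs
  filter_upwards [ae_all_iff.2 h1] with t ht htT k using ht k htT

theorem isProfile (hT : 0 < T) (hs : 1 / 6 < s) (h : IsSolution T s u₀ u) {X : ℝ≥0∞}
    (hX : ∑' k, br (s - 11 / 10) k * ∫⁻ r in Ioc 0 T, ‖modForcing T u k r‖ₑ ^ 2 ≤ X ^ 2) :
    IsProfile T s (linftySobolevNorm (Ioo 0 T) s (toComplex u)) X (profile T u₀ u)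
      (modForcing T u) := by
  classical
  have hae := h.ae_profile_eq hT hs
  have hcont : ∀ k, Continuous (profile T u₀ u k) := fun k =>
    continuous_const.add (intervalIntegral.continuous_primitive
      (fun _ _ => (h.integrable_modForcing hs k).intervalIntegrable) 0)
  have hIoc : ∀ᵐ t : ℝ, t ∈ Ioc 0 T → t ∈ Ioo 0 T := by
    have : ∀ᵐ t : ℝ, t ≠ T := by simp [ae_iff]
    filter_upwards [this] with t ht htT using ⟨htT.1, lt_of_le_of_ne htT.2 ht⟩
  refine ⟨h.integrable_modForcing hs, fun k t => by rw [profile_zero, profile], fun k t ht => ?_,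
    fun t ht => ?_, h.bounded.ne, hX, ?_⟩
  · refine Icc_subset_of_ae hT (S := {t | profile T u₀ u (-k) t =
      (starRingEnd ℂ) (profile T u₀ u k t)}) (isClosed_eq (hcont _)
        (Complex.continuous_conj.comp (hcont k))) ?_ ht
    filter_upwards [hae] with r hr hrT
    rw [← hr hrT, ← hr hrT, modCoeff_neg]
  · refine (ENNReal.pow_le_pow_left_iff two_ne_zero).1 ?_
    rw [hNorm_sq, ENNReal.tsum_eq_iSup_sum]
    refine iSup_le fun B => ?_
    refine Icc_subset_of_ae hT (S := {t | ∑ k ∈ B, br s k * ‖profile T u₀ u k t‖ₑ ^ 2 ≤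
      linftySobolevNorm (Ioo 0 T) s (toComplex u) ^ 2}) (isClosed_le ?_ continuous_const) ?_ ht
    · exact continuous_finsetSum _ fun k _ => (ENNReal.continuous_const_mul (br_ne_top s k)).comp
        ((ENNReal.continuous_pow 2).comp (hcont k).enorm)
    · filter_upwards [hae, h.ae_regular] with r hr hr2 hrT
      refine (ENNReal.sum_le_tsum B).trans ?_
      simp only [← hr hrT, enorm_modCoeff]
      rw [← hNorm_sq]
      gcongr
      exact (hr2 hrT).2
  · filter_upwards [hae, h.ae_regular, hIoc] with r hr hr2 hrIoc hrT k
    have hrT := hrIoc hrT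
    obtain ⟨hu, hA⟩ := hr2 hrT
    simp only [← hr hrT]
    rcases eq_or_ne k 0 with rfl | hk
    · exact ⟨0, by simp [modForcing]⟩
    -- `û(-k)` is the conjugate of `û(k)`, so the resonant term is a real multiple of `i û(k)`
    refine ⟨6 * Real.pi * k * ‖modCoeff (toComplex u) k r‖ ^ 2, ?_⟩
    rw [modForcing, indicator_of_mem hrT,
      fourierCoeff_nonlinearity hs hu (hA.trans_lt h.bounded) hk]
    change -(2 * Real.pi * k * Complex.I) * (osc (-freq k) r * ((∑' q : ℤ × ℤ,
      if Nonres (-k, q) then fourierCoeff (toComplex u r) q.1 * fourierCoeff (toComplex u r) q.2 *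
        fourierCoeff (toComplex u r) (last (-k, q)) else 0) -
      3 * fourierCoeff (toComplex u r) k ^ 2 * fourierCoeff (toComplex u r) (-k))) = _
    simp only [fourierCoeff_eq_osc_mul_modCoeff (toComplex u)]
    rw [mul_sub, ← tsum_mul_left]
    have h1 : (∑' q : ℤ × ℤ, osc (-freq k) r * if Nonres (-k, q) then
        osc (freq q.1) r * modCoeff (toComplex u) q.1 r *
          (osc (freq q.2) r * modCoeff (toComplex u) q.2 r) *
          (osc (freq (last (-k, q))) r * modCoeff (toComplex u) (last (-k, q)) r) else 0) =
        ∑' q : ℤ × ℤ, if Nonres (-k, q) then osc (reson (-k, q)) r *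
          (modCoeff (toComplex u) q.1 r * modCoeff (toComplex u) q.2 r *
            modCoeff (toComplex u) (last (-k, q)) r) else 0 := by
      refine tsum_congr fun q => ?_
      split_ifs
      · rw [reson, osc_add, osc_add, osc_add, freq_neg]
        ring
      · rw [mul_zero]
    rw [h1, modCoeff_neg, freq_neg]
    have h2 := osc_neg_mul (freq k) r
    have h3 := Complex.mul_conj' (modCoeff (toComplex u) k r)
    push_cast
    linear_combination (6 * Real.pi * k * Complex.I * modCoeff (toComplex u) k r ^ 2 *
      (starRingEnd ℂ) (modCoeff (toComplex u) k r) *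
      (osc (-freq k) r * osc (freq k) r + 1)) * h2 +
      (6 * Real.pi * k * Complex.I * modCoeff (toComplex u) k r) * h3

end IsSolution

end MKdV

namespace MKdV

open AddCircle Filter Topology

/-! ### Comparison with the extensions of a solution -/

theorem IsExtension.ae_eq_slice {T : ℝ} {u v : ℝ → Torus → ℂ} (h : IsExtension T u v) :
    ∀ᵐ t, t ∈ Ioo 0 T → v t =ᵐ[haarAddCircle] u t := by
  have h1 := Measure.ae_ae_of_ae_prod h.ae_eq
  rw [volume_torus] at h1
  exact (ae_restrict_iff' measurableSet_Ioo).1 h1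

theorem sobolevNorm_congr {s : ℝ} {f g : Torus → ℂ} (h : f =ᵐ[haarAddCircle] g) :
    sobolevNorm s f = sobolevNorm s g := by
  classical
  have h1 : Integrable f (volume : Measure Torus) ↔ Integrable g volume := by
    rw [volume_torus]; exact integrable_congr h
  rw [sobolevNorm, sobolevNorm, fourierCoeff_congr_ae h]
  exact if_congr h1 rfl rfl

theorem IsExtension.linftySobolevNorm_le {T : ℝ} {u v : ℝ → Torus → ℂ} (h : IsExtension T u v)
    (s : ℝ) : linftySobolevNorm (Ioo 0 T) s u ≤ linftySobolevNorm univ s v := by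
  have h1 : linftySobolevNorm (Ioo 0 T) s u = linftySobolevNorm (Ioo 0 T) s v := by
    refine essSup_congr_ae ((ae_restrict_iff' measurableSet_Ioo).2 ?_)
    filter_upwards [h.ae_eq_slice] with t ht htT using sobolevNorm_congr (ht htT).symm
  rw [h1]
  exact essSup_mono_measure (Measure.restrict_mono (subset_univ _) le_rfl).absolutelyContinuous

/-- The Duhamel forcing is controlled by the Bourgain norm of any extension. -/
theorem IsSolution.tsum_modForcing_le {T s : ℝ} {u₀ : Torus → ℝ} {u : ℝ → Torus → ℝ}
    (hs : 1 / 6 < s) (h : IsSolution T s u₀ u) {v : ℝ → Torus → ℂ}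
    (hv : IsExtension T (toComplex u) v) {r : ℝ} (hr : bourgainNorm r 1 v ≠ ⊤) :
    ∑' k, br r k * ∫⁻ t in Ioc 0 T, ‖modForcing T u k t‖ₑ ^ 2 ≤ bourgainNorm r 1 v ^ 2 := by
  have hmem : ∀ k : ℤ, MemLp (fun t : ℝ => fourierCoeff (v t) k) 2 volume := by
    by_contra hc
    rw [bourgainNorm, dif_neg hc] at hr
    exact hr rfl
  set E : ℤ → ℝ≥0∞ := fun k => ∫⁻ τ : ℝ, ENNReal.ofReal (bracketSq (2 * Real.pi * τ - freq k)) *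
    ‖(𝓕 (hmem k).toLp : Lp ℂ 2 (volume : Measure ℝ)) τ‖ₑ ^ 2 with hE
  have hnorm : bourgainNorm r 1 v ^ 2 = ∑' k, br r k * E k := by
    rw [bourgainNorm, dif_pos hmem, ← ENNReal.rpow_natCast, ← ENNReal.rpow_mul]
    norm_num
    refine tsum_congr fun k => ?_
    rw [hE, ← lintegral_const_mul' _ _ (br_ne_top r k)]
    refine lintegral_congr fun τ => ?_
    rw [ENNReal.ofReal_mul (bracketSq_pos _).le, br, freq]
    ring
  have hEtop : ∀ k, E k ≠ ⊤ := fun k hk => by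
    have h1 : br r k * E k ≤ bourgainNorm r 1 v ^ 2 := by
      rw [hnorm]
      exact ENNReal.le_tsum (f := fun k => br r k * E k) k
    have h2 : br r k ≠ 0 := by
      rw [br, Ne, ENNReal.ofReal_eq_zero, not_le]
      exact Real.rpow_pos_of_pos (bracketSq_pos _) _
    rw [hk, ENNReal.mul_top h2, top_le_iff] at h1
    exact ENNReal.pow_ne_top hr h1
  rw [hnorm]
  refine ENNReal.tsum_le_tsum fun k => mul_le_mul_right ?_ _
  obtain ⟨W, hW, hWle, hWd⟩ := exists_weak_deriv (hmem k) (freq k) (hEtop k)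
  refine le_trans ?_ hWle
  have hWi : LocallyIntegrable (fun t => osc (-freq k) t * W t) := by
    have h1 := hW.locallyIntegrable (by norm_num)
    have h2 := h1.locallyIntegrableOn univ
    rw [← locallyIntegrableOn_univ]
    exact h2.continuousOn_mul (continuous_osc _).continuousOn isOpen_univ.isLocallyClosed
  have hD : LocallyIntegrableOn (fun t => osc (-freq k) t * W t - modForcing T u k t)
      (Ioo 0 T) :=
    (hWi.sub (h.integrable_modForcing hs k).locallyIntegrable).locallyIntegrableOn _
  have hslice := hv.ae_eq_slice
  have hae := isOpen_Ioo.ae_eq_zero_of_integral_contDiff_smul_eq_zero hD fun ρ hρ hρc hρs => by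
    have hout : ∀ t, t ∉ Ioo 0 T → ρ t = 0 := fun t ht =>
      image_eq_zero_of_notMem_tsupport fun h' => ht (hρs h')
    have hdout : ∀ t, t ∉ Ioo 0 T → deriv ρ t = 0 := fun t ht =>
      image_eq_zero_of_notMem_tsupport fun h' => ht (hρs (tsupport_deriv_subset h'))
    obtain ⟨b, hbT, hb⟩ := exists_lt_of_tsupport_subset_Ioo hρc hρs
    have h1 := h.weak_modCoeff hs k hρ ⟨b, hbT, fun t ht => by
      rcases le_or_gt 0 t with h0 | h0
      · exact hb t (by rwa [abs_of_nonneg h0] at ht)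
      · exact hout t fun h' => by linarith [h'.1]⟩
    rw [hout 0 (by simp), Complex.ofReal_zero, zero_mul, add_zero, integral_add
      ((h.integrableOn_modCoeff hs k).ofReal_mul (hρ.continuous_deriv (by simp)))
      ((h.integrable_modForcing hs k).integrableOn.ofReal_mul hρ.continuous)] at h1
    have h2 := hWd ρ hρ hρc
    have h3 : ∫ t, ((deriv ρ t : ℝ) : ℂ) * (osc (-freq k) t * fourierCoeff (v t) k) =
        ∫ t in Ioo 0 T, ((deriv ρ t : ℝ) : ℂ) * modCoeff (toComplex u) k t := by
      rw [← integral_indicator measurableSet_Ioo]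
      refine integral_congr_ae ?_
      filter_upwards [hslice] with t ht
      by_cases htT : t ∈ Ioo 0 T
      · rw [indicator_of_mem htT, modCoeff, fourierCoeff_congr_ae (ht htT)]
      · rw [indicator_of_notMem htT, hdout t htT, Complex.ofReal_zero, zero_mul]
    have h4 : ∫ t, (ρ t : ℂ) * modForcing T u k t =
        ∫ t in Ioo 0 T, (ρ t : ℂ) * modForcing T u k t := by
      rw [setIntegral_eq_integral_of_forall_compl_eq_zero]
      intro t ht
      rw [hout t ht, Complex.ofReal_zero, zero_mul]
    have hi : ∀ F : ℝ → ℂ, LocallyIntegrable F → Integrable fun t => (ρ t : ℂ) * F t :=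
      fun F hF => by
        have := hF.integrable_smul_left_of_hasCompactSupport hρ.continuous hρc
        simpa only [Complex.real_smul] using this
    simp only [Complex.real_smul, mul_sub]
    rw [integral_sub (hi _ hWi) (hi _ (h.integrable_modForcing hs k).locallyIntegrable), h2, h3, h4]
    linear_combination -h1
  rw [← lintegral_indicator measurableSet_Ioc]
  refine lintegral_mono_ae ?_
  have hneT : ∀ᵐ t : ℝ, t ≠ T := by simp [ae_iff]
  filter_upwards [hae, hneT] with t ht hne
  by_cases htT : t ∈ Ioc 0 T
  · rw [indicator_of_mem htT, ← sub_eq_zero.1 (ht ⟨htT.1, lt_of_le_of_ne htT.2 hne⟩), enorm_mul,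
      ← ofReal_norm (osc _ _), norm_osc, ENNReal.ofReal_one, one_mul]
  · rw [indicator_of_notMem htT]
    exact zero_le

/-- The energy estimate, with the norm of an arbitrary extension on the right-hand side. -/
theorem exists_energy_estimate {s : ℝ} (hs : 1 / 6 < s) : ∃ C : ℝ≥0, ∀ (T : ℝ) (u₀ : Torus → ℝ)
    (u : ℝ → Torus → ℝ), 0 < T → T ≤ 1 → IsSolution T s u₀ u → ∀ v : ℝ → Torus → ℂ,
      IsExtension T (toComplex u) v → zNorm s v ≠ ⊤ →
      linftySobolevNorm (Ioo 0 T) s (toComplex u) ^ 2 ≤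
        C * (sobolevNorm s (fun x => (u₀ x : ℂ)) ^ 2 +
          ENNReal.ofReal (T ^ (1 / 8 : ℝ)) * zNorm s v ^ 4) := by
  obtain ⟨C, hC⟩ := exists_profile_estimate hs
  refine ⟨1 + 2 * C, fun T u₀ u hT hT1 h v hv hvZ => ?_⟩
  set M := linftySobolevNorm (Ioo 0 T) s (toComplex u) with hM
  set Z := zNorm s v with hZ
  set θ := ENNReal.ofReal (T ^ (1 / 8 : ℝ)) with hθ
  set S := sobolevNorm s fun x => (u₀ x : ℂ) with hS
  set X := bourgainNorm (s - 11 / 10) 1 v with hX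
  have hXZ : X ≤ Z := le_self_add
  have hMZ : M ≤ Z := (hv.linftySobolevNorm_le s).trans le_add_self
  have hP := h.isProfile hT hs (h.tsum_modForcing_le hs hv (ne_top_of_le_ne_top hvZ hXZ))
  have hS' : S = hNorm s fun k => ‖profile T u₀ u k 0‖ₑ := by
    simp only [profile_zero]
    exact sobolevNorm_eq_hNorm s (integrable_of_sobolevNorm_ne_top h.datum.ne)
  have hbound : ∀ᵐ t, t ∈ Ioo 0 T →
      sobolevNorm s (toComplex u t) ^ 2 ≤ (1 + 2 * C : ℝ≥0) * (S ^ 2 + θ * Z ^ 4) := by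
    filter_upwards [h.ae_regular, h.ae_profile_eq hT hs] with t ht htP htT
    have h1 : sobolevNorm s (toComplex u t) = hNorm s fun k => ‖profile T u₀ u k t‖ₑ := by
      rw [sobolevNorm_eq_hNorm s (ht htT).1]
      simp only [← htP htT, enorm_modCoeff]
    rw [h1]
    calc (hNorm s fun k => ‖profile T u₀ u k t‖ₑ) ^ 2
        ≤ S ^ 2 + C * (θ * (M ^ 4 + X * M ^ 3)) := by
          rw [hS']
          exact hC T M X _ _ hT hT1 hP t (Ioo_subset_Icc_self htT)
      _ ≤ S ^ 2 + C * (θ * (Z ^ 4 + Z * Z ^ 3)) := by gcongr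
      _ = 1 * S ^ 2 + (2 * C) * (θ * Z ^ 4) := by ring
      _ ≤ (1 + 2 * C) * S ^ 2 + (1 + 2 * C) * (θ * Z ^ 4) := by
          gcongr
          · exact le_self_add
          · exact le_add_self
      _ = _ := by push_cast; ring
  have h2 : M ≤ ((1 + 2 * C : ℝ≥0) * (S ^ 2 + θ * Z ^ 4)) ^ (1 / 2 : ℝ) := by
    refine essSup_le_of_ae_le _ ((ae_restrict_iff' measurableSet_Ioo).2 ?_)
    filter_upwards [hbound] with t ht htT
    have h3 := ENNReal.rpow_le_rpow (ht htT) (by norm_num : (0 : ℝ) ≤ 1 / 2)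
    rw [← ENNReal.rpow_natCast, ← ENNReal.rpow_mul] at h3
    norm_num at h3
    simpa using h3
  calc M ^ 2 ≤ (((1 + 2 * C : ℝ≥0) * (S ^ 2 + θ * Z ^ 4)) ^ (1 / 2 : ℝ)) ^ 2 := by gcongr
    _ = (1 + 2 * C : ℝ≥0) * (S ^ 2 + θ * Z ^ 4) := by
        rw [← ENNReal.rpow_natCast, ← ENNReal.rpow_mul]
        norm_num

end MKdV

end

theorem proposition3p9 (s : ℝ) (hs : 2 / 9 < s) :
    ∃ C : ℝ≥0, ∀ (T : ℝ) (u₀ : MKdV.Torus → ℝ) (u : ℝ → MKdV.Torus → ℝ),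
      0 < T → T ≤ 1 →
      MKdV.IsSolution T s u₀ u →
      MKdV.zNormT T s (MKdV.toComplex u) < ⊤ →
      MKdV.linftySobolevNorm (Ioo 0 T) s (MKdV.toComplex u) ^ 2 ≤
        C * (MKdV.sobolevNorm s (fun x => (u₀ x : ℂ)) ^ 2 +
          ENNReal.ofReal (T ^ (1 / 8 : ℝ)) * MKdV.zNormT T s (MKdV.toComplex u) ^ 4) := by
  obtain ⟨C, hC⟩ := MKdV.exists_energy_estimate (s := s) (by linarith)
  refine ⟨C, fun T u₀ u hT hT1 h hZ => ?_⟩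
  set Y := MKdV.zNormT T s (MKdV.toComplex u) with hY
  set A := MKdV.sobolevNorm s fun x => (u₀ x : ℂ)
  -- the right-hand side depends continuously on the norm, which is an infimum over extensions
  have hcont : Continuous fun y : ℝ≥0∞ =>
      (C : ℝ≥0∞) * (A ^ 2 + ENNReal.ofReal (T ^ (1 / 8 : ℝ)) * y ^ 4) :=
    (ENNReal.continuous_const_mul ENNReal.coe_ne_top).comp
      (continuous_const.add ((ENNReal.continuous_const_mul ENNReal.ofReal_ne_top).comp
        (ENNReal.continuous_pow 4)))
  have hne : (nhdsWithin Y (Ioi Y)).NeBot := nhdsGT_neBot_of_exists_gt ⟨⊤, hZ⟩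
  have hlim := (hcont.tendsto Y).mono_left (nhdsWithin_le_nhds (s := Ioi Y))
  refine ge_of_tendsto hlim ?_
  filter_upwards [self_mem_nhdsWithin] with y hy
  obtain ⟨v, hv⟩ := iInf_lt_iff.1 (show MKdV.zNormT T s (MKdV.toComplex u) < y from hy)
  obtain ⟨hext, hvy⟩ := iInf_lt_iff.1 hv
  refine (hC T u₀ u hT hT1 h v hext hvy.ne_top).trans ?_
  gcongr
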